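/- Notation. Let $r$ denote an odd prime, $\chi_0$ the principal character modulo $r$, and $\mathbb E_{\chi\ne\chi_0}F(\chi)=\frac1{r-2}\sum_{\chi\ne\chi_0}F(\chi)$, the sum being over the non-principal Dirichlet characters modulo $r$. Let $f$ be a Steinhaus random multiplicative function: $f$ is completely multiplicative and the values $f(p)$, $p$ prime, are independent and uniformly distributed on the unit circle. Put $f^\ast(n)=f(n)\mathbf 1_{\gcd(n,r)=1}$ and $L^\ast(s,f)=\sum_{n\ge1}f^\ast(n)n^{-s}$, so that formally $1/L^\ast(s,f)=\sum_{n\ge1}\mu(n)f^\ast(n)n^{-s}$. For a quotient of such series, $\mathbb E_f$ means: expand formally as a Dirichlet series and average each coefficient over $f$. Thus $$\mathbb E_f\frac{L^\ast(z_1,f)L^\ast(z_2,\bar f)}{L^\ast(s_1,f)L^\ast(s_2,\bar f)}=\sum_{m_1,m_2,n_1,n_2\ge1}\frac{\mathbb E\big[f^\ast(m_1)\overline{f^\ast(m_2)}\,\mu(n_1)f^\ast(n_1)\,\mu(n_2)\overline{f^\ast(n_2)}\big]}{m_1^{z_1}m_2^{z_2}n_1^{s_1}n_2^{s_2}}$$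 when all four variables have real part greater than $\frac12$, and the left side is extended by its meromorphic continuation to $\Re z_1=\Re z_2=\frac12$; and $$\mathbb E_f\frac{f^\ast(m_1)\overline{f^\ast}(m_2)}{L^\ast(s_1,f)L^\ast(s_2,\bar f)}=\sum_{n_1,n_2\ge1}\frac{\mathbb E\big[f^\ast(m_1)\overline{f^\ast(m_2)}\,\mu(n_1)f^\ast(n_1)\,\mu(n_2)\overline{f^\ast(n_2)}\big]}{n_1^{s_1}n_2^{s_2}}.$$ GRH. For every odd prime $r$ and every Dirichlet character $\chi$ modulo $r$ (including $\chi_0$, for which $L(s,\chi_0)=(1-r^{-s})\zeta(s)$), every zero of $L(s,\chi)$ with $0<\Re s<1$ satisfies $\Re s=\frac12$. Ratios Conjecture. There is an absolute constant $\omega\in(0,\frac12]$ such that for all sufficiently small $\varepsilon>0$, all odd primes $r$, all $z_1,z_2$ with $\Re z_1=\Re z_2=\frac12$ and $z_1+z_2\neq1$, and all $s_1,s_2$ with $\Re s_1=\Re s_2=\frac12+\varepsilon$, $$\mathbb E_{\chi\ne\chi_0}\frac{L(z_1,\chi)L(z_2,\bar\chi)}{L(s_1,\chi)L(s_2,\bar\chi)}=\mathbb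 E_f\frac{L^\ast(z_1,f)L^\ast(z_2,\bar f)}{L^\ast(s_1,f)L^\ast(s_2,\bar f)}+\frac{H}{r^{z_1+z_2-1}}\,\mathbb E_f\frac{L^\ast(1-z_2,f)L^\ast(1-z_1,\bar f)}{L^\ast(s_1,f)L^\ast(s_2,\bar f)}+O_\varepsilon\big((1+T)^\varepsilon r^{-\omega}\big),$$ where $T=\max(|\Im z_1|,|\Im z_2|,|\Im s_1|,|\Im s_2|)$ and $$H=\frac{(2\pi)^{z_1+z_2}}{\pi^2}\,\Gamma(1-z_1)\Gamma(1-z_2)\cdot\frac12\sum_{a\in\{0,1\}}\sin\big(\tfrac\pi2(1-z_1+a)\big)\sin\big(\tfrac\pi2(1-z_2+a)\big).$$ Theorem. Assume GRH and the Ratios Conjecture. Then there are absolute constants $\omega'\in(0,\frac12]$, $\varepsilon_0>0$ and $\hbar_0>0$ such that for all $0<\varepsilon<\varepsilon_0$ and $0<\hbar<\hbar_0$, all odd primes $r$, all integers $m_1,m_2$ with $1\le m_1,m_2\le r^{\hbar}$, and all $s_1,s_2$ with $\Re s_1=\Re s_2=\frac12+\varepsilon$, the double series defining $\mathbb E_f\frac{f^\ast(m_1)\overline{f^\ast}(m_2)}{L^\ast(s_1,f)L^\ast(s_2,\bar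 f)}$ converges absolutely and $$\mathbb E_{\chi\ne\chi_0}\frac{\chi(m_1)\bar\chi(m_2)}{L(s_1,\chi)L(s_2,\bar\chi)}=\mathbb E_f\frac{f^\ast(m_1)\overline{f^\ast}(m_2)}{L^\ast(s_1,f)L^\ast(s_2,\bar f)}+O_\varepsilon\big((1+T)^\varepsilon r^{-\omega'}\big),\qquad T=\max(|\Im s_1|,|\Im s_2|),$$ where the implied constant depends only on $\varepsilon$. -/

import Mathlib

/-- The Generalized Riemann Hypothesis for the family of all `L(s, χ)`, `χ` a Dirichlet character
modulo `r` (the principal character, with `L(s, χ₀) = (1 - r⁻ˢ) ζ(s)` for `r` prime, included):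
every zero in the critical strip lies on the critical line. -/
def GRHModulus (r : ℕ) [NeZero r] : Prop :=
  ∀ (χ : DirichletCharacter ℂ r) (s : ℂ), 0 < s.re → s.re < 1 →
    DirichletCharacter.LFunction χ s = 0 → s.re = 1 / 2

open scoped Classical in
/-- The average over the non-principal characters modulo a prime `r`:
`𝔼_{χ ≠ χ₀} F(χ) = (r - 2)⁻¹ ∑_{χ ≠ χ₀} F(χ)`. -/
noncomputable def charAvg (r : ℕ) [NeZero r] (F : DirichletCharacter ℂ r → ℂ) : ℂ :=
  1 / ((r : ℂ) - 2) * ∑ χ ∈ (Finset.univ : Finset (DirichletCharacter ℂ r)).erase 1, F χ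

/-- The sample space of the Steinhaus model: an angle `θ_p ∈ ℝ/ℤ` for every prime `p`. -/
abbrev SteinhausSpace : Type := Nat.Primes → UnitAddCircle

/-- The Steinhaus law: the angles `θ_p` are independent and uniformly distributed on `ℝ/ℤ`. -/
noncomputable def steinhausMeasure : MeasureTheory.Measure SteinhausSpace :=
  MeasureTheory.Measure.infinitePi fun _ : Nat.Primes =>
    (AddCircle.haarAddCircle : MeasureTheory.Measure UnitAddCircle)

/-- The Steinhaus expectation `𝔼_f` of a quantity depending on finitely many `f(p)`. -/
noncomputable def steinhausE (X : SteinhausSpace → ℂ) : ℂ :=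
  ∫ θ, X θ ∂steinhausMeasure

/-- The Steinhaus random multiplicative function: the completely multiplicative function `f` with
`f(p) = exp(2πi θ_p)` at every prime `p`. -/
noncomputable def steinhausF (θ : SteinhausSpace) (n : ℕ) : ℂ :=
  if n = 0 then 0
  else ∏ p ∈ n.primeFactors.attach,
    (AddCircle.toCircle (θ ⟨p.1, Nat.prime_of_mem_primeFactors p.2⟩) : ℂ) ^ n.factorization p.1

/-- `f*(n) = f(n) 1_{gcd(n, r) = 1}`. -/
noncomputable def fStar (r : ℕ) (θ : SteinhausSpace) (n : ℕ) : ℂ :=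
  if Nat.gcd n r = 1 then steinhausF θ n else 0

/-- `μ*_f(n) = μ(n) f*(n)`, the coefficients of `1 / L*(s, f)`, where
`L*(s, f) = ∑ f*(n) n⁻ˢ`. -/
noncomputable def muStar (r : ℕ) (θ : SteinhausSpace) (n : ℕ) : ℂ :=
  (ArithmeticFunction.moebius n : ℂ) * fStar r θ n

/-- The general term of the four-variable Dirichlet series
`𝔼_f [L*(z₁, f) L*(z₂, f̄) / (L*(s₁, f) L*(s₂, f̄))]`, obtained by expanding the quotient formally
and averaging each coefficient. (Terms with a zero index vanish, as `f*(0) = 0` for `r > 1`.) -/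
noncomputable def steinhausRatioTerm (r : ℕ) (z₁ z₂ s₁ s₂ : ℂ) (k : ℕ × ℕ × ℕ × ℕ) : ℂ :=
  steinhausE (fun θ => fStar r θ k.1 * starRingEnd ℂ (fStar r θ k.2.1) *
      muStar r θ k.2.2.1 * starRingEnd ℂ (muStar r θ k.2.2.2)) /
    ((k.1 : ℂ) ^ z₁ * (k.2.1 : ℂ) ^ z₂ * (k.2.2.1 : ℂ) ^ s₁ * (k.2.2.2 : ℂ) ^ s₂)

/-- `𝔼_f [L*(z₁, f) L*(z₂, f̄) / (L*(s₁, f) L*(s₂, f̄))]` on the closed region where all four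
variables have real part at least `1/2`. The Dirichlet series converges absolutely where all four
real parts exceed `1/2`; at a boundary point the value of its meromorphic continuation (wherever
that is holomorphic) is the limit of the series from inside, which is what `extendFrom` takes. -/
noncomputable def steinhausRatio (r : ℕ) (z₁ z₂ s₁ s₂ : ℂ) : ℂ :=
  extendFrom
    {p : ℂ × ℂ × ℂ × ℂ | 1 / 2 < p.1.re ∧ 1 / 2 < p.2.1.re ∧ 1 / 2 < p.2.2.1.re ∧
      1 / 2 < p.2.2.2.re}
    (fun p => ∑' k : ℕ × ℕ × ℕ × ℕ, steinhausRatioTerm r p.1 p.2.1 p.2.2.1 p.2.2.2 k)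
    (z₁, z₂, s₁, s₂)

/-- `H(z₁, z₂) = (2π)^{z₁+z₂} π⁻² Γ(1-z₁) Γ(1-z₂) ·
½ ∑_{a ∈ {0,1}} sin(π/2 (1-z₁+a)) sin(π/2 (1-z₂+a))`. -/
noncomputable def ratiosH (z₁ z₂ : ℂ) : ℂ :=
  (2 * (Real.pi : ℂ)) ^ (z₁ + z₂) / (Real.pi : ℂ) ^ 2 *
    Complex.Gamma (1 - z₁) * Complex.Gamma (1 - z₂) *
    ((∑ a ∈ Finset.range 2,
      Complex.sin ((Real.pi : ℂ) / 2 * (1 - z₁ + (a : ℂ))) *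
        Complex.sin ((Real.pi : ℂ) / 2 * (1 - z₂ + (a : ℂ)))) / 2)

/-- The main term of the Ratios Conjecture. -/
noncomputable def ratiosMainTerm (r : ℕ) (z₁ z₂ s₁ s₂ : ℂ) : ℂ :=
  steinhausRatio r z₁ z₂ s₁ s₂ +
    ratiosH z₁ z₂ / (r : ℂ) ^ (z₁ + z₂ - 1) * steinhausRatio r (1 - z₂) (1 - z₁) s₁ s₂

/-- The Ratios Conjecture for `L(z₁, χ) L(z₂, χ̄) / (L(s₁, χ) L(s₂, χ̄))`, with `χ` running over the
non-principal characters modulo an odd prime `r`: a power saving `ω` independent of `r` and `ε`, and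
an implied constant depending only on `ε`. On the line `z₁ + z₂ = 1` the two terms of the main term
have poles that cancel; that line is left out, since both sides are continuous across it. -/
def RatiosConjecture : Prop :=
  ∃ ω : ℝ, 0 < ω ∧ ω ≤ 1 / 2 ∧ ∃ ε₀ : ℝ, 0 < ε₀ ∧ ∀ ε : ℝ, 0 < ε → ε < ε₀ →
    ∃ C : ℝ, ∀ (r : ℕ) [Fact r.Prime], 2 < r →
      ∀ z₁ z₂ s₁ s₂ : ℂ, z₁.re = 1 / 2 → z₂.re = 1 / 2 → z₁ + z₂ ≠ 1 →
        s₁.re = 1 / 2 + ε → s₂.re = 1 / 2 + ε →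
        ‖charAvg r (fun χ =>
            (DirichletCharacter.LFunction χ z₁ * DirichletCharacter.LFunction (star χ) z₂) /
              (DirichletCharacter.LFunction χ s₁ * DirichletCharacter.LFunction (star χ) s₂)) -
          ratiosMainTerm r z₁ z₂ s₁ s₂‖ ≤
        C * (1 + max (max |z₁.im| |z₂.im|) (max |s₁.im| |s₂.im|)) ^ ε / (r : ℝ) ^ ω

/-- The general term of the Dirichlet series `𝔼_f [f*(m₁) f̄*(m₂) / (L*(s₁, f) L*(s₂, f̄))]` in
`s₁, s₂`, obtained by expanding formally and averaging each coefficient. -/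
noncomputable def steinhausTwistedTerm (r m₁ m₂ : ℕ) (s₁ s₂ : ℂ) (k : ℕ × ℕ) : ℂ :=
  steinhausE (fun θ => fStar r θ m₁ * starRingEnd ℂ (fStar r θ m₂) *
      muStar r θ k.1 * starRingEnd ℂ (muStar r θ k.2)) /
    ((k.1 : ℂ) ^ s₁ * (k.2 : ℂ) ^ s₂)

/-!
The values `χ(m₁) χ̄(m₂)` are coefficients of the Dirichlet series `L(z₁, χ) L(z₂, χ̄)`, so the
twisted average is recovered from the Ratios Conjecture by a coefficient extraction in `z₁` and
`z₂`. The extraction uses the kernel `coeffKernel m`, the transform of a spline concentrated near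
`log m`: its integral against `n⁻ᶻ` along a vertical line is `1` for `n = m` and `0` for every other
`n ≥ 1`, and it decays like `m⁷ (1 + |Im z|)⁻⁶`. Because of the decay a non-principal `L(z, χ)`, of
linear growth in `Re z ≥ 1/2`, may be integrated on the critical line itself
(`integral_coeffKernel_mul_LFunction`). The error of the conjecture, integrated against two kernels,
stays `≪ m₁⁷ m₂⁷ (1 + T)^ε r^(-ω)`, and `m₁⁷ m₂⁷ ≤ r^(14 ℏ)` costs only a part of the saving.

For the main term, the Steinhaus average is computed in closed form
(`hasSum_steinhausRatioTerm`, `steinhausRatio_eq`): with `ζ_r(s) = (1 - r⁻ˢ) ζ(s)` it is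
`ζ_r(z₁ + z₂) A(z₁ + s₂, z₂ + s₁, s₁ + s₂)`, where `A(u, v, t)` is `1 / ζ_r(u)` times an absolutely
convergent series as long as `Re u > 1/2` and `Re v, Re t > 1`, and is symmetric in `u, v` where
both have real part greater than `1`. The two halves of the main term have simple poles at
`z₁ + z₂ = 1`, which cancel since `H(z, 1 - z) = 1` (`ratiosH_one_sub`) and by the symmetry of `A`
(`mainNum_one_sub`). Hence, for fixed `z₁` on the critical line, the `z₂`-integral of the main term
can be moved to `Re z₂ = 3/4` (`integral_coeffKernel_mul_ratiosMainTerm`). There the first half is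
an absolutely convergent Dirichlet series, from which the kernels extract exactly the twisted
Steinhaus average (`integral_integral_coeffKernel_mul_ratio`), while the second half carries the
factor `r^(1 - z₁ - z₂)` of modulus `r^(-1/4)` (`exists_norm_mainSecond_le`).

The bound for the second half has to be `O((1 + T)^ε)` in the heights of `s₁, s₂`; growth in the
heights of `z₁, z₂` is absorbed by the kernels. On the shifted line `s₂` enters through
`1 / ζ(1 - z₂ + s₂)`, whose argument has real part greater than `3/4`, so the bound is Littlewood's
for `1 / ζ` under the Riemann hypothesis (`ZetaNeZeroRightHalf.exists_norm_invZeta_le`). The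
non-vanishing of `ζ` for `1/2 < Re s < 1` comes from the principal character.
-/

section

open Complex MeasureTheory Filter Topology Set

/-! ### Integrals along vertical lines -/

/-- A function continuous on a closed vertical strip that is `O(|Im z|⁻²)` far up is
`O((1 + (Im z)²)⁻¹)` on the whole strip. -/
theorem exists_bound_on_strip {f : ℂ → ℂ} {a b C Y : ℝ}
    (hc : ContinuousOn f {z | a ≤ z.re ∧ z.re ≤ b})
    (hC : ∀ z : ℂ, a ≤ z.re → z.re ≤ b → Y ≤ |z.im| → ‖f z‖ ≤ C / (1 + z.im ^ 2)) :
    ∃ C' : ℝ, ∀ z : ℂ, a ≤ z.re → z.re ≤ b → ‖f z‖ ≤ C' * (1 + z.im ^ 2)⁻¹ := by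
  have hK : IsCompact (Icc a b ×ℂ Icc (-Y) Y) := isCompact_Icc.reProdIm isCompact_Icc
  obtain ⟨D, hD⟩ := hK.exists_bound_of_continuousOn
    (hc.mono (fun z hz => ⟨(mem_reProdIm.1 hz).1.1, (mem_reProdIm.1 hz).1.2⟩))
  refine ⟨max C (D * (1 + Y ^ 2)), fun z h1 h2 => ?_⟩
  have hp : 0 < 1 + z.im ^ 2 := by positivity
  rcases le_or_gt Y |z.im| with h | h
  · refine (hC z h1 h2 h).trans ?_
    rw [div_eq_mul_inv]
    gcongr
    exact le_max_left _ _
  · have hb := hD z (mem_reProdIm.2 ⟨⟨h1, h2⟩, abs_le.1 h.le⟩)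
    have hD0 : 0 ≤ D := (norm_nonneg _).trans hb
    have hsq : z.im ^ 2 ≤ Y ^ 2 := by
      rw [← sq_abs]; exact pow_le_pow_left₀ (abs_nonneg _) h.le 2
    rw [← div_eq_mul_inv, le_div_iff₀ hp]
    refine le_trans ?_ (le_max_right _ _)
    gcongr

theorem continuous_vertical {f : ℂ → ℂ} {a b c : ℝ}
    (hc : ContinuousOn f {z | a ≤ z.re ∧ z.re ≤ b}) (h1 : a ≤ c) (h2 : c ≤ b) :
    Continuous fun t : ℝ => f (c + t * I) :=
  hc.comp_continuous (by fun_prop) (fun t => by simp [h1, h2])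

theorem integrable_vertical {f : ℂ → ℂ} {a b c C : ℝ}
    (hc : ContinuousOn f {z | a ≤ z.re ∧ z.re ≤ b}) (h1 : a ≤ c) (h2 : c ≤ b)
    (hC : ∀ z : ℂ, a ≤ z.re → z.re ≤ b → ‖f z‖ ≤ C * (1 + z.im ^ 2)⁻¹) :
    Integrable fun t : ℝ => f (c + t * I) := by
  refine (integrable_inv_one_add_sq.const_mul C).mono'
    (continuous_vertical hc h1 h2).aestronglyMeasurable (ae_of_all _ fun t => ?_)
  simpa using hC (c + t * I) (by simpa using h1) (by simpa using h2)

/-- Shifting the line of integration across a vertical strip. -/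
theorem integral_vertical_eq {f : ℂ → ℂ} {a b C : ℝ} (hab : a ≤ b)
    (hc : ContinuousOn f {z | a ≤ z.re ∧ z.re ≤ b})
    (hd : DifferentiableOn ℂ f {z | a < z.re ∧ z.re < b})
    (hC : ∀ z : ℂ, a ≤ z.re → z.re ≤ b → ‖f z‖ ≤ C * (1 + z.im ^ 2)⁻¹) :
    ∫ t : ℝ, f (a + t * I) = ∫ t : ℝ, f (b + t * I) := by
  have hCnn : 0 ≤ C := by
    have := (norm_nonneg _).trans (hC (a : ℂ) (by simp) (by simpa using hab))
    simpa using this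
  have hT : Tendsto (fun T : ℝ => T) atTop atTop := tendsto_id
  have hTn : Tendsto (fun T : ℝ => -T) atTop atBot := tendsto_neg_atTop_atBot
  have hlim : ∀ c : ℝ, a ≤ c → c ≤ b → Tendsto (fun T : ℝ => ∫ t in (-T)..T, f (c + t * I)) atTop
      (𝓝 (∫ t : ℝ, f (c + t * I))) := fun c h1 h2 =>
    intervalIntegral_tendsto_integral (integrable_vertical hc h1 h2 hC) hTn hT
  have h0 : Tendsto (fun T : ℝ => (∫ t in (-T)..T, f (b + t * I)) -
      ∫ t in (-T)..T, f (a + t * I)) atTop (𝓝 0) := by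
    have hb : Tendsto (fun T : ℝ => 2 * (C * (1 + T ^ 2)⁻¹ * (b - a))) atTop (𝓝 0) := by
      have : Tendsto (fun T : ℝ => (1 + T ^ 2)⁻¹) atTop (𝓝 0) :=
        (tendsto_atTop_add_const_left _ _ (tendsto_pow_atTop two_ne_zero)).inv_tendsto_atTop
      simpa using ((this.const_mul C).mul_const (b - a)).const_mul 2
    refine squeeze_zero_norm (fun T => ?_) hb
    have key := integral_boundary_rect_eq_zero_of_continuousOn_of_differentiableOn f
      (a + (-T : ℝ) * I) (b + T * I) (hc.mono ?_) (hd.mono ?_)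
    · simp only [add_re, ofReal_re, mul_re, I_re, mul_zero, ofReal_im, I_im, mul_one, sub_self,
        add_zero, add_im, mul_im, zero_add] at key
      have hh : ∀ y : ℝ, y ^ 2 = T ^ 2 →
          ‖∫ x : ℝ in a..b, f (x + y * I)‖ ≤ C * (1 + T ^ 2)⁻¹ * (b - a) := by
        intro y hy
        have := intervalIntegral.norm_integral_le_of_norm_le_const (a := a) (b := b)
          (f := fun x : ℝ => f (x + y * I)) (C := C * (1 + T ^ 2)⁻¹) (fun x hx => by
            rw [uIoc_of_le hab] at hx
            have := hC (x + y * I) (by simpa using hx.1.le) (by simpa using hx.2)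
            simpa [hy] using this)
        rwa [abs_of_nonneg (sub_nonneg.2 hab)] at this
      have e : I • ((∫ t in (-T)..T, f (b + t * I)) - ∫ t in (-T)..T, f (a + t * I)) =
          (∫ x : ℝ in a..b, f (x + T * I)) - ∫ x : ℝ in a..b, f (x + (-T : ℝ) * I) := by
        rw [smul_sub]; linear_combination key
      have e2 := congrArg norm e
      rw [norm_smul, norm_I, one_mul] at e2
      rw [e2, two_mul]
      exact (norm_sub_le _ _).trans (add_le_add (hh _ rfl) (hh _ (by ring)))
    · intro z hz
      have := (mem_reProdIm.1 hz).1
      simpa [uIcc_of_le hab] using this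
    · intro z hz
      have := (mem_reProdIm.1 hz).1
      simpa [min_eq_left hab, max_eq_right hab] using this
  have := tendsto_nhds_unique h0 ((hlim b hab le_rfl).sub (hlim a le_rfl hab))
  exact (sub_eq_zero.1 this.symm).symm

/-! ### A spline and its transform -/

/-- `(sinh w / w)⁶`, with the singularity at `0` removed: the transform of a compactly supported
spline. -/
noncomputable def splineTransform (w : ℂ) : ℂ := dslope Complex.sinh 0 w ^ 6

theorem differentiable_splineTransform : Differentiable ℂ splineTransform := by
  have : Differentiable ℂ (dslope Complex.sinh 0) := by
    rw [← differentiableOn_univ, differentiableOn_dslope univ_mem]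
    exact Complex.differentiable_sinh.differentiableOn
  exact this.pow 6

theorem splineTransform_of_ne {w : ℂ} (hw : w ≠ 0) :
    splineTransform w = (Complex.sinh w / w) ^ 6 := by
  simp [splineTransform, dslope_of_ne _ hw, slope, div_eq_inv_mul]

theorem splineTransform_zero : splineTransform 0 = 1 := by
  simp [splineTransform, dslope_same, (Complex.hasDerivAt_sinh 0).deriv]

theorem splineTransform_neg (w : ℂ) : splineTransform (-w) = splineTransform w := by
  rcases eq_or_ne w 0 with rfl | hw
  · simp
  · rw [splineTransform_of_ne hw, splineTransform_of_ne (neg_ne_zero.2 hw), Complex.sinh_neg,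
      neg_div_neg_eq]

theorem norm_sinh_le (w : ℂ) : ‖Complex.sinh w‖ ≤ Real.exp |w.re| := by
  have h1 : ‖Complex.exp w‖ ≤ Real.exp |w.re| := by
    rw [Complex.norm_exp]; exact Real.exp_le_exp.2 (le_abs_self _)
  have h2 : ‖Complex.exp (-w)‖ ≤ Real.exp |w.re| := by
    rw [Complex.norm_exp]; exact Real.exp_le_exp.2 (neg_le_abs _)
  rw [Complex.sinh, norm_div, Complex.norm_ofNat]
  have := norm_sub_le (Complex.exp w) (Complex.exp (-w))
  linarith

theorem norm_splineTransform_le {w : ℂ} (hw : w ≠ 0) :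
    ‖splineTransform w‖ ≤ Real.exp (6 * |w.re|) / ‖w‖ ^ 6 := by
  have e : Real.exp (6 * |w.re|) = Real.exp |w.re| ^ 6 := by
    rw [← Real.exp_nat_mul]; norm_num
  rw [splineTransform_of_ne hw, norm_pow, norm_div, div_pow, e]
  gcongr
  exact norm_sinh_le w

/-- On any vertical strip the transform `(sinh w / w)⁶` decays quadratically. -/
theorem exists_bound_splineTransform (a b : ℝ) (h u : ℝ) (hh : 0 < h) :
    ∃ C : ℝ, ∀ z : ℂ, a ≤ z.re → z.re ≤ b →
      ‖Complex.exp (-u * z) * splineTransform (h * z)‖ ≤ C * (1 + z.im ^ 2)⁻¹ := by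
  have hcont : Continuous fun z : ℂ => Complex.exp (-u * z) * splineTransform (h * z) := by
    have := differentiable_splineTransform.continuous
    fun_prop
  set R := max |a| |b| with hR
  refine exists_bound_on_strip (C := Real.exp (|u| * R) * Real.exp (6 * (h * R)) / h ^ 6 * 2)
    (Y := 1) hcont.continuousOn ?_
  intro z h1 h2 hY
  have hzre : |z.re| ≤ R := abs_le_max_abs_abs h1 h2
  have hz : z ≠ 0 := by
    rintro rfl
    simp at hY; linarith
  have him : 1 ≤ z.im ^ 2 := by
    rw [← sq_abs]; nlinarith
  have hhz : (h : ℂ) * z ≠ 0 := mul_ne_zero (by exact_mod_cast hh.ne') hz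
  rw [norm_mul]
  have e1 : ‖Complex.exp (-u * z)‖ ≤ Real.exp (|u| * R) := by
    rw [Complex.norm_exp]
    refine Real.exp_le_exp.2 ?_
    have : (-(u : ℂ) * z).re = -u * z.re := by simp
    rw [this]
    calc -u * z.re ≤ |(-u) * z.re| := le_abs_self _
      _ = |u| * |z.re| := by rw [abs_mul, abs_neg]
      _ ≤ |u| * R := by gcongr
  have e2 : ‖splineTransform (h * z)‖ ≤ Real.exp (6 * (h * R)) / h ^ 6 * (2 / (1 + z.im ^ 2)) := by
    refine (norm_splineTransform_le hhz).trans ?_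
    have hre : |((h : ℂ) * z).re| ≤ h * R := by
      simp only [mul_re, ofReal_re, ofReal_im, zero_mul, sub_zero, abs_mul, abs_of_pos hh]
      gcongr
    have hn : ‖(h : ℂ) * z‖ ^ 6 = h ^ 6 * ‖z‖ ^ 6 := by
      rw [norm_mul, mul_pow, Complex.norm_real, Real.norm_of_nonneg hh.le]
    have hz6 : (1 + z.im ^ 2) / 2 ≤ ‖z‖ ^ 6 := by
      have h3 : z.im ^ 2 ≤ ‖z‖ ^ 2 := by
        rw [← sq_abs]; exact pow_le_pow_left₀ (abs_nonneg _) (abs_im_le_norm z) 2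
      have h4 : (1 : ℝ) ≤ ‖z‖ ^ 2 := him.trans h3
      nlinarith [sq_nonneg (‖z‖ ^ 2 - 1), mul_nonneg (sub_nonneg.2 h4) (sub_nonneg.2 h4)]
    rw [hn, mul_comm (h ^ 6), ← div_div, div_right_comm, div_eq_mul_inv _ (‖z‖ ^ 6)]
    gcongr
    rw [← inv_div]
    gcongr
  calc _ ≤ Real.exp (|u| * R) * (Real.exp (6 * (h * R)) / h ^ 6 * (2 / (1 + z.im ^ 2))) := by
        gcongr
    _ = _ := by ring

/-- The normalising constant `∫ (sin t / t)⁶ dt` of the spline. -/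
noncomputable def splineMass : ℝ := ∫ t : ℝ, Real.sinc t ^ 6

theorem splineTransform_ofReal_mul_I (t : ℝ) :
    splineTransform (t * I) = ((Real.sinc t ^ 6 : ℝ) : ℂ) := by
  rcases eq_or_ne t 0 with rfl | ht
  · simp [splineTransform_zero]
  · rw [splineTransform_of_ne (mul_ne_zero (by exact_mod_cast ht) I_ne_zero), Complex.sinh_mul_I,
      mul_div_mul_right _ _ I_ne_zero, Real.sinc_of_ne_zero ht]
    push_cast
    rfl

theorem integral_splineTransform_ofReal_mul_I :
    ∫ t : ℝ, splineTransform (t * I) = (splineMass : ℂ) := by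
  simp_rw [splineTransform_ofReal_mul_I]
  exact integral_ofReal

theorem integrable_splineTransform_line (c h u : ℝ) (hh : 0 < h) :
    Integrable fun t : ℝ => Complex.exp (-u * (c + t * I)) * splineTransform (h * (c + t * I)) := by
  obtain ⟨C, hC⟩ := exists_bound_splineTransform c c h u hh
  have := differentiable_splineTransform.continuous
  exact integrable_vertical (f := fun z => Complex.exp (-u * z) * splineTransform (h * z))
    (a := c) (b := c) (by fun_prop) le_rfl le_rfl hC

theorem splineMass_pos : 0 < splineMass := by
  have hi : Integrable fun t : ℝ => Real.sinc t ^ 6 := by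
    have := integrable_splineTransform_line 0 1 0 one_pos
    have h2 := this.re
    refine h2.congr (ae_of_all _ fun t => ?_)
    simp only [ofReal_zero, neg_zero, zero_mul, Complex.exp_zero, ofReal_one, one_mul, zero_add,
      splineTransform_ofReal_mul_I]
    exact ofReal_re _
  have hnn : 0 ≤ fun t : ℝ => Real.sinc t ^ 6 := fun t => by positivity
  rw [splineMass, integral_pos_iff_support_of_nonneg hnn hi]
  have hc : Continuous fun t : ℝ => Real.sinc t ^ 6 := Real.continuous_sinc.pow 6
  exact hc.isOpen_support.measure_pos _ ⟨0, by simp⟩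

/-- The line integral of `e^{-uz} (sinh hz / hz)⁶` does not depend on the line. -/
theorem integral_exp_mul_splineTransform_shift {a b : ℝ} (hab : a ≤ b) (h u : ℝ) (hh : 0 < h) :
    ∫ t : ℝ, Complex.exp (-u * (a + t * I)) * splineTransform (h * (a + t * I)) =
      ∫ t : ℝ, Complex.exp (-u * (b + t * I)) * splineTransform (h * (b + t * I)) := by
  obtain ⟨C, hC⟩ := exists_bound_splineTransform a b h u hh
  have h1 := differentiable_splineTransform
  have h2 := h1.continuous
  exact integral_vertical_eq (f := fun z => Complex.exp (-u * z) * splineTransform (h * z)) hab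
    (by fun_prop) (by fun_prop) hC

/-- The spline vanishes to the right of its support: shift the line to `+∞`. -/
theorem integral_exp_mul_splineTransform_eq_zero {h u : ℝ} (hh : 0 < h) (hu : 6 * h < u)
    (c : ℝ) :
    ∫ t : ℝ, Complex.exp (-u * (c + t * I)) * splineTransform (h * (c + t * I)) = 0 := by
  set J := ∫ t : ℝ, Complex.exp (-u * (c + t * I)) * splineTransform (h * (c + t * I)) with hJ
  have hint : Integrable fun t : ℝ => (1 + t ^ 2)⁻¹ := integrable_inv_one_add_sq
  set Q := ∫ t : ℝ, (1 + t ^ 2)⁻¹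
  -- On the line `Re z = x` the integrand is `O(e^{-(u - 6h) x} (1 + t²)⁻¹)`.
  have hb : ∀ᶠ x : ℝ in atTop, ‖J‖ ≤ Real.exp (-((u - 6 * h) * x)) * (2 / h ^ 6 * Q) := by
    filter_upwards [eventually_ge_atTop c, eventually_ge_atTop 1] with x hx hx1
    rw [hJ, integral_exp_mul_splineTransform_shift hx h u hh]
    rw [show Real.exp (-((u - 6 * h) * x)) * (2 / h ^ 6 * Q) =
      ∫ t : ℝ, Real.exp (-((u - 6 * h) * x)) * (2 / h ^ 6) * (1 + t ^ 2)⁻¹ by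
        rw [integral_const_mul, mul_assoc]]
    refine norm_integral_le_of_norm_le (hint.const_mul _) (ae_of_all _ fun t => ?_)
    set z : ℂ := x + t * I with hz
    have hzre : z.re = x := by simp [hz]
    have hzim : z.im = t := by simp [hz]
    have hz0 : z ≠ 0 := by
      intro h0
      rw [h0] at hzre
      simp at hzre; linarith
    have hhz : (h : ℂ) * z ≠ 0 := mul_ne_zero (by exact_mod_cast hh.ne') hz0
    rw [norm_mul]
    have e1 : ‖Complex.exp (-u * z)‖ = Real.exp (-(u * x)) := by
      rw [Complex.norm_exp]
      simp [hzre]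
    have hre : |((h : ℂ) * z).re| = h * x := by
      simp only [mul_re, ofReal_re, ofReal_im, zero_mul, sub_zero, hzre]
      exact abs_of_nonneg (by positivity)
    have hn : ‖(h : ℂ) * z‖ ^ 6 = h ^ 6 * ‖z‖ ^ 6 := by
      rw [norm_mul, mul_pow, Complex.norm_real, Real.norm_of_nonneg hh.le]
    have hsq : ‖z‖ ^ 2 = x ^ 2 + t ^ 2 := by
      rw [Complex.sq_norm, Complex.normSq_apply, hzre, hzim]; ring
    have hz6 : (1 + t ^ 2) / 2 ≤ ‖z‖ ^ 6 := by
      have h4 : 1 + t ^ 2 ≤ ‖z‖ ^ 2 := by rw [hsq]; nlinarith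
      have h5 : (1 : ℝ) ≤ ‖z‖ ^ 2 := by nlinarith [sq_nonneg t]
      nlinarith [sq_nonneg (‖z‖ ^ 2 - 1), mul_nonneg (sub_nonneg.2 h5) (sub_nonneg.2 h5)]
    have e2 := norm_splineTransform_le hhz
    rw [hre, hn] at e2
    calc _ ≤ Real.exp (-(u * x)) * (Real.exp (6 * (h * x)) / (h ^ 6 * ‖z‖ ^ 6)) := by
          rw [e1]; gcongr
      _ ≤ Real.exp (-(u * x)) * (Real.exp (6 * (h * x)) / (h ^ 6 * ((1 + t ^ 2) / 2))) := by
          gcongr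
      _ = _ := by
          rw [show -((u - 6 * h) * x) = -(u * x) + 6 * (h * x) by ring, Real.exp_add]
          field_simp
  have hlim : Tendsto (fun x : ℝ => Real.exp (-((u - 6 * h) * x)) * (2 / h ^ 6 * Q)) atTop
      (𝓝 0) := by
    have : Tendsto (fun x : ℝ => (u - 6 * h) * x) atTop atTop :=
      tendsto_id.const_mul_atTop (sub_pos.2 hu)
    simpa using (Real.tendsto_exp_neg_atTop_nhds_zero.comp this).mul_const (2 / h ^ 6 * Q)
  exact norm_le_zero_iff.1 (ge_of_tendsto hlim hb)

/-- The spline vanishes to the left of its support, by symmetry. -/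
theorem integral_exp_mul_splineTransform_eq_zero' {h u : ℝ} (hh : 0 < h) (hu : u < -(6 * h))
    (c : ℝ) :
    ∫ t : ℝ, Complex.exp (-u * (c + t * I)) * splineTransform (h * (c + t * I)) = 0 := by
  have := integral_exp_mul_splineTransform_eq_zero hh (u := -u) (by linarith) (-c)
  rw [← this, ← integral_neg_eq_self]
  refine integral_congr_ae (ae_of_all _ fun t => ?_)
  simp only []
  rw [show (h : ℂ) * (c + ((-t : ℝ) : ℂ) * I) = -(h * (((-c : ℝ) : ℂ) + t * I)) by push_cast; ring,
    splineTransform_neg]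
  push_cast
  ring_nf

/-- The value of the spline at the origin. -/
theorem integral_splineTransform_line {h : ℝ} (hh : 0 < h) (c : ℝ) :
    ∫ t : ℝ, splineTransform (h * (c + t * I)) = (splineMass / h : ℝ) := by
  have key : ∀ a b : ℝ, a ≤ b → ∫ t : ℝ, splineTransform (h * (a + t * I)) =
      ∫ t : ℝ, splineTransform (h * (b + t * I)) := fun a b hab => by
    simpa using integral_exp_mul_splineTransform_shift hab h 0 hh
  have h0 : ∫ t : ℝ, splineTransform (h * (c + t * I)) =
      ∫ t : ℝ, splineTransform (h * ((0 : ℝ) + t * I)) := by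
    rcases le_total c 0 with hc | hc
    · exact key _ _ hc
    · exact (key _ _ hc).symm
  rw [h0]
  have := Measure.integral_comp_mul_left (fun t : ℝ => splineTransform (t * I)) h
  rw [integral_splineTransform_ofReal_mul_I] at this
  rw [show (fun t : ℝ => splineTransform (h * ((0 : ℝ) + t * I))) =
    fun t : ℝ => splineTransform ((h * t : ℝ) * I) by
      ext t; push_cast; ring_nf]
  rw [this, abs_of_pos (inv_pos.2 hh)]
  simp [div_eq_inv_mul]

/-! ### The kernel extracting a coefficient -/

/-- The kernel extracting the coefficient of `m⁻ᶻ` from a Dirichlet series in `z`. Its spline lives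
on the logarithmic scale at `log m`; the scale `h = 1 / (18 m)` makes the support the interval of
radius `6 h = 1 / (3 m)`, too short to reach `log (m ± 1)`. The normalisation is by `∫ … dt` along
`z = c + it`, without a factor `2π`. -/
noncomputable def coeffKernel (m : ℕ) (z : ℂ) : ℂ :=
  (1 / (18 * m * splineMass) : ℝ) * (m : ℂ) ^ z * splineTransform ((1 / (18 * m) : ℝ) * z)

theorem differentiable_coeffKernel {m : ℕ} (hm : 1 ≤ m) : Differentiable ℂ (coeffKernel m) := by
  have h1 := differentiable_splineTransform
  have hm' : (m : ℂ) ≠ 0 := by exact_mod_cast (by lia : m ≠ 0)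
  have : Differentiable ℂ fun z : ℂ => (m : ℂ) ^ z := fun z =>
    (hasDerivAt_id z).const_cpow (Or.inl hm') |>.differentiableAt
  unfold coeffKernel
  fun_prop

/-- Extraction of coefficients: the kernel sees `n⁻ᶻ` only for `n = m`. -/
theorem integral_coeffKernel_mul_cpow {m n : ℕ} (hm : 1 ≤ m) (hn : 1 ≤ n) (c : ℝ) :
    ∫ t : ℝ, coeffKernel m (c + t * I) * (n : ℂ) ^ (-(c + t * I : ℂ)) =
      if n = m then 1 else 0 := by
  have hm0 : (0 : ℝ) < m := by exact_mod_cast hm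
  have hn0 : (0 : ℝ) < n := by exact_mod_cast hn
  have hmC : (m : ℂ) ≠ 0 := by exact_mod_cast hm0.ne'
  have hnC : (n : ℂ) ≠ 0 := by exact_mod_cast hn0.ne'
  set h : ℝ := 1 / (18 * m) with hh
  have hpos : 0 < h := by positivity
  -- Up to the normalisation, the integral is the value of the spline at `u = log (n / m)`.
  set u : ℝ := Real.log n - Real.log m with hu
  have e : ∀ t : ℝ, coeffKernel m (c + t * I) * (n : ℂ) ^ (-(c + t * I : ℂ)) =
      (1 / (18 * m * splineMass) : ℝ) *
        (Complex.exp (-u * (c + t * I)) * splineTransform (h * (c + t * I))) := by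
    intro t
    rw [coeffKernel, Complex.cpow_def_of_ne_zero hmC, Complex.cpow_def_of_ne_zero hnC, hu]
    have : Complex.exp (-((Real.log n - Real.log m : ℝ) : ℂ) * (c + t * I)) =
        Complex.exp (Complex.log m * (c + t * I)) * Complex.exp (Complex.log n * -(c + t * I)) := by
      rw [← Complex.exp_add]
      congr 1
      rw [← Complex.natCast_log, ← Complex.natCast_log]
      push_cast
      ring
    rw [this]
    ring
  simp_rw [e]
  rw [integral_const_mul]
  split_ifs with hnm
  · subst hnm
    have : u = 0 := by simp [hu]
    simp only [this, ofReal_zero, neg_zero, zero_mul, Complex.exp_zero, one_mul]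
    rw [integral_splineTransform_line hpos, ← ofReal_mul, ← ofReal_one]
    congr 1
    have := splineMass_pos.ne'
    rw [hh]
    field_simp
  · have hlog : ∀ x y : ℕ, 1 ≤ x → x < y → 1 / (y : ℝ) ≤ Real.log y - Real.log x := by
      intro x y hx hxy
      have hx0 : (0 : ℝ) < x := by exact_mod_cast hx
      have hxy' : (x : ℝ) + 1 ≤ y := by exact_mod_cast hxy
      have hy0 : (0 : ℝ) < y := by linarith
      have := Real.log_le_sub_one_of_pos (div_pos hx0 hy0)
      rw [Real.log_div hx0.ne' hy0.ne'] at this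
      have h2 : (x : ℝ) / y ≤ 1 - 1 / y := by
        rw [div_le_iff₀ hy0]; field_simp; linarith
      linarith
    have h6 : 6 * h = 1 / (3 * m) := by rw [hh]; field_simp; norm_num
    rcases lt_or_gt_of_ne hnm with hlt | hgt
    · rw [integral_exp_mul_splineTransform_eq_zero' hpos, mul_zero]
      have := hlog n m hn hlt
      have h3 : 1 / (3 * (m : ℝ)) < 1 / m := by
        apply one_div_lt_one_div_of_lt hm0; linarith
      linarith
    · rw [integral_exp_mul_splineTransform_eq_zero hpos, mul_zero]
      have h4 := hlog m (m + 1) hm (by lia)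
      have h5 : Real.log ((m + 1 : ℕ) : ℝ) ≤ Real.log n :=
        Real.log_le_log (by positivity) (by exact_mod_cast hgt)
      have h3 : 1 / (3 * (m : ℝ)) < 1 / ((m + 1 : ℕ) : ℝ) := by
        apply one_div_lt_one_div_of_lt (by positivity)
        push_cast
        have : (1 : ℝ) ≤ m := by exact_mod_cast hm
        linarith
      linarith

/-- The constant in the bound for `coeffKernel`. -/
noncomputable def coeffKernelConst : ℝ := 18 ^ 5 * 3 ^ 6 * Real.exp 1 / splineMass

theorem coeffKernelConst_pos : 0 < coeffKernelConst := by
  have := splineMass_pos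
  unfold coeffKernelConst
  positivity

theorem one_add_abs_im_le {z : ℂ} (h1 : 1 / 2 ≤ z.re) : 1 + |z.im| ≤ 3 * ‖z‖ := by
  have h3 := (le_abs_self _).trans (abs_re_le_norm z)
  have h4 := abs_im_le_norm z
  linarith

/-- Decay of the kernel. The power `m⁷` is made of `m⁻¹` from the normalisation, `m²` from `mᶻ` with
`Re z ≤ 2`, and `m⁶` from the scale `1 / (18 m)`. -/
theorem norm_coeffKernel_le {m : ℕ} (hm : 1 ≤ m) {z : ℂ} (h1 : 1 / 2 ≤ z.re) (h2 : z.re ≤ 2) :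
    ‖coeffKernel m z‖ ≤ coeffKernelConst * m ^ 7 / (1 + |z.im|) ^ 6 := by
  have hm1 : (1 : ℝ) ≤ m := by exact_mod_cast hm
  have hm0 : (0 : ℝ) < m := by linarith
  have hκ := splineMass_pos
  have hz : z ≠ 0 := by
    rintro rfl
    simp at h1; linarith
  set h : ℝ := 1 / (18 * m) with hh
  have hpos : 0 < h := by positivity
  have hhz : (h : ℂ) * z ≠ 0 := mul_ne_zero (by exact_mod_cast hpos.ne') hz
  have hzn : 0 < ‖z‖ := norm_pos_iff.2 hz
  have e1 : ‖((1 / (18 * m * splineMass) : ℝ) : ℂ)‖ = 1 / (18 * m * splineMass) := by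
    rw [Complex.norm_real, Real.norm_of_nonneg (by positivity)]
  have e2 : ‖(m : ℂ) ^ z‖ ≤ (m : ℝ) ^ 2 := by
    rw [norm_natCast_cpow_of_pos (by lia), ← Real.rpow_natCast]
    exact Real.rpow_le_rpow_of_exponent_le hm1 (by exact_mod_cast h2)
  have e3 : ‖splineTransform (h * z)‖ ≤ Real.exp 1 * (18 * m) ^ 6 * 3 ^ 6 / (1 + |z.im|) ^ 6 := by
    refine (norm_splineTransform_le hhz).trans ?_
    have hn : ‖(h : ℂ) * z‖ = h * ‖z‖ := by
      rw [norm_mul, Complex.norm_real, Real.norm_of_nonneg hpos.le]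
    have hre : 6 * |((h : ℂ) * z).re| ≤ 1 := by
      simp only [mul_re, ofReal_re, ofReal_im, zero_mul, sub_zero]
      rw [abs_of_nonneg (by positivity)]
      have : h ≤ 1 / 18 := by
        rw [hh]; apply one_div_le_one_div_of_le <;> linarith
      nlinarith
    have hlow : (1 + |z.im|) / (3 * (18 * m)) ≤ h * ‖z‖ := by
      rw [hh]
      rw [div_le_iff₀ (by positivity)]
      have := one_add_abs_im_le h1
      field_simp
      linarith
    rw [hn]
    calc _ ≤ Real.exp 1 / ((1 + |z.im|) / (3 * (18 * m))) ^ 6 := by gcongr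
      _ = _ := by field_simp
  rw [coeffKernel, norm_mul, norm_mul, e1]
  calc _ ≤ 1 / (18 * m * splineMass) * m ^ 2 *
        (Real.exp 1 * (18 * m) ^ 6 * 3 ^ 6 / (1 + |z.im|) ^ 6) := by gcongr
    _ = _ := by rw [coeffKernelConst]; field_simp

theorem norm_coeffKernel_le_inv_one_add_sq {m : ℕ} (hm : 1 ≤ m) {z : ℂ} (h1 : 1 / 2 ≤ z.re)
    (h2 : z.re ≤ 2) : ‖coeffKernel m z‖ ≤ coeffKernelConst * m ^ 7 * (1 + z.im ^ 2)⁻¹ := by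
  refine (norm_coeffKernel_le hm h1 h2).trans ?_
  rw [div_eq_mul_inv]
  have := coeffKernelConst_pos
  have h0 := abs_nonneg z.im
  gcongr
  have e1 : 1 + z.im ^ 2 ≤ (1 + |z.im|) ^ 2 := by rw [← sq_abs]; nlinarith
  exact e1.trans (pow_le_pow_right₀ (by linarith) (by norm_num))

theorem integrable_coeffKernel {m : ℕ} (hm : 1 ≤ m) {c : ℝ} (h1 : 1 / 2 ≤ c) (h2 : c ≤ 2) :
    Integrable fun t : ℝ => coeffKernel m (c + t * I) :=
  integrable_vertical (differentiable_coeffKernel hm).continuous.continuousOn h1 h2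
    fun _ hz1 hz2 => norm_coeffKernel_le_inv_one_add_sq hm hz1 hz2

theorem norm_mul_natCast_cpow_vertical {a : ℂ} {n : ℕ} (hn : n = 0 → a = 0) (c t : ℝ) :
    ‖a * (n : ℂ) ^ (-(c + t * I : ℂ))‖ = ‖a * (n : ℂ) ^ (-(c : ℂ))‖ := by
  rcases Nat.eq_zero_or_pos n with h | h
  · simp [hn h]
  · rw [norm_mul, norm_mul, norm_natCast_cpow_of_pos h, norm_natCast_cpow_of_pos h]
    simp

theorem continuous_mul_natCast_cpow_vertical {a : ℂ} {n : ℕ} (hn : n = 0 → a = 0) (c : ℝ) :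
    Continuous fun t : ℝ => a * (n : ℂ) ^ (-(c + t * I : ℂ)) := by
  rcases Nat.eq_zero_or_pos n with h | h
  · simp only [hn h, zero_mul]
    exact continuous_const
  · have hne : (n : ℂ) ≠ 0 := by exact_mod_cast h.ne'
    exact continuous_const.mul (Continuous.const_cpow (by fun_prop) (Or.inl hne))

theorem integrable_coeffKernel_mul_tsum {ι : Type*} {m : ℕ} (hm : 1 ≤ m) {c : ℝ}
    (h1 : 1 / 2 ≤ c) (h2 : c ≤ 2) (a : ι → ℂ) (n : ι → ℕ) (hn : ∀ i, n i = 0 → a i = 0)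
    (hs : Summable fun i => a i * (n i : ℂ) ^ (-(c : ℂ))) :
    Integrable fun t : ℝ => coeffKernel m (c + t * I) *
      ∑' i, a i * (n i : ℂ) ^ (-(c + t * I : ℂ)) := by
  refine (integrable_coeffKernel hm h1 h2).mul_bdd (c := ∑' i, ‖a i * (n i : ℂ) ^ (-(c : ℂ))‖)
    (Continuous.aestronglyMeasurable (continuous_tsum
      (fun i => continuous_mul_natCast_cpow_vertical (hn i) c) hs.norm
      fun i t => (norm_mul_natCast_cpow_vertical (hn i) c t).le))
    (ae_of_all _ fun t => tsum_of_norm_bounded hs.norm.hasSum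
      fun i => (norm_mul_natCast_cpow_vertical (hn i) c t).le)

/-- Extraction of the coefficients of an absolutely convergent Dirichlet series. -/
theorem integral_coeffKernel_mul_tsum {ι : Type*} [Countable ι] {m : ℕ} (hm : 1 ≤ m) {c : ℝ}
    (h1 : 1 / 2 ≤ c) (h2 : c ≤ 2) (a : ι → ℂ) (n : ι → ℕ) (hn : ∀ i, n i = 0 → a i = 0)
    (hs : Summable fun i => a i * (n i : ℂ) ^ (-(c : ℂ))) :
    ∫ t : ℝ, coeffKernel m (c + t * I) * ∑' i, a i * (n i : ℂ) ^ (-(c + t * I : ℂ)) =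
      ∑' i, if n i = m then a i else 0 := by
  have hK := integrable_coeffKernel hm h1 h2
  have hnorm : ∀ i (t : ℝ), ‖a i * (n i : ℂ) ^ (-(c + t * I : ℂ))‖ =
      ‖a i * (n i : ℂ) ^ (-(c : ℂ))‖ := fun i => norm_mul_natCast_cpow_vertical (hn i) c
  set F : ι → ℝ → ℂ := fun i t =>
    coeffKernel m (c + t * I) * (a i * (n i : ℂ) ^ (-(c + t * I : ℂ))) with hF
  have hFi : ∀ i, Integrable (F i) := fun i =>
    hK.mul_bdd (c := ‖a i * (n i : ℂ) ^ (-(c : ℂ))‖)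
      (continuous_mul_natCast_cpow_vertical (hn i) c).aestronglyMeasurable
      (ae_of_all _ fun t => (hnorm i t).le)
  have hFs : Summable fun i => ∫ t, ‖F i t‖ := by
    have : ∀ i, ∫ t, ‖F i t‖ = (∫ t : ℝ, ‖coeffKernel m (c + t * I)‖) *
        ‖a i * (n i : ℂ) ^ (-(c : ℂ))‖ := by
      intro i
      rw [← integral_mul_const]
      refine integral_congr_ae (ae_of_all _ fun t => ?_)
      simp only [hF]
      rw [norm_mul, hnorm]
    simp_rw [this]
    exact hs.norm.mul_left _
  have key := integral_tsum_of_summable_integral_norm hFi hFs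
  simp only [hF] at key
  simp_rw [tsum_mul_left] at key
  rw [← key]
  refine tsum_congr fun i => ?_
  rcases Nat.eq_zero_or_pos (n i) with h | h
  · simp [hn i h]
  · have := integral_coeffKernel_mul_cpow hm h c
    rw [show (fun t : ℝ => coeffKernel m (c + t * I) * (a i * (n i : ℂ) ^ (-(c + t * I : ℂ)))) =
      fun t : ℝ => a i * (coeffKernel m (c + t * I) * (n i : ℂ) ^ (-(c + t * I : ℂ))) by
        ext t; ring, integral_const_mul, this]
    simp

/-! ### Growth of `ζ` and of non-principal `L`-functions -/

/-- The remainder `∫₁^∞ R(t) t^{-s-1} dt` left by partial summation. -/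
noncomputable def abelRemainder (R : ℝ → ℂ) (s : ℂ) : ℂ :=
  ∫ t in Ioi (1 : ℝ), R t * (t : ℂ) ^ (-(s + 1))

theorem norm_abelRemainder_le {R : ℝ → ℂ} {B : ℝ} (hB : ∀ t, 1 < t → ‖R t‖ ≤ B) {s : ℂ}
    (hs : 0 < s.re) : ‖abelRemainder R s‖ ≤ B / s.re := by
  have hlt : -(s.re + 1) < -1 := by linarith
  have hint : IntegrableOn (fun t : ℝ => t ^ (-(s.re + 1))) (Ioi 1) :=
    integrableOn_Ioi_rpow_of_lt hlt one_pos
  have hval : ∫ t in Ioi (1 : ℝ), B * t ^ (-(s.re + 1)) = B / s.re := by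
    rw [integral_const_mul, integral_Ioi_rpow_of_lt hlt one_pos]
    rw [Real.one_rpow]
    field_simp
    ring_nf
    field_simp
  rw [← hval]
  refine norm_integral_le_of_norm_le (hint.const_mul B) ?_
  filter_upwards [ae_restrict_mem measurableSet_Ioi] with t ht
  have ht0 : (0 : ℝ) < t := zero_lt_one.trans ht
  rw [norm_mul, norm_cpow_eq_rpow_re_of_pos ht0]
  simp only [neg_re, add_re, one_re]
  gcongr
  exact hB t ht

theorem differentiableOn_abelRemainder {R : ℝ → ℂ} (hm : Measurable R) {B : ℝ}
    (hB : ∀ t, 1 < t → ‖R t‖ ≤ B) :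
    DifferentiableOn ℂ (abelRemainder R) {s | 0 < s.re} := by
  intro s hs
  have hs : 0 < s.re := hs
  set f : ℝ → ℂ := (Ioi (1 : ℝ)).indicator R with hf
  have heq : abelRemainder R = fun s => mellin f (-s) := by
    ext s
    rw [abelRemainder, mellin, ← integral_indicator measurableSet_Ioi,
      ← integral_indicator measurableSet_Ioi]
    congr 1
    ext t
    by_cases h : t ∈ Ioi (1 : ℝ)
    · have h0 : t ∈ Ioi (0 : ℝ) := mem_Ioi.2 (zero_lt_one.trans (mem_Ioi.1 h))
      rw [indicator_of_mem h, indicator_of_mem h0, hf, indicator_of_mem h, smul_eq_mul,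
        mul_comm]
      ring_nf
    · rw [indicator_of_notMem h]
      by_cases h0 : t ∈ Ioi (0 : ℝ)
      · rw [indicator_of_mem h0, hf, indicator_of_notMem h, smul_zero]
      · rw [indicator_of_notMem h0]
  have hbound : ∀ t, ‖f t‖ ≤ |B| := by
    intro t
    by_cases h : t ∈ Ioi (1 : ℝ)
    · rw [hf, indicator_of_mem h]; exact (hB t h).trans (le_abs_self B)
    · rw [hf, indicator_of_notMem h]; simp
  have hfm : Measurable f := hm.indicator measurableSet_Ioi
  have hloc : LocallyIntegrableOn f (Ioi 0) := by
    have hc : LocallyIntegrable (fun _ : ℝ => |B|) (volume : Measure ℝ) := locallyIntegrable_const _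
    exact (hc.mono hfm.aestronglyMeasurable
      (ae_of_all _ fun t => by simpa using hbound t)).locallyIntegrableOn _
  have hd : DifferentiableAt ℂ (mellin f) (-s) := by
    refine mellin_differentiableAt_of_isBigO_rpow (a := 0) (b := (-s).re - 1) hloc ?_ ?_ ?_ ?_
    · refine Asymptotics.IsBigO.of_bound |B| (Eventually.of_forall fun t => ?_)
      simpa using hbound t
    · simpa using hs
    · refine Asymptotics.IsBigO.of_bound 0 ?_
      filter_upwards [Ioo_mem_nhdsGT (zero_lt_one (α := ℝ))] with t ht
      have : t ∉ Ioi (1 : ℝ) := fun h => absurd ht.2 (not_lt.2 (le_of_lt h))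
      rw [hf, indicator_of_notMem this]; simp
    · linarith
  rw [heq]
  exact (hd.comp s differentiableAt_id.neg).differentiableWithinAt

theorem isPreconnected_re_pos : IsPreconnected {s : ℂ | 0 < s.re} :=
  (convex_halfSpace_re_gt 0).isPreconnected

/-- The identity theorem on the right half-plane. -/
theorem eqOn_re_pos {f g : ℂ → ℂ} (hf : DifferentiableOn ℂ f {s | 0 < s.re})
    (hg : DifferentiableOn ℂ g {s | 0 < s.re}) (h : ∀ s : ℂ, 1 < s.re → f s = g s) :
    ∀ s : ℂ, 0 < s.re → f s = g s := by
  have hf' := hf.analyticOnNhd (isOpen_re_gt 0)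
  have hg' := hg.analyticOnNhd (isOpen_re_gt 0)
  have h2 : f =ᶠ[𝓝 (2 : ℂ)] g := by
    filter_upwards [(isOpen_re_gt 1).mem_nhds (show (1 : ℝ) < (2 : ℂ).re by norm_num)] with z hz
    exact h z hz
  exact fun s hs => hf'.eqOn_of_preconnected_of_eventuallyEq hg' isPreconnected_re_pos
    (show (0 : ℝ) < (2 : ℂ).re by norm_num) h2 hs

/-- The entire function `(s - 1) ζ(s)` by partial summation. -/
theorem riemannZeta₁_eq {s : ℂ} (hs : 0 < s.re) :
    riemannZeta₁ s = s - s * (s - 1) * abelRemainder (fun t => ((Int.fract t : ℝ) : ℂ)) s := by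
  have hfr : ∀ t : ℝ, 1 < t → ‖((Int.fract t : ℝ) : ℂ)‖ ≤ 1 := fun t _ => by
    rw [Complex.norm_real, Real.norm_of_nonneg (Int.fract_nonneg t)]
    exact (Int.fract_lt_one t).le
  have hmeas : Measurable fun t : ℝ => ((Int.fract t : ℝ) : ℂ) :=
    Complex.measurable_ofReal.comp measurable_fract
  have hd := differentiableOn_abelRemainder hmeas hfr
  refine eqOn_re_pos (g := fun s => s - s * (s - 1) *
    abelRemainder (fun t => ((Int.fract t : ℝ) : ℂ)) s)
    differentiable_riemannZeta₁.differentiableOn (by fun_prop) ?_ s hs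
  intro s hs
  have hs1 : s ≠ 1 := by rintro rfl; simp at hs
  have hs1' : s - 1 ≠ 0 := sub_ne_zero.2 hs1
  have hz : riemannZeta s = s * ∫ t in Ioi (1 : ℝ), ((⌊t⌋₊ : ℕ) : ℂ) * (t : ℂ) ^ (-(s + 1)) := by
    rw [← LSeries_one_eq_riemannZeta hs]
    have := LSeries_eq_mul_integral (1 : ℕ → ℂ) (r := 1) zero_le_one hs
      (LSeriesSummable_one_iff.2 hs) (by
        refine Asymptotics.IsBigO.of_bound 1 (Eventually.of_forall fun n => ?_)
        simp)
    rw [this]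
    simp
  have hlt : (-s).re < -1 := by simpa using hs
  have hi1 : ∫ t in Ioi (1 : ℝ), (t : ℂ) ^ (-s) = 1 / (s - 1) := by
    rw [integral_Ioi_cpow_of_lt hlt one_pos]
    rw [ofReal_one, one_cpow, show -s + 1 = -(s - 1) by ring, neg_div_neg_eq]
  have hint1 : IntegrableOn (fun t : ℝ => (t : ℂ) ^ (-s)) (Ioi 1) :=
    integrableOn_Ioi_cpow_of_lt hlt one_pos
  have hint2 : IntegrableOn (fun t : ℝ => ((Int.fract t : ℝ) : ℂ) * (t : ℂ) ^ (-(s + 1)))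
      (Ioi 1) := by
    have h3 : IntegrableOn (fun t : ℝ => (t : ℂ) ^ (-(s + 1))) (Ioi 1) :=
      integrableOn_Ioi_cpow_of_lt (by simp; linarith) one_pos
    refine Integrable.bdd_mul (c := 1) h3 hmeas.aestronglyMeasurable ?_
    filter_upwards [ae_restrict_mem measurableSet_Ioi] with t ht using hfr t ht
  have hsplit : ∫ t in Ioi (1 : ℝ), ((⌊t⌋₊ : ℕ) : ℂ) * (t : ℂ) ^ (-(s + 1)) =
      1 / (s - 1) - abelRemainder (fun t => ((Int.fract t : ℝ) : ℂ)) s := by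
    rw [← hi1, abelRemainder, ← integral_sub hint1 hint2]
    refine setIntegral_congr_fun measurableSet_Ioi fun t ht => ?_
    have ht0 : (0 : ℝ) < t := zero_lt_one.trans ht
    have htC : (t : ℂ) ≠ 0 := by exact_mod_cast ht0.ne'
    have e1 : ((⌊t⌋₊ : ℕ) : ℂ) = (t : ℂ) - (Int.fract t : ℝ) := by
      have : ((⌊t⌋₊ : ℕ) : ℝ) = t - Int.fract t := by
        rw [natCast_floor_eq_intCast_floor ht0.le, Int.self_sub_fract]
      rw [← ofReal_natCast, this]; push_cast; rfl
    have e2 : (t : ℂ) ^ (-s) = t * (t : ℂ) ^ (-(s + 1)) := by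
      rw [show -s = 1 + -(s + 1) by ring, cpow_add _ _ htC, cpow_one]
    simp only [e1, e2]
    ring
  have h1 := riemannZeta_eq_inv_sub_mul hs1
  have h2 : riemannZeta₁ s = (s - 1) * riemannZeta s := by rw [h1]; field_simp
  rw [h2, hz, hsplit]
  field_simp

theorem norm_riemannZeta₁_le {s : ℂ} (hs : 1 / 2 ≤ s.re) :
    ‖riemannZeta₁ s‖ ≤ ‖s‖ + 2 * (‖s‖ * ‖s - 1‖) := by
  have h0 : 0 < s.re := by linarith
  have hb := norm_abelRemainder_le (R := fun t => ((Int.fract t : ℝ) : ℂ)) (B := 1) (fun t _ => by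
    rw [Complex.norm_real, Real.norm_of_nonneg (Int.fract_nonneg t)]
    exact (Int.fract_lt_one t).le) h0
  have hb2 : ‖abelRemainder (fun t => ((Int.fract t : ℝ) : ℂ)) s‖ ≤ 2 :=
    hb.trans (by rw [div_le_iff₀ h0]; linarith)
  rw [riemannZeta₁_eq h0]
  refine (norm_sub_le _ _).trans ?_
  rw [norm_mul, norm_mul]
  have := mul_le_mul_of_nonneg_left hb2 (by positivity : 0 ≤ ‖s‖ * ‖s - 1‖)
  linarith

theorem norm_riemannZeta_le {s : ℂ} (hs : 1 / 2 ≤ s.re) (hs1 : s ≠ 1) :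
    ‖riemannZeta s‖ ≤ ‖s‖ * (1 / ‖s - 1‖ + 2) := by
  have h := norm_riemannZeta₁_le hs
  have h1 : 0 < ‖s - 1‖ := norm_pos_iff.2 (sub_ne_zero.2 hs1)
  rw [riemannZeta_eq_inv_sub_mul hs1, norm_mul, norm_inv, ← div_eq_inv_mul, div_le_iff₀ h1]
  refine h.trans (le_of_eq ?_)
  field_simp

/-- The partial sums are periodic, since the sum over a full period vanishes. -/
theorem DirichletCharacter.exists_bound_sum_Icc {N : ℕ} [NeZero N] {χ : DirichletCharacter ℂ N}
    (hχ : χ ≠ 1) : ∃ B : ℝ, ∀ n : ℕ, ‖∑ k ∈ Finset.Icc 1 n, χ (k : ZMod N)‖ ≤ B := by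
  set S : ℕ → ℂ := fun n => ∑ k ∈ Finset.range n, χ (k : ZMod N) with hS
  have hN : S N = 0 := by
    rw [← χ.sum_eq_zero_of_ne_one hχ, hS]
    refine Finset.sum_bij (fun k _ => (k : ZMod N)) (by simp) ?_ ?_ (by simp)
    · intro a ha b hb hab
      have := (ZMod.natCast_eq_natCast_iff' a b N).1 hab
      rwa [Nat.mod_eq_of_lt (Finset.mem_range.1 ha), Nat.mod_eq_of_lt (Finset.mem_range.1 hb)]
        at this
    · intro b _
      exact ⟨b.val, Finset.mem_range.2 (ZMod.val_lt b), by simp⟩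
  have hper : Function.Periodic S N := by
    intro n
    simp only [hS]
    rw [add_comm n N, Finset.sum_range_add]
    simp only [hS] at hN
    rw [hN, zero_add]
    simp
  have hb : ∀ n, ‖S n‖ ≤ ∑ j ∈ Finset.range N, ‖S j‖ := by
    intro n
    rw [← hper.map_mod_nat n]
    exact Finset.single_le_sum (f := fun j => ‖S j‖) (fun _ _ => norm_nonneg _)
      (Finset.mem_range.2 (Nat.mod_lt _ (NeZero.pos N)))
  refine ⟨(∑ j ∈ Finset.range N, ‖S j‖) + ‖χ 0‖, fun n => ?_⟩
  have e : ∑ k ∈ Finset.Icc 1 n, χ (k : ZMod N) = S (n + 1) - χ 0 := by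
    simp only [hS]
    rw [Finset.sum_range_eq_add_Ico _ (Nat.succ_pos n)]
    simp [Finset.Ico_add_one_right_eq_Icc]
  rw [e]
  exact (norm_sub_le _ _).trans (by gcongr; exact hb _)

/-- A non-principal `L(s, χ)` grows at most linearly in the half-plane `Re s ≥ 1/2`. -/
theorem DirichletCharacter.exists_norm_LFunction_le {N : ℕ} [NeZero N]
    {χ : DirichletCharacter ℂ N} (hχ : χ ≠ 1) :
    ∃ B : ℝ, 0 ≤ B ∧ ∀ s : ℂ, 1 / 2 ≤ s.re → ‖LFunction χ s‖ ≤ B * ‖s‖ := by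
  obtain ⟨B, hB⟩ := DirichletCharacter.exists_bound_sum_Icc hχ
  have hB0 : 0 ≤ B := (norm_nonneg _).trans (hB 0)
  set R : ℝ → ℂ := fun t => ∑ k ∈ Finset.Icc 1 ⌊t⌋₊, χ (k : ZMod N) with hR
  have hRb : ∀ t, 1 < t → ‖R t‖ ≤ B := fun t _ => hB _
  have hRm : Measurable R :=
    (measurable_from_nat (f := fun n : ℕ => ∑ k ∈ Finset.Icc 1 n, χ (k : ZMod N))).comp
      Nat.measurable_floor
  have hd := differentiableOn_abelRemainder hRm hRb
  have heq : ∀ s : ℂ, 0 < s.re → LFunction χ s = s * abelRemainder R s := by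
    refine eqOn_re_pos (g := fun s => s * abelRemainder R s)
      (differentiable_LFunction hχ).differentiableOn (by fun_prop) ?_
    intro s hs
    rw [LFunction_eq_LSeries χ hs]
    exact LSeries_eq_mul_integral (fun n => χ (n : ZMod N)) (r := 0) le_rfl (by linarith)
      (LSeriesSummable_of_one_lt_re χ hs) (by
        refine Asymptotics.IsBigO.of_bound B (Eventually.of_forall fun n => ?_)
        simpa using hB n)
  refine ⟨2 * B, by positivity, fun s hs => ?_⟩
  have h0 : 0 < s.re := by linarith
  rw [heq s h0, norm_mul, mul_comm]
  gcongr
  refine (norm_abelRemainder_le hRb h0).trans ?_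
  rw [div_le_iff₀ h0]
  nlinarith

theorem differentiable_coeffKernel_mul_LFunction {N : ℕ} [NeZero N] {χ : DirichletCharacter ℂ N}
    (hχ : χ ≠ 1) {m : ℕ} (hm : 1 ≤ m) :
    Differentiable ℂ fun z => coeffKernel m z * DirichletCharacter.LFunction χ z :=
  (differentiable_coeffKernel hm).mul (DirichletCharacter.differentiable_LFunction hχ)

theorem exists_norm_coeffKernel_mul_LFunction_le {N : ℕ} [NeZero N] {χ : DirichletCharacter ℂ N}
    (hχ : χ ≠ 1) {m : ℕ} (hm : 1 ≤ m) : ∃ C : ℝ, ∀ z : ℂ, 1 / 2 ≤ z.re → z.re ≤ 2 →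
      ‖coeffKernel m z * DirichletCharacter.LFunction χ z‖ ≤ C * (1 + z.im ^ 2)⁻¹ := by
  obtain ⟨B, hB0, hB⟩ := DirichletCharacter.exists_norm_LFunction_le hχ
  have hK := coeffKernelConst_pos
  refine ⟨coeffKernelConst * m ^ 7 * (2 * B), ?_⟩
  intro z h1 h2
  rw [norm_mul]
  have hz : ‖z‖ ≤ 2 * (1 + |z.im|) := by
    refine (norm_le_abs_re_add_abs_im z).trans ?_
    rw [abs_of_nonneg (by linarith)]
    have := abs_nonneg z.im
    linarith
  have hp : 0 < 1 + |z.im| := by positivity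
  calc _ ≤ coeffKernelConst * m ^ 7 / (1 + |z.im|) ^ 6 * (B * (2 * (1 + |z.im|))) := by
        gcongr
        · exact norm_coeffKernel_le hm h1 h2
        · exact (hB z h1).trans (by gcongr)
    _ = coeffKernelConst * m ^ 7 * (2 * B) * ((1 + |z.im|) ^ 5)⁻¹ := by
        field_simp
    _ ≤ _ := by
        gcongr
        have e1 : 1 + z.im ^ 2 ≤ (1 + |z.im|) ^ 2 := by
          rw [← sq_abs]; nlinarith [abs_nonneg z.im]
        exact e1.trans (pow_le_pow_right₀ (by linarith [abs_nonneg z.im]) (by norm_num))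

theorem integrable_coeffKernel_mul_LFunction {N : ℕ} [NeZero N] {χ : DirichletCharacter ℂ N}
    (hχ : χ ≠ 1) {m : ℕ} (hm : 1 ≤ m) :
    Integrable fun t : ℝ => coeffKernel m ((1 / 2 : ℝ) + t * I) *
      DirichletCharacter.LFunction χ ((1 / 2 : ℝ) + t * I) := by
  obtain ⟨C, hC⟩ := exists_norm_coeffKernel_mul_LFunction_le hχ hm
  exact integrable_vertical (differentiable_coeffKernel_mul_LFunction hχ hm).continuous.continuousOn
    le_rfl (by norm_num) hC

/-- The kernel extracts the values of a non-principal character from the values of `L(s, χ)` on the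
critical line. -/
theorem integral_coeffKernel_mul_LFunction {N : ℕ} [NeZero N] {χ : DirichletCharacter ℂ N}
    (hχ : χ ≠ 1) {m : ℕ} (hm : 1 ≤ m) :
    ∫ t : ℝ, coeffKernel m ((1 / 2 : ℝ) + t * I) *
      DirichletCharacter.LFunction χ ((1 / 2 : ℝ) + t * I) = χ (m : ZMod N) := by
  obtain ⟨C, hC⟩ := exists_norm_coeffKernel_mul_LFunction_le hχ hm
  have hd := differentiable_coeffKernel_mul_LFunction hχ hm
  have hshift := integral_vertical_eq (f := fun z =>
    coeffKernel m z * DirichletCharacter.LFunction χ z) (a := 1 / 2) (b := 2) (by norm_num)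
    hd.continuous.continuousOn hd.differentiableOn hC
  rw [hshift]
  have hsum : Summable fun n : ℕ => (if n = 0 then 0 else χ (n : ZMod N)) *
      (n : ℂ) ^ (-((2 : ℝ) : ℂ)) := by
    have := DirichletCharacter.LSeriesSummable_of_one_lt_re χ (s := ((2 : ℝ) : ℂ)) (by norm_num)
    refine this.congr fun n => ?_
    rcases eq_or_ne n 0 with rfl | h
    · simp
    · rw [LSeries.term_of_ne_zero h, cpow_neg, if_neg h, div_eq_mul_inv]
  have key := integral_coeffKernel_mul_tsum hm (c := 2) (by norm_num) le_rfl
    (fun n : ℕ => if n = 0 then 0 else χ (n : ZMod N)) id (by intro i hi; simp_all) hsum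
  have e : ∀ t : ℝ, DirichletCharacter.LFunction χ ((2 : ℝ) + t * I) =
      ∑' n : ℕ, (if n = 0 then 0 else χ (n : ZMod N)) * (n : ℂ) ^ (-((2 : ℝ) + t * I : ℂ)) := by
    intro t
    rw [DirichletCharacter.LFunction_eq_LSeries χ (by simp), LSeries]
    refine tsum_congr fun n => ?_
    rcases eq_or_ne n 0 with rfl | h
    · simp
    · rw [LSeries.term_of_ne_zero h, cpow_neg, if_neg h, div_eq_mul_inv]
  simp_rw [e]
  simp only [id] at key
  rw [key, tsum_eq_single m]
  · simp [show m ≠ 0 by lia]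
  · intro n hn
    simp [hn]

/-! ### Littlewood's bound for `1 / ζ` under the Riemann hypothesis -/

theorem exists_norm_LSeries_le {f : ℕ → ℂ} {σ : ℝ} (h : LSeriesSummable f σ) :
    ∃ C : ℝ, 0 ≤ C ∧ ∀ s : ℂ, σ ≤ s.re → ‖LSeries f s‖ ≤ C := by
  refine ⟨∑' n, ‖LSeries.term f σ n‖, tsum_nonneg fun _ => norm_nonneg _, fun s hs => ?_⟩
  exact tsum_of_norm_bounded (summable_norm_iff.2 h).hasSum
    (fun n => LSeries.norm_term_le_of_re_le_re f (s := (σ : ℂ)) (by simpa using hs) n)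

theorem exists_norm_inv_riemannZeta_le {σ : ℝ} (hσ : 1 < σ) :
    ∃ C : ℝ, 0 < C ∧ ∀ s : ℂ, σ ≤ s.re → ‖(riemannZeta s)⁻¹‖ ≤ C := by
  obtain ⟨C, hC0, hC⟩ := exists_norm_LSeries_le
    ((ArithmeticFunction.LSeriesSummable_moebius_iff (s := (σ : ℂ))).2 (by simpa using hσ))
  refine ⟨C + 1, by linarith, fun s hs => ?_⟩
  have h1 : 1 < s.re := by linarith
  have := ArithmeticFunction.LSeries_zeta_mul_Lseries_moebius h1
  rw [ArithmeticFunction.LSeries_zeta_eq_riemannZeta h1] at this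
  rw [← eq_inv_of_mul_eq_one_right this]
  linarith [hC s hs]

theorem riemannZeta₁_eq_mul {s : ℂ} (hs : s ≠ 1) :
    riemannZeta₁ s = (s - 1) * riemannZeta s := by
  rw [riemannZeta_eq_inv_sub_mul hs, mul_inv_cancel_left₀ (sub_ne_zero.2 hs)]

/-- The Riemann hypothesis, in the form of non-vanishing in the right half of the critical strip. -/
def ZetaNeZeroRightHalf : Prop := ∀ s : ℂ, 1 / 2 < s.re → s.re < 1 → riemannZeta s ≠ 0

theorem ZetaNeZeroRightHalf.riemannZeta₁_ne_zero (h : ZetaNeZeroRightHalf) {s : ℂ}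
    (hs : 1 / 2 < s.re) : riemannZeta₁ s ≠ 0 := by
  rcases eq_or_ne s 1 with rfl | h1
  · simp
  · rw [riemannZeta₁_eq_mul h1]
    refine mul_ne_zero (sub_ne_zero.2 h1) ?_
    rcases lt_or_ge s.re 1 with h2 | h2
    · exact h s hs h2
    · exact riemannZeta_ne_zero_of_one_le_re h2

theorem one_le_log_three_add (t : ℝ) : 1 ≤ Real.log (3 + |t|) := by
  rw [Real.le_log_iff_exp_le (by positivity)]
  have := Real.exp_one_lt_three
  linarith [abs_nonneg t]

/-- Under the Riemann hypothesis `ζ₁'/ζ₁ = O(log |t|)` to the right of the critical line, where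
`ζ₁(s) = (s - 1) ζ(s)`: Borel–Carathéodory for `log ζ₁` on the disc about `2 + it`. -/
theorem ZetaNeZeroRightHalf.exists_norm_logDeriv_le (h : ZetaNeZeroRightHalf) :
    ∃ C : ℝ, 0 < C ∧ ∀ s : ℂ, 5 / 8 ≤ s.re → s.re ≤ 5 / 4 →
      ‖deriv riemannZeta₁ s / riemannZeta₁ s‖ ≤ C * Real.log (3 + |s.im|) := by
  obtain ⟨K, hK0, hK⟩ := exists_norm_inv_riemannZeta_le (σ := 2) one_lt_two
  set C₁ : ℝ := |Real.log (3 * K)| + 4 with hC₁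
  have hC₁0 : 0 < C₁ := by positivity
  refine ⟨736 * C₁, by positivity, fun s hs1 hs2 => ?_⟩
  set t := s.im with ht
  set L := Real.log (3 + |t|) with hL
  have hL1 : 1 ≤ L := one_le_log_three_add t
  set c : ℂ := 2 + t * I with hc
  have hcre : c.re = 2 := by simp [hc]
  have hcim : c.im = t := by simp [hc]
  -- The disk of radius `3/2` about `c` only touches the line `Re = 1/2`, so `G` has a logarithm on
  -- the open disk.
  set G : ℂ → ℂ := fun w => riemannZeta₁ (c + w) with hG
  have hGd : Differentiable ℂ G := differentiable_riemannZeta₁.comp (by fun_prop)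
  have hre : ∀ w ∈ Metric.ball (0 : ℂ) (3 / 2), 1 / 2 < (c + w).re := by
    intro w hw
    rw [mem_ball_zero_iff] at hw
    have := (abs_lt.1 ((abs_re_le_norm w).trans_lt hw)).1
    rw [add_re, hcre]; linarith
  have hG0 : ∀ w ∈ Metric.ball (0 : ℂ) (3 / 2), G w ≠ 0 := fun w hw =>
    h.riemannZeta₁_ne_zero (hre w hw)
  have hdG : DifferentiableOn ℂ (fun w => deriv G w / G w) (Metric.ball 0 (3 / 2)) :=
    (hGd.deriv.differentiableOn).div hGd.differentiableOn hG0
  obtain ⟨F, hF0, hF⟩ := hdG.isExactOn_ball.with_val_at 0 0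
  have h0mem : (0 : ℂ) ∈ Metric.ball (0 : ℂ) (3 / 2) := by simp
  have hFd : DifferentiableOn ℂ F (Metric.ball 0 (3 / 2)) := fun w hw =>
    (hF w hw).differentiableAt.differentiableWithinAt
  have hexp : ∀ w ∈ Metric.ball (0 : ℂ) (3 / 2), Complex.exp (F w) = G w / G 0 := by
    intro w hw
    have hcst : ∀ w ∈ Metric.ball (0 : ℂ) (3 / 2),
        HasDerivAt (fun w => Complex.exp (-F w) * G w) 0 w := by
      intro w hw
      have e1 := ((hF w hw).neg.cexp).mul (hGd w).hasDerivAt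
      have e2 : deriv G w / G w * G w = deriv G w := div_mul_cancel₀ _ (hG0 w hw)
      refine e1.congr_deriv ?_
      simp only [Pi.neg_apply]
      linear_combination -Complex.exp (-F w) * e2
    have hw' := (convex_ball (0 : ℂ) (3 / 2)).is_const_of_fderivWithin_eq_zero (𝕜 := ℂ)
      (f := fun w => Complex.exp (-F w) * G w)
      (fun x hx => (hcst x hx).differentiableAt.differentiableWithinAt) (fun x hx => by
        rw [fderivWithin_of_isOpen Metric.isOpen_ball hx]
        ext; simp [(hcst x hx).hasFDerivAt.fderiv]) hw h0mem
    simp only [hF0, neg_zero, Complex.exp_zero, one_mul] at hw'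
    rw [← hw', Complex.exp_neg]
    field_simp [hG0 w hw, Complex.exp_ne_zero]
  have hc1 : c ≠ 1 := by
    intro h1; rw [h1] at hcre; norm_num at hcre
  have hGc : ‖(G 0)⁻¹‖ ≤ K := by
    simp only [hG, add_zero]
    rw [riemannZeta₁_eq_mul hc1, mul_inv, norm_mul]
    have h1 : ‖(c - 1)⁻¹‖ ≤ 1 := by
      rw [norm_inv]
      refine inv_le_one_of_one_le₀ ?_
      refine le_trans ?_ (abs_re_le_norm _)
      rw [sub_re, hcre]; norm_num
    calc _ ≤ 1 * K := by gcongr; exact hK c hcre.ge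
      _ = K := one_mul K
  have hre_le : ∀ w ∈ Metric.ball (0 : ℂ) (3 / 2), (F w).re ≤ C₁ * L := by
    intro w hw
    have hn := congrArg norm (hexp w hw)
    rw [Complex.norm_exp, div_eq_mul_inv, norm_mul] at hn
    have hwn := (mem_ball_zero_iff.1 hw).le
    have hcn : ‖c‖ ≤ 2 + |t| := by
      refine (norm_le_abs_re_add_abs_im c).trans ?_
      rw [hcre, hcim]; norm_num
    have hcn1 : ‖c - 1‖ ≤ 1 + |t| := by
      refine (norm_le_abs_re_add_abs_im _).trans ?_
      rw [sub_re, sub_im, hcre, hcim]; norm_num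
    have n1 : ‖c + w‖ ≤ 2 * (3 + |t|) := by
      have := norm_add_le c w
      linarith [abs_nonneg t]
    have n2 : ‖c + w - 1‖ ≤ (3 + |t|) := by
      have := norm_add_le (c - 1) w
      rw [show c + w - 1 = c - 1 + w by ring]
      linarith [abs_nonneg t]
    have hg : ‖G w‖ ≤ 3 * (2 * (3 + |t|) ^ 2) := by
      refine (norm_riemannZeta₁_le (hre w hw).le).trans ?_
      have ht3 : 1 ≤ 3 + |t| := by linarith [abs_nonneg t]
      calc _ ≤ 2 * (3 + |t|) + 2 * (2 * (3 + |t|) * (3 + |t|)) := by gcongr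
        _ ≤ _ := by nlinarith
    have : Real.exp (F w).re ≤ Real.exp (C₁ * L) := by
      rw [hn]
      have e1 : (3 + |t|) ^ 2 = Real.exp (2 * L) := by
        rw [mul_comm, Real.exp_mul, Real.exp_log (by positivity)]
        norm_num
      have e2 : (2 : ℝ) ≤ Real.exp 1 := by
        have := Real.add_one_le_exp (1 : ℝ)
        linarith
      have e3 : 3 * K ≤ Real.exp |Real.log (3 * K)| := by
        calc 3 * K = Real.exp (Real.log (3 * K)) := (Real.exp_log (by positivity)).symm
          _ ≤ _ := Real.exp_le_exp.2 (le_abs_self _)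
      calc ‖G w‖ * ‖(G 0)⁻¹‖ ≤ 3 * (2 * (3 + |t|) ^ 2) * K := by gcongr
        _ = (3 * K) * 2 * Real.exp (2 * L) := by rw [e1]; ring
        _ ≤ Real.exp |Real.log (3 * K)| * Real.exp 1 * Real.exp (2 * L) := by gcongr
        _ = Real.exp (|Real.log (3 * K)| + 1 + 2 * L) := by rw [Real.exp_add, Real.exp_add]
        _ ≤ _ := by
          refine Real.exp_le_exp.2 ?_
          rw [hC₁]
          nlinarith [abs_nonneg (Real.log (3 * K))]
    exact Real.exp_le_exp.1 this
  have hM : 0 < C₁ * L := by positivity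
  set w := s - c with hw
  have hsw : c + w = s := by rw [hw]; ring
  have hwn : ‖w‖ ≤ 11 / 8 := by
    have : w = ((s.re - 2 : ℝ) : ℂ) := by
      apply Complex.ext <;> simp [hw, hcre, hcim, ht]
    rw [this, Complex.norm_real, Real.norm_eq_abs, abs_le]
    constructor <;> linarith
  have hball : Metric.closedBall w (1 / 16) ⊆ Metric.ball 0 (3 / 2) := by
    intro x hx
    rw [mem_closedBall_iff_norm] at hx
    rw [mem_ball_zero_iff]
    have := norm_sub_norm_le x w
    linarith
  have hsph : ∀ x ∈ Metric.sphere w (1 / 16), ‖F x‖ ≤ 46 * (C₁ * L) := by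
    intro x hx
    have hx' := hball (Metric.sphere_subset_closedBall hx)
    have hxn : ‖x‖ ≤ 23 / 16 := by
      have h1 := mem_sphere_iff_norm.1 hx
      have := norm_sub_norm_le x w
      linarith
    have hbc := Complex.borelCaratheodory_zero hM hFd hre_le (by norm_num) hx' hF0
    refine hbc.trans ?_
    rw [div_le_iff₀ (by linarith)]
    nlinarith [mul_nonneg hM.le (norm_nonneg x)]
  have hder := Complex.norm_deriv_le_of_forall_mem_sphere_norm_le (f := F) (c := w) (R := 1 / 16)
    (by norm_num) ((hFd.mono hball).diffContOnCl_ball subset_rfl) hsph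
  have hwm : w ∈ Metric.ball (0 : ℂ) (3 / 2) := hball (Metric.mem_closedBall_self (by norm_num))
  rw [(hF w hwm).deriv] at hder
  have hdG' : deriv G w = deriv riemannZeta₁ s := by
    have := deriv_comp_const_add (f := riemannZeta₁) c w
    rw [hsw] at this
    exact this
  rw [hdG'] at hder
  simp only [hG, hsw] at hder
  refine hder.trans (le_of_eq ?_)
  ring

theorem exists_norm_logDeriv_le_right : ∃ C : ℝ, 0 < C ∧ ∀ s : ℂ, s.re = 5 / 4 →
    ‖deriv riemannZeta₁ s / riemannZeta₁ s‖ ≤ C := by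
  obtain ⟨C, hC0, hC⟩ := exists_norm_LSeries_le
    (ArithmeticFunction.LSeriesSummable_vonMangoldt (s := ((5 / 4 : ℝ) : ℂ))
      (by rw [ofReal_re]; norm_num))
  refine ⟨C + 4, by linarith, fun s hs => ?_⟩
  have h1 : 1 < s.re := by rw [hs]; norm_num
  have hs1 : s ≠ 1 := by rintro rfl; simp at h1
  have hz : riemannZeta s ≠ 0 := riemannZeta_ne_zero_of_one_le_re h1.le
  have hder : deriv riemannZeta₁ s = riemannZeta s + (s - 1) * deriv riemannZeta s := by
    have e : riemannZeta₁ =ᶠ[𝓝 s] fun s => (s - 1) * riemannZeta s := by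
      filter_upwards [isOpen_ne.mem_nhds hs1] with z hz using riemannZeta₁_eq_mul hz
    rw [e.deriv_eq]
    have := ((hasDerivAt_id s).sub_const 1).fun_mul (differentiableAt_riemannZeta hs1).hasDerivAt
    simpa using this.deriv
  have e : deriv riemannZeta₁ s / riemannZeta₁ s =
      (s - 1)⁻¹ - LSeries (fun n => (ArithmeticFunction.vonMangoldt n : ℂ)) s := by
    rw [ArithmeticFunction.LSeries_vonMangoldt_eq_deriv_riemannZeta_div h1, hder,
      riemannZeta₁_eq_mul hs1]
    field_simp [sub_ne_zero.2 hs1]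
    ring
  rw [e]
  refine (norm_sub_le _ _).trans ?_
  have h4 : ‖(s - 1)⁻¹‖ ≤ 4 := by
    rw [norm_inv]
    refine inv_le_of_inv_le₀ (by norm_num) ?_
    refine le_trans ?_ (abs_re_le_norm _)
    rw [sub_re, hs]; norm_num
  linarith [hC s hs.ge]

/-- Under the Riemann hypothesis `ζ₁'/ζ₁` is a smaller power of `log |t|` away from the critical
line: three lines between `Re s = 5/8` and `Re s = 5/4`, localised by the factor `e^{(s - it)²}`. -/
theorem ZetaNeZeroRightHalf.exists_norm_logDeriv_le_rpow (h : ZetaNeZeroRightHalf) :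
    ∃ A : ℝ, 0 < A ∧ ∀ s : ℂ, 3 / 4 ≤ s.re → s.re ≤ 5 / 4 →
      ‖deriv riemannZeta₁ s / riemannZeta₁ s‖ ≤ A * Real.log (3 + |s.im|) ^ (4 / 5 : ℝ) := by
  obtain ⟨C, hC0, hC⟩ := h.exists_norm_logDeriv_le
  obtain ⟨K, hK0, hK⟩ := exists_norm_logDeriv_le_right
  set E : ℝ := Real.exp (25 / 16) with hE
  set A : ℝ := max 1 (max (2 * C * E) (K * E)) with hA
  have hA1 : 1 ≤ A := le_max_left _ _
  have hA2 : 2 * C * E ≤ A := (le_max_left _ _).trans (le_max_right _ _)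
  have hA3 : K * E ≤ A := (le_max_right _ _).trans (le_max_right _ _)
  refine ⟨A, by linarith, fun s hs1 hs2 => ?_⟩
  set t₀ := s.im with ht₀
  set L := Real.log (3 + |t₀|) with hL
  have hL1 : 1 ≤ L := one_le_log_three_add t₀
  set D : ℂ → ℂ := fun z => deriv riemannZeta₁ z / riemannZeta₁ z with hD
  set f : ℂ → ℂ := fun z => D z * Complex.exp ((z - t₀ * I) ^ 2) with hf
  have hnexp : ∀ z : ℂ, ‖Complex.exp ((z - t₀ * I) ^ 2)‖ =
      Real.exp (z.re ^ 2) * Real.exp (-(z.im - t₀) ^ 2) := by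
    intro z
    rw [Complex.norm_exp, ← Real.exp_add]
    congr 1
    simp [sq]
    ring
  have hnexp_le : ∀ z : ℂ, 5 / 8 ≤ z.re → z.re ≤ 5 / 4 →
      ‖Complex.exp ((z - t₀ * I) ^ 2)‖ ≤ E * Real.exp (-(z.im - t₀) ^ 2) := by
    intro z h1 h2
    rw [hnexp, hE]
    gcongr
    nlinarith
  have hstrip : ∀ z : ℂ, 5 / 8 ≤ z.re → z.re ≤ 5 / 4 → ‖f z‖ ≤ 2 * C * E * L := by
    intro z h1 h2
    set x := |z.im - t₀| with hx
    have hx0 : 0 ≤ x := abs_nonneg _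
    have hlog : Real.log (3 + |z.im|) ≤ L + x := by
      have e1 : 3 + |z.im| ≤ (3 + |t₀|) * Real.exp x := by
        have h3 : |z.im| ≤ |t₀| + x := by
          have := abs_add_le t₀ (z.im - t₀)
          simpa using this
        have := Real.add_one_le_exp x
        nlinarith [abs_nonneg t₀]
      calc _ ≤ Real.log ((3 + |t₀|) * Real.exp x) := Real.log_le_log (by positivity) e1
        _ = _ := by rw [Real.log_mul (by positivity) (by positivity), Real.log_exp]
    have hexp : Real.exp (-(z.im - t₀) ^ 2) * (1 + x) ≤ 2 := by
      have e1 := Real.add_one_le_exp ((z.im - t₀) ^ 2)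
      have e2 : (z.im - t₀) ^ 2 = x ^ 2 := (sq_abs _).symm
      rw [Real.exp_neg, inv_mul_le_iff₀ (Real.exp_pos _)]
      rw [e2] at e1 ⊢
      nlinarith [sq_nonneg (x - 1)]
    rw [hf, norm_mul]
    calc _ ≤ C * Real.log (3 + |z.im|) * (E * Real.exp (-(z.im - t₀) ^ 2)) := by
          gcongr
          · exact mul_nonneg hC0.le (zero_le_one.trans (one_le_log_three_add _))
          · exact hC z h1 h2
          · exact hnexp_le z h1 h2
      _ ≤ C * (L * (1 + x)) * (E * Real.exp (-(z.im - t₀) ^ 2)) := by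
          gcongr
          nlinarith
      _ = C * L * E * (Real.exp (-(z.im - t₀) ^ 2) * (1 + x)) := by ring
      _ ≤ C * L * E * 2 := by gcongr
      _ = _ := by ring
  have hdiff : DifferentiableOn ℂ f {z | 1 / 2 < z.re} := by
    refine DifferentiableOn.mul ?_ (by fun_prop)
    exact differentiable_riemannZeta₁.deriv.differentiableOn.div
      differentiable_riemannZeta₁.differentiableOn fun z hz => h.riemannZeta₁_ne_zero hz
  have hcl : DiffContOnCl ℂ f (HadamardThreeLines.verticalStrip (5 / 8) (5 / 4)) := by
    refine DifferentiableOn.diffContOnCl (hdiff.mono ?_)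
    intro z hz
    have : closure (HadamardThreeLines.verticalStrip (5 / 8) (5 / 4)) ⊆ {z | 5 / 8 ≤ z.re} :=
      closure_minimal (fun w hw => hw.1.le) (isClosed_le continuous_const continuous_re)
    have : (5 / 8 : ℝ) ≤ z.re := this hz
    show 1 / 2 < z.re
    linarith
  have hthree := HadamardThreeLines.norm_le_interp_of_mem_verticalClosedStrip' (f := f) (z := s)
    (a := A * L) (b := A) (l := 5 / 8) (u := 5 / 4) (by norm_num)
    ⟨by linarith, hs2⟩ hcl
    ⟨2 * C * E * L, by
      rintro _ ⟨z, hz, rfl⟩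
      exact hstrip z hz.1 hz.2⟩
    (fun z hz => by
      have hz : z.re = 5 / 8 := hz
      refine (hstrip z hz.ge (by rw [hz]; norm_num)).trans ?_
      gcongr)
    (fun z hz => by
      have hz : z.re = 5 / 4 := hz
      rw [hf, norm_mul]
      calc _ ≤ K * (E * 1) := by
            gcongr
            · exact hK z hz
            · refine (hnexp_le z (by rw [hz]; norm_num) hz.le).trans ?_
              gcongr
              exact Real.exp_le_one_iff.2 (by nlinarith [sq_nonneg (z.im - t₀)])
        _ ≤ A := by rw [mul_one]; exact hA3)
  have hDf : ‖D s‖ ≤ ‖f s‖ := by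
    rw [hf, norm_mul, hnexp]
    have : (1 : ℝ) ≤ Real.exp (s.re ^ 2) := Real.one_le_exp (sq_nonneg _)
    simp only [← ht₀, sub_self]
    norm_num
    exact le_mul_of_one_le_right (norm_nonneg _) this
  refine hDf.trans (hthree.trans ?_)
  set θ := (s.re - 5 / 8) / (5 / 4 - 5 / 8) with hθ
  have hθ1 : 1 / 5 ≤ θ := by rw [hθ, le_div_iff₀ (by norm_num)]; linarith
  have hA0 : 0 < A := by linarith
  have hL0 : 0 < L := by linarith
  rw [Real.mul_rpow hA0.le hL0.le, mul_right_comm, ← Real.rpow_add hA0]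
  rw [show 1 - θ + θ = 1 by ring, Real.rpow_one]
  gcongr
  linarith

/-- `1 / ζ` with the value `0` at the pole of `ζ`; holomorphic in `Re u > 1/2` under the Riemann
hypothesis. -/
noncomputable def invZeta (u : ℂ) : ℂ := (u - 1) / riemannZeta₁ u

theorem invZeta_eq_inv {u : ℂ} (hu : u ≠ 1) : invZeta u = (riemannZeta u)⁻¹ := by
  rw [invZeta, riemannZeta₁_eq_mul hu, div_mul_cancel_left₀ (sub_ne_zero.2 hu)]

theorem ZetaNeZeroRightHalf.differentiableOn_invZeta (h : ZetaNeZeroRightHalf) :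
    DifferentiableOn ℂ invZeta {u | 1 / 2 < u.re} := by
  have : DifferentiableOn ℂ (fun u => (u - 1) / riemannZeta₁ u) {u | 1 / 2 < u.re} :=
    DifferentiableOn.div (by fun_prop) differentiable_riemannZeta₁.differentiableOn
      fun z hz => h.riemannZeta₁_ne_zero hz
  exact this

/-- Littlewood's bound for `1 / ζ` under the Riemann hypothesis: `1 / ζ(u)` is smaller than any
power of `|Im u|`, uniformly in `Re u ≥ 3/4`. -/
theorem ZetaNeZeroRightHalf.exists_norm_invZeta_le (h : ZetaNeZeroRightHalf) {ε : ℝ} (hε : 0 < ε) :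
    ∃ C : ℝ, 0 < C ∧ ∀ u : ℂ, 3 / 4 ≤ u.re → ‖invZeta u‖ ≤ C * (1 + |u.im|) ^ ε := by
  obtain ⟨K, hK0, hK⟩ := exists_norm_inv_riemannZeta_le (σ := 5 / 4) (by norm_num)
  obtain ⟨A, hA0, hA⟩ := h.exists_norm_logDeriv_le_rpow
  set Q : ℝ := A * (A / ε) ^ (4 : ℝ) with hQ
  have hQ0 : 0 ≤ Q := by positivity
  refine ⟨K * Real.exp Q * 3 ^ ε, by positivity, fun u hu => ?_⟩
  set t := u.im with ht
  have ht1 : 1 ≤ 1 + |t| := by linarith [abs_nonneg t]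
  have h3 : (1 : ℝ) ≤ 3 ^ ε := Real.one_le_rpow (by norm_num) hε.le
  have h4 : (1 : ℝ) ≤ (1 + |t|) ^ ε := Real.one_le_rpow ht1 hε.le
  have hbase : K ≤ K * Real.exp Q * 3 ^ ε * (1 + |t|) ^ ε := by
    have : 1 ≤ Real.exp Q := Real.one_le_exp hQ0
    calc K = K * 1 * 1 * 1 := by ring
      _ ≤ _ := by gcongr
  rcases le_total (5 / 4) u.re with hu2 | hu2
  · have h1 : u ≠ 1 := by rintro rfl; norm_num at hu2
    rw [invZeta_eq_inv h1]
    exact (hK u hu2).trans hbase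
  set L := Real.log (3 + |t|) with hL
  have hL1 : 1 ≤ L := one_le_log_three_add t
  -- Grönwall's inequality for `1 / ζ₁` along the horizontal segment from `5/4 + it` to `u`.
  set p : ℝ → ℂ := fun x => ((5 / 4 - x : ℝ) : ℂ) + t * I with hp
  have hpre : ∀ x, (p x).re = 5 / 4 - x := fun x => by simp [hp]
  have hpim : ∀ x, (p x).im = t := fun x => by simp [hp]
  have hpd : ∀ x, HasDerivAt p (-1) x := by
    intro x
    have := ((hasDerivAt_id x).const_sub (5 / 4)).ofReal_comp.add_const ((t : ℂ) * I)
    simpa [hp] using this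
  set R := 5 / 4 - u.re with hR
  have hR0 : 0 ≤ R := by linarith
  have hR1 : R ≤ 1 / 2 := by linarith
  have hne : ∀ x, x ≤ 1 / 2 → riemannZeta₁ (p x) ≠ 0 := fun x hx =>
    h.riemannZeta₁_ne_zero (by rw [hpre]; linarith)
  have hder : ∀ x, x ≤ 1 / 2 → HasDerivAt (fun x => (riemannZeta₁ (p x))⁻¹)
      (deriv riemannZeta₁ (p x) / riemannZeta₁ (p x) * (riemannZeta₁ (p x))⁻¹) x := by
    intro x hx
    have e1 := (differentiable_riemannZeta₁ (p x)).hasDerivAt.comp x (hpd x)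
    refine (e1.inv (hne x hx)).congr_deriv ?_
    have := hne x hx
    simp only [Function.comp]
    field_simp
  have hgr := norm_le_gronwallBound_of_norm_deriv_right_le
    (f := fun x => (riemannZeta₁ (p x))⁻¹) (a := 0) (b := R)
    (δ := ‖(riemannZeta₁ (p 0))⁻¹‖) (K := A * L ^ (4 / 5 : ℝ)) (ε := 0)
    (fun x hx => (hder x (hx.2.trans hR1)).continuousAt.continuousWithinAt)
    (fun x hx => (hder x (hx.2.le.trans hR1)).hasDerivWithinAt) le_rfl
    (fun x hx => by
      rw [norm_mul, add_zero]
      gcongr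
      have := hA (p x) (by rw [hpre]; linarith [hx.2]) (by rw [hpre]; linarith [hx.1])
      rwa [hpim] at this) R (right_mem_Icc.2 hR0)
  rw [gronwallBound_ε0, sub_zero] at hgr
  have hpR : p R = u := by
    apply Complex.ext
    · rw [hpre, hR]; ring
    · rw [hpim]
  rw [hpR] at hgr
  have hp0 : p 0 ≠ 1 := by
    intro h1
    have := hpre 0
    rw [h1] at this; norm_num at this
  have hu1 : ‖u - 1‖ ≤ ‖p 0 - 1‖ := by
    rw [← sq_le_sq₀ (norm_nonneg _) (norm_nonneg _), Complex.sq_norm, Complex.sq_norm,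
      Complex.normSq_apply, Complex.normSq_apply]
    simp only [sub_re, sub_im, one_re, one_im, hpre, hpim, ← ht]
    nlinarith
  have hK0' := hK (p 0) (by rw [hpre]; norm_num)
  rw [← invZeta_eq_inv hp0, invZeta, norm_div] at hK0'
  -- `A L^(4/5) ≤ ε L` once `L ≥ (A / ε)⁵`; otherwise the left side is at most the constant `Q`.
  have hweight : A * L ^ (4 / 5 : ℝ) * R ≤ Q + ε * L := by
    have hL0 : 0 ≤ L := by linarith
    have e0 : A * L ^ (4 / 5 : ℝ) * R ≤ A * L ^ (4 / 5 : ℝ) := by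
      have : 0 ≤ A * L ^ (4 / 5 : ℝ) := by positivity
      nlinarith
    refine e0.trans ?_
    rcases le_total ((A / ε) ^ (5 : ℝ)) L with hl | hl
    · have e1 : A / ε ≤ L ^ (1 / 5 : ℝ) := by
        have := Real.rpow_le_rpow (by positivity) hl (by norm_num : (0 : ℝ) ≤ 1 / 5)
        rwa [← Real.rpow_mul (by positivity), show (5 : ℝ) * (1 / 5) = 1 by norm_num,
          Real.rpow_one] at this
      have e2 : A ≤ ε * L ^ (1 / 5 : ℝ) := by
        rwa [div_le_iff₀ hε, mul_comm] at e1
      have e3 : L ^ (1 / 5 : ℝ) * L ^ (4 / 5 : ℝ) = L := by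
        rw [← Real.rpow_add (by linarith)]; norm_num
      calc A * L ^ (4 / 5 : ℝ) ≤ ε * L ^ (1 / 5 : ℝ) * L ^ (4 / 5 : ℝ) := by gcongr
        _ = ε * L := by rw [mul_assoc, e3]
        _ ≤ _ := by linarith
    · have e1 : L ^ (4 / 5 : ℝ) ≤ (A / ε) ^ (4 : ℝ) := by
        have := Real.rpow_le_rpow hL0 hl (by norm_num : (0 : ℝ) ≤ 4 / 5)
        rwa [← Real.rpow_mul (by positivity), show (5 : ℝ) * (4 / 5) = 4 by norm_num] at this
      calc A * L ^ (4 / 5 : ℝ) ≤ Q := by rw [hQ]; gcongr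
        _ ≤ _ := by nlinarith
  have hexpL : Real.exp (ε * L) ≤ 3 ^ ε * (1 + |t|) ^ ε := by
    rw [mul_comm, Real.exp_mul, Real.exp_log (by positivity),
      ← Real.mul_rpow (by norm_num) (by positivity)]
    exact Real.rpow_le_rpow (by positivity) (by linarith [abs_nonneg t]) hε.le
  rw [invZeta, div_eq_mul_inv, norm_mul]
  calc _ ≤ ‖p 0 - 1‖ * (‖(riemannZeta₁ (p 0))⁻¹‖ * Real.exp (A * L ^ (4 / 5 : ℝ) * R)) := by
        gcongr
    _ = ‖p 0 - 1‖ / ‖riemannZeta₁ (p 0)‖ * Real.exp (A * L ^ (4 / 5 : ℝ) * R) := by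
        rw [norm_inv]; ring
    _ ≤ K * Real.exp (Q + ε * L) := by gcongr
    _ = K * Real.exp Q * Real.exp (ε * L) := by rw [Real.exp_add]; ring
    _ ≤ K * Real.exp Q * (3 ^ ε * (1 + |t|) ^ ε) := by gcongr
    _ = _ := by ring

/-! ### Orthogonality in the Steinhaus model -/

theorem integral_toCircle_zpow (k : ℤ) :
    ∫ x : UnitAddCircle, (AddCircle.toCircle x : ℂ) ^ k ∂AddCircle.haarAddCircle =
      if k = 0 then 1 else 0 := by
  have h := (orthonormal_iff_ite.1 (orthonormal_fourier (T := (1 : ℝ)))) 0 k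
  rw [ContinuousMap.inner_toLp] at h
  simp only [fourier_zero] at h
  rw [← show (∫ x : UnitAddCircle, fourier k x ∂AddCircle.haarAddCircle) =
    ∫ x : UnitAddCircle, (AddCircle.toCircle x : ℂ) ^ k ∂AddCircle.haarAddCircle by
      congr 1
      ext x
      rw [fourier_apply, AddCircle.toCircle_zsmul]
      push_cast
      rfl]
  simpa [eq_comm] using h

/-- `f(n)` as a product over any finite set of primes containing the prime divisors of `n`, so that
several values can be compared over one index set. -/
theorem steinhausF_eq_prod {n : ℕ} (hn : n ≠ 0) (S : Finset Nat.Primes)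
    (hS : ∀ p : Nat.Primes, (p : ℕ) ∣ n → p ∈ S) (θ : SteinhausSpace) :
    steinhausF θ n = ∏ p ∈ S, (AddCircle.toCircle (θ p) : ℂ) ^ n.factorization p := by
  classical
  rw [steinhausF, if_neg hn]
  set i : {x // x ∈ n.primeFactors} → Nat.Primes :=
    fun p => ⟨p.1, Nat.prime_of_mem_primeFactors p.2⟩ with hi
  have hinj : Set.InjOn i (n.primeFactors.attach : Set _) := by
    intro a _ b _ hab
    exact Subtype.ext (congrArg (fun p : Nat.Primes => (p : ℕ)) hab)
  rw [show (∏ p ∈ n.primeFactors.attach,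
      (AddCircle.toCircle (θ ⟨p.1, Nat.prime_of_mem_primeFactors p.2⟩) : ℂ) ^
        n.factorization p.1) =
    ∏ p ∈ n.primeFactors.attach.image i,
      (AddCircle.toCircle (θ p) : ℂ) ^ n.factorization p by rw [Finset.prod_image hinj]]
  refine Finset.prod_subset ?_ ?_
  · intro p hp
    obtain ⟨q, -, rfl⟩ := Finset.mem_image.1 hp
    exact hS _ (Nat.dvd_of_mem_primeFactors q.2)
  · intro p _ hp
    have : n.factorization p = 0 := by
      by_contra h
      refine hp (Finset.mem_image.2 ⟨⟨p, ?_⟩, Finset.mem_attach _ _, rfl⟩)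
      exact Nat.support_factorization n ▸ Finsupp.mem_support_iff.2 h
    rw [this, pow_zero]

/-- The prime divisors of `n`, as a finite set of primes. -/
noncomputable def primeDivisors (n : ℕ) : Finset Nat.Primes := by
  classical
  exact n.primeFactors.attach.image fun p => ⟨p.1, Nat.prime_of_mem_primeFactors p.2⟩

theorem mem_primeDivisors {n : ℕ} (hn : n ≠ 0) {p : Nat.Primes} (h : (p : ℕ) ∣ n) :
    p ∈ primeDivisors n := by
  classical
  exact Finset.mem_image.2 ⟨⟨p, Nat.mem_primeFactors.2 ⟨p.2, h, hn⟩⟩, Finset.mem_attach _ _, rfl⟩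

theorem steinhausF_mul (θ : SteinhausSpace) (m n : ℕ) :
    steinhausF θ (m * n) = steinhausF θ m * steinhausF θ n := by
  rcases eq_or_ne m 0 with rfl | hm
  · simp [steinhausF]
  rcases eq_or_ne n 0 with rfl | hn
  · simp [steinhausF]
  have hmn := mul_ne_zero hm hn
  have hS : ∀ p : Nat.Primes, (p : ℕ) ∣ m * n → p ∈ primeDivisors (m * n) := fun p hp =>
    mem_primeDivisors hmn hp
  rw [steinhausF_eq_prod hmn _ hS, steinhausF_eq_prod hm (primeDivisors (m * n))
    fun p hp => hS p (hp.mul_right n), steinhausF_eq_prod hn (primeDivisors (m * n))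
    fun p hp => hS p (hp.mul_left m), ← Finset.prod_mul_distrib]
  refine Finset.prod_congr rfl fun p _ => ?_
  rw [Nat.factorization_mul hm hn, Finsupp.add_apply, pow_add]

/-- Orthogonality of the Steinhaus random multiplicative function. -/
theorem steinhausE_mul_conj {m n : ℕ} (hm : m ≠ 0) (hn : n ≠ 0) :
    steinhausE (fun θ => steinhausF θ m * starRingEnd ℂ (steinhausF θ n)) =
      if m = n then 1 else 0 := by
  classical
  set S := primeDivisors (m * n) with hS'
  have hmn := mul_ne_zero hm hn
  have hS : ∀ p : Nat.Primes, (p : ℕ) ∣ m * n → p ∈ S := fun p hp => mem_primeDivisors hmn hp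
  set e : Nat.Primes → ℤ := fun p => (m.factorization p : ℤ) - n.factorization p with he
  have h1 : ∀ θ : SteinhausSpace, steinhausF θ m * starRingEnd ℂ (steinhausF θ n) =
      (fun y : (p : S) → UnitAddCircle => ∏ p : S, (AddCircle.toCircle (y p) : ℂ) ^ e p)
        (S.restrict θ) := by
    intro θ
    rw [steinhausF_eq_prod hm S fun p hp => hS p (hp.mul_right n),
      steinhausF_eq_prod hn S fun p hp => hS p (hp.mul_left m), map_prod,
      ← Finset.prod_mul_distrib]
    simp only [Finset.restrict]
    rw [← Finset.prod_coe_sort S]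
    refine Finset.prod_congr rfl fun p _ => ?_
    have hne : (AddCircle.toCircle (θ p) : ℂ) ≠ 0 := Circle.coe_ne_zero _
    rw [map_pow, ← Circle.coe_inv_eq_conj, he, zpow_sub₀ hne, zpow_natCast, zpow_natCast,
      Circle.coe_inv, inv_pow, div_eq_mul_inv]
  have h2 : AEStronglyMeasurable
      (fun y : (p : S) → UnitAddCircle => ∏ p : S, (AddCircle.toCircle (y p) : ℂ) ^ e p)
      (Measure.pi fun _ : S => (AddCircle.haarAddCircle : Measure UnitAddCircle)) := by
    refine Continuous.aestronglyMeasurable ?_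
    refine continuous_finsetProd _ fun p _ => ?_
    have hc : Continuous fun y : (p : S) → UnitAddCircle => (AddCircle.toCircle (y p) : ℂ) :=
      continuous_subtype_val.comp (AddCircle.continuous_toCircle.comp (continuous_apply p))
    exact hc.zpow₀ _ fun y => Or.inl (Circle.coe_ne_zero _)
  rw [steinhausE, integral_congr_ae (ae_of_all _ h1)]
  refine (integral_restrict_infinitePi
    (μ := fun _ : Nat.Primes => (AddCircle.haarAddCircle : Measure UnitAddCircle)) h2).trans ?_
  rw [integral_fintype_prod_eq_prod (𝕜 := ℂ)
    (fun (p : S) (x : UnitAddCircle) => (AddCircle.toCircle x : ℂ) ^ e p)]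
  simp_rw [integral_toCircle_zpow]
  split_ifs with h
  · subst h
    simp [he]
  · have : ∃ p : Nat.Primes, m.factorization p ≠ n.factorization p := by
      by_contra hcon
      push Not at hcon
      refine h (Nat.eq_of_factorization_eq hm hn fun p => ?_)
      by_cases hp : p.Prime
      · exact hcon ⟨p, hp⟩
      · rw [Nat.factorization_eq_zero_of_not_prime _ hp,
          Nat.factorization_eq_zero_of_not_prime _ hp]
    obtain ⟨p, hp⟩ := this
    have hpS : p ∈ S := by
      refine hS p ?_
      by_contra hd
      rw [Nat.Prime.dvd_mul p.2, not_or] at hd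
      exact hp (by rw [Nat.factorization_eq_zero_of_not_dvd hd.1,
        Nat.factorization_eq_zero_of_not_dvd hd.2])
    refine Finset.prod_eq_zero (Finset.mem_univ ⟨p, hpS⟩) (if_neg ?_)
    simp only [he]
    lia

theorem steinhausE_const_mul (c : ℂ) (X : SteinhausSpace → ℂ) :
    steinhausE (fun θ => c * X θ) = c * steinhausE X := integral_const_mul _ _

/-- The averaged coefficient of the four-variable Dirichlet series. -/
theorem steinhausE_ratio {r : ℕ} (hr : r ≠ 1) (a b c d : ℕ) :
    steinhausE (fun θ => fStar r θ a * starRingEnd ℂ (fStar r θ b) * muStar r θ c *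
        starRingEnd ℂ (muStar r θ d)) =
      if (a.Coprime r ∧ b.Coprime r ∧ c.Coprime r ∧ d.Coprime r) ∧ a * c = b * d then
        (ArithmeticFunction.moebius c : ℂ) * (ArithmeticFunction.moebius d : ℂ) else 0 := by
  by_cases h : a.Coprime r ∧ b.Coprime r ∧ c.Coprime r ∧ d.Coprime r
  · obtain ⟨ha, hb, hc, hd⟩ := h
    have hne : ∀ n : ℕ, n.Coprime r → n ≠ 0 := by
      rintro n hn rfl
      exact hr (by simpa using hn)
    have e : ∀ θ, fStar r θ a * starRingEnd ℂ (fStar r θ b) * muStar r θ c *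
        starRingEnd ℂ (muStar r θ d) =
        ((ArithmeticFunction.moebius c : ℂ) * (ArithmeticFunction.moebius d : ℂ)) *
          (steinhausF θ (a * c) * starRingEnd ℂ (steinhausF θ (b * d))) := by
      intro θ
      rw [muStar, muStar, fStar, fStar, fStar, fStar, if_pos ha, if_pos hb, if_pos hc, if_pos hd,
        steinhausF_mul, steinhausF_mul, map_mul, map_mul, map_intCast]
      ring
    simp_rw [e]
    rw [steinhausE_const_mul, steinhausE_mul_conj (mul_ne_zero (hne a ha) (hne c hc))
      (mul_ne_zero (hne b hb) (hne d hd))]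
    by_cases h : a * c = b * d
    · rw [if_pos h, if_pos ⟨⟨ha, hb, hc, hd⟩, h⟩, mul_one]
    · rw [if_neg h, if_neg fun hh => h hh.2, mul_zero]
  · rw [if_neg (fun hh => h hh.1)]
    have e : ∀ θ, fStar r θ a * starRingEnd ℂ (fStar r θ b) * muStar r θ c *
        starRingEnd ℂ (muStar r θ d) = 0 := by
      intro θ
      by_contra hne
      refine h ⟨?_, ?_, ?_, ?_⟩ <;>
      · by_contra hcon
        exact hne (by simp [muStar, fStar, show ¬ Nat.gcd _ r = 1 from hcon])
    simp_rw [e]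
    simp [steinhausE]

/-! ### Closed form of the four-variable Dirichlet series -/

theorem summable_norm_natCast_cpow_neg {s : ℂ} (hs : 1 < s.re) :
    Summable fun n : ℕ => ‖(n : ℂ) ^ (-s)‖ := by
  have := Real.summable_nat_rpow_inv.2 hs
  refine this.congr fun n => ?_
  rw [norm_natCast_cpow_of_re_ne_zero n (by simp; linarith), neg_re, Real.rpow_neg n.cast_nonneg]

theorem DirichletCharacter.one_apply_natCast (M n : ℕ) :
    (1 : DirichletCharacter ℂ M) (n : ZMod M) = if n.Coprime M then 1 else 0 := by
  split_ifs with h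
  · exact MulChar.one_apply ((ZMod.isUnit_iff_coprime n M).2 h)
  · exact MulChar.map_nonunit _ fun hu => h ((ZMod.isUnit_iff_coprime n M).1 hu)

/-- `∑_{(n, M) = 1} n⁻ˢ = ζ(s) ∏_{p ∣ M} (1 - p⁻ˢ)`. -/
theorem hasSum_coprime {M : ℕ} (hM : M ≠ 0) {s : ℂ} (hs : 1 < s.re) :
    HasSum (fun n : ℕ => if n.Coprime M then (n : ℂ) ^ (-s) else 0)
      ((∏ p ∈ M.primeFactors, (1 - (p : ℂ) ^ (-s))) * riemannZeta s) := by
  have : NeZero M := ⟨hM⟩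
  have hs1 : s ≠ 1 := by rintro rfl; simp at hs
  have hs0 : s ≠ 0 := by rintro rfl; simp at hs; linarith
  have h := (DirichletCharacter.LSeriesSummable_of_one_lt_re
    (1 : DirichletCharacter ℂ M) hs).LSeriesHasSum
  rw [← DirichletCharacter.LFunction_eq_LSeries _ hs] at h
  have e := DirichletCharacter.LFunctionTrivChar_eq_mul_riemannZeta (N := M) hs1
  rw [DirichletCharacter.LFunctionTrivChar] at e
  rw [e, LSeriesHasSum] at h
  convert h using 1
  ext n
  rcases eq_or_ne n 0 with rfl | hn
  · simp [hs0]
  · rw [LSeries.term_of_ne_zero hn, DirichletCharacter.one_apply_natCast, cpow_neg]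
    split_ifs <;> simp

/-- `∑_{(n, M) = 1} μ(n) n⁻ˢ = ζ(s)⁻¹ ∏_{p ∣ M} (1 - p⁻ˢ)⁻¹`. -/
theorem hasSum_coprime_moebius {M : ℕ} (hM : M ≠ 0) {s : ℂ} (hs : 1 < s.re) :
    HasSum (fun n : ℕ => if n.Coprime M then
        (ArithmeticFunction.moebius n : ℂ) * (n : ℂ) ^ (-s) else 0)
      ((∏ p ∈ M.primeFactors, (1 - (p : ℂ) ^ (-s)))⁻¹ * invZeta s) := by
  have : NeZero M := ⟨hM⟩
  have hs1 : s ≠ 1 := by rintro rfl; simp at hs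
  have hs0 : s ≠ 0 := by rintro rfl; simp at hs; linarith
  have h1 := DirichletCharacter.LSeries.mul_mu_eq_one (1 : DirichletCharacter ℂ M) hs
  have h := (DirichletCharacter.LSeriesSummable_mul (1 : DirichletCharacter ℂ M)
    ((ArithmeticFunction.LSeriesSummable_moebius_iff (s := s)).2 hs)).LSeriesHasSum
  have e := DirichletCharacter.LFunctionTrivChar_eq_mul_riemannZeta (N := M) hs1
  rw [DirichletCharacter.LFunctionTrivChar, DirichletCharacter.LFunction_eq_LSeries _ hs] at e
  rw [e] at h1
  rw [eq_inv_of_mul_eq_one_right h1, LSeriesHasSum] at h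
  rw [invZeta_eq_inv hs1, ← mul_inv]
  convert h using 1
  ext n
  rcases eq_or_ne n 0 with rfl | hn
  · simp
  · rw [LSeries.term_of_ne_zero hn, Pi.mul_apply, DirichletCharacter.one_apply_natCast, cpow_neg]
    split_ifs
    · simp [div_eq_mul_inv]
    · simp

/-- `c^{ω(n)} = O(n^η)` for every `η > 0`: only the primes `p ≤ c^{1/η}` contribute more than
`p^η`. -/
theorem exists_pow_card_primeFactors_le {c η : ℝ} (hc : 1 ≤ c) (hη : 0 < η) :
    ∃ K : ℝ, 1 ≤ K ∧ ∀ n : ℕ, n ≠ 0 → c ^ n.primeFactors.card ≤ K * (n : ℝ) ^ η := by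
  set P := ⌈c ^ (1 / η)⌉₊ with hP
  refine ⟨c ^ (P + 1), one_le_pow₀ hc, fun n hn => ?_⟩
  have hc0 : 0 ≤ c := by linarith
  have h1 : c ^ n.primeFactors.card ≤
      ∏ p ∈ n.primeFactors, ((if p ≤ P then c else 1) * (p : ℝ) ^ η) := by
    rw [← Finset.prod_const]
    refine Finset.prod_le_prod (fun _ _ => hc0) fun p hp => ?_
    have hp1 : (1 : ℝ) ≤ p := by exact_mod_cast (Nat.prime_of_mem_primeFactors hp).one_le
    split_ifs with h
    · exact le_mul_of_one_le_right hc0 (Real.one_le_rpow hp1 hη.le)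
    · have h2 : c ^ (1 / η) ≤ p := (Nat.le_ceil _).trans (by exact_mod_cast (not_le.1 h).le)
      have := Real.rpow_le_rpow (by positivity) h2 hη.le
      rw [← Real.rpow_mul hc0, one_div_mul_cancel hη.ne', Real.rpow_one] at this
      linarith
  have h2 : ∏ p ∈ n.primeFactors, (if p ≤ P then c else 1) ≤ c ^ (P + 1) := by
    rw [← Finset.prod_filter, Finset.prod_const]
    refine pow_le_pow_right₀ hc ?_
    refine (Finset.card_le_card (t := Finset.range (P + 1)) fun p hp => ?_).trans
      (Finset.card_range _).le
    exact Finset.mem_range.2 (Nat.lt_succ_of_le (Finset.mem_filter.1 hp).2)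
  have h3 : ∏ p ∈ n.primeFactors, (p : ℝ) ^ η ≤ (n : ℝ) ^ η := by
    rw [Real.finsetProd_rpow _ _ fun _ _ => Nat.cast_nonneg _, ← Nat.cast_prod]
    refine Real.rpow_le_rpow (by positivity) ?_ hη.le
    exact_mod_cast Nat.le_of_dvd (Nat.pos_of_ne_zero hn) (Nat.prod_primeFactors_dvd n)
  rw [Finset.prod_mul_distrib] at h1
  refine h1.trans ?_
  gcongr

theorem norm_prime_cpow_neg_le {p : ℕ} (hp : p.Prime) {u : ℂ} (hu : 1 / 2 ≤ u.re) :
    ‖(p : ℂ) ^ (-u)‖ ≤ 3 / 4 := by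
  have hp2 : (2 : ℝ) ≤ p := by exact_mod_cast hp.two_le
  rw [norm_natCast_cpow_of_pos hp.pos, neg_re]
  have h1 : (p : ℝ) ^ (-u.re) ≤ (p : ℝ) ^ (-(1 / 2) : ℝ) :=
    Real.rpow_le_rpow_of_exponent_le (by linarith) (by linarith)
  refine h1.trans ?_
  rw [Real.rpow_neg (by linarith), ← Real.sqrt_eq_rpow]
  have h2 : (4 / 3 : ℝ) ≤ √p := by
    apply Real.le_sqrt_of_sq_le; norm_num; linarith
  have := inv_anti₀ (by norm_num) h2
  norm_num at this ⊢
  exact this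

theorem norm_inv_one_sub_prime_cpow_le {p : ℕ} (hp : p.Prime) {u : ℂ} (hu : 1 / 2 ≤ u.re) :
    ‖(1 - (p : ℂ) ^ (-u))⁻¹‖ ≤ 4 := by
  have h := norm_prime_cpow_neg_le hp hu
  have h2 := norm_sub_norm_le (1 : ℂ) ((p : ℂ) ^ (-u))
  rw [norm_one] at h2
  rw [norm_inv]
  refine inv_le_of_inv_le₀ (by norm_num) ?_
  norm_num
  linarith

theorem one_sub_prime_cpow_ne_zero_of_half_le {p : ℕ} (hp : p.Prime) {u : ℂ}
    (hu : 1 / 2 ≤ u.re) : 1 - (p : ℂ) ^ (-u) ≠ 0 := by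
  intro h0
  have h := norm_prime_cpow_neg_le hp hu
  rw [← sub_eq_zero.1 h0] at h
  norm_num at h

/-- The summand of the arithmetic factor of the ratio after the sum over one variable has been
carried out. -/
noncomputable def arithTerm (r : ℕ) (u v t : ℂ) (k : ℕ × ℕ) : ℂ :=
  if k.1.Coprime r ∧ k.2.Coprime r then
    (ArithmeticFunction.moebius (k.1 * k.2) : ℂ) * (ArithmeticFunction.moebius k.2 : ℂ) *
      ((k.1 : ℂ) ^ (-v) * (k.2 : ℂ) ^ (-t)) *
        ∏ p ∈ (k.1 * k.2).primeFactors, (1 - (p : ℂ) ^ (-u))⁻¹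
  else 0

theorem norm_moebius_le (n : ℕ) : ‖(ArithmeticFunction.moebius n : ℂ)‖ ≤ 1 := by
  rw [Complex.norm_intCast]
  exact_mod_cast ArithmeticFunction.abs_moebius_le_one

/-- A summable majorant for `arithTerm`, uniform in the half-planes. -/
theorem exists_norm_arithTerm_le {κ : ℝ} (hκ : 0 < κ) :
    ∃ g : ℕ × ℕ → ℝ, Summable g ∧ ∀ (r : ℕ) (u v t : ℂ), 1 / 2 ≤ u.re → 1 + κ ≤ v.re →
      1 + κ ≤ t.re → ∀ k, ‖arithTerm r u v t k‖ ≤ g k := by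
  obtain ⟨K, hK1, hK⟩ := exists_pow_card_primeFactors_le (c := 4) (η := κ / 2) (by norm_num)
    (by linarith)
  have hs : Summable fun n : ℕ => (n : ℝ) ^ (-(1 + κ / 2)) := by
    have := Real.summable_nat_rpow_inv.2 (show 1 < 1 + κ / 2 by linarith)
    refine this.congr fun n => (Real.rpow_neg n.cast_nonneg _).symm
  have hs2 := (hs.mul_of_nonneg hs (fun n => by positivity) fun n => by positivity).mul_left (K * K)
  refine ⟨_, hs2, fun r u v t hu hv ht k => ?_⟩
  obtain ⟨z, w⟩ := k
  have hnn : 0 ≤ K * K * ((z : ℝ) ^ (-(1 + κ / 2)) * (w : ℝ) ^ (-(1 + κ / 2))) := by positivity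
  rcases Nat.eq_zero_or_pos z with hz | hz
  · simpa [arithTerm, hz] using hnn
  rcases Nat.eq_zero_or_pos w with hw | hw
  · simpa [arithTerm, hw] using hnn
  by_cases hcop : z.Coprime r ∧ w.Coprime r
  · simp only [arithTerm, if_pos hcop, norm_mul]
    have hz1 : (1 : ℝ) ≤ z := by exact_mod_cast hz
    have hw1 : (1 : ℝ) ≤ w := by exact_mod_cast hw
    have hprod : ‖∏ p ∈ (z * w).primeFactors, (1 - (p : ℂ) ^ (-u))⁻¹‖ ≤
        (K * (z : ℝ) ^ (κ / 2)) * (K * (w : ℝ) ^ (κ / 2)) := by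
      rw [norm_prod]
      calc _ ≤ ∏ p ∈ (z * w).primeFactors, (4 : ℝ) :=
            Finset.prod_le_prod (fun _ _ => norm_nonneg _) fun p hp =>
              norm_inv_one_sub_prime_cpow_le (Nat.prime_of_mem_primeFactors hp) hu
        _ = 4 ^ (z * w).primeFactors.card := by rw [Finset.prod_const]
        _ ≤ 4 ^ (z.primeFactors.card + w.primeFactors.card) := by
            refine pow_le_pow_right₀ (by norm_num) ?_
            rw [Nat.primeFactors_mul hz.ne' hw.ne']
            exact Finset.card_union_le _ _
        _ = 4 ^ z.primeFactors.card * 4 ^ w.primeFactors.card := pow_add _ _ _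
        _ ≤ _ := by
            gcongr
            · exact hK z hz.ne'
            · exact hK w hw.ne'
    have hpow : ∀ {n : ℕ} {x : ℂ}, 0 < n → (1 : ℝ) ≤ n → 1 + κ ≤ x.re →
        ‖(n : ℂ) ^ (-x)‖ ≤ (n : ℝ) ^ (-(1 + κ)) := by
      intro n x hn hn1 hx
      rw [norm_natCast_cpow_of_pos hn, neg_re]
      exact Real.rpow_le_rpow_of_exponent_le hn1 (by linarith)
    have hcomb : ∀ {n : ℕ}, 0 < n → (n : ℝ) ^ (-(1 + κ)) * (n : ℝ) ^ (κ / 2) =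
        (n : ℝ) ^ (-(1 + κ / 2)) := by
      intro n hn
      rw [← Real.rpow_add (by exact_mod_cast hn)]
      ring_nf
    calc _ ≤ 1 * 1 * ((z : ℝ) ^ (-(1 + κ)) * (w : ℝ) ^ (-(1 + κ))) *
          ((K * (z : ℝ) ^ (κ / 2)) * (K * (w : ℝ) ^ (κ / 2))) := by
          gcongr
          · exact norm_moebius_le _
          · exact norm_moebius_le _
          · exact hpow hz hz1 hv
          · exact hpow hw hw1 ht
      _ = K * K * (((z : ℝ) ^ (-(1 + κ)) * (z : ℝ) ^ (κ / 2)) *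
          ((w : ℝ) ^ (-(1 + κ)) * (w : ℝ) ^ (κ / 2))) := by ring
      _ = _ := by rw [hcomb hz, hcomb hw]
  · simpa [arithTerm, hcop] using hnn

theorem summable_arithTerm {r : ℕ} {u v t : ℂ} (hu : 1 / 2 ≤ u.re) (hv : 1 < v.re)
    (ht : 1 < t.re) : Summable (arithTerm r u v t) := by
  obtain ⟨g, hg, h⟩ := exists_norm_arithTerm_le (κ := min (v.re - 1) (t.re - 1))
    (lt_min (by linarith) (by linarith))
  refine Summable.of_norm_bounded hg (h r u v t hu ?_ ?_)
  · linarith [min_le_left (v.re - 1) (t.re - 1)]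
  · linarith [min_le_right (v.re - 1) (t.re - 1)]

theorem exists_norm_tsum_arithTerm_le {κ : ℝ} (hκ : 0 < κ) :
    ∃ C : ℝ, 0 < C ∧ ∀ (r : ℕ) (u v t : ℂ), 1 / 2 ≤ u.re → 1 + κ ≤ v.re →
      1 + κ ≤ t.re → ‖∑' k, arithTerm r u v t k‖ ≤ C := by
  obtain ⟨g, hg, h⟩ := exists_norm_arithTerm_le hκ
  refine ⟨|∑' k, g k| + 1, by positivity, fun r u v t hu hv ht => ?_⟩
  have := tsum_of_norm_bounded hg.hasSum (h r u v t hu hv ht)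
  linarith [le_abs_self (∑' k, g k)]

theorem differentiable_natCast_cpow_neg {n : ℕ} (hn : n ≠ 0) :
    Differentiable ℂ fun s : ℂ => (n : ℂ) ^ (-s) := fun s =>
  ((hasDerivAt_neg s).const_cpow (Or.inl (by exact_mod_cast hn))).differentiableAt

theorem differentiableOn_prod_inv_one_sub_prime_cpow (n : ℕ) :
    DifferentiableOn ℂ (fun u : ℂ => ∏ p ∈ n.primeFactors, (1 - (p : ℂ) ^ (-u))⁻¹)
      {u | 1 / 2 < u.re} := by
  refine DifferentiableOn.fun_finsetProd fun p hp => ?_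
  have hp' := Nat.prime_of_mem_primeFactors hp
  refine DifferentiableOn.inv ?_ fun u hu => one_sub_prime_cpow_ne_zero_of_half_le hp' (le_of_lt hu)
  exact ((differentiable_natCast_cpow_neg hp'.ne_zero).const_sub 1).differentiableOn

theorem differentiableOn_tsum_arithTerm (r : ℕ) {v t : ℂ} (hv : 1 < v.re) (ht : 1 < t.re) :
    DifferentiableOn ℂ (fun u => ∑' k, arithTerm r u v t k) {u | 1 / 2 < u.re} := by
  obtain ⟨g, hg, h⟩ := exists_norm_arithTerm_le (κ := min (v.re - 1) (t.re - 1))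
    (lt_min (by linarith) (by linarith))
  refine differentiableOn_tsum_of_summable_norm hg (fun k => ?_) (Complex.isOpen_re_gt _)
    fun k u hu => h r u v t (le_of_lt hu) ?_ ?_ k
  · by_cases hk : k.1.Coprime r ∧ k.2.Coprime r
    · simp only [arithTerm, if_pos hk]
      exact (differentiableOn_prod_inv_one_sub_prime_cpow _).const_mul _
    · simp only [arithTerm, if_neg hk]
      exact differentiableOn_const _
  · linarith [min_le_left (v.re - 1) (t.re - 1)]
  · linarith [min_le_right (v.re - 1) (t.re - 1)]

theorem continuousAt_tsum_arithTerm (r : ℕ) {u v t : ℂ} (hu : 1 / 2 < u.re) (hv : 1 < v.re)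
    (ht : 1 < t.re) :
    ContinuousAt (fun q : ℂ × ℂ × ℂ => ∑' k, arithTerm r q.1 q.2.1 q.2.2 k) (u, v, t) := by
  set κ := min (v.re - 1) (t.re - 1) / 2 with hκ
  have hκ0 : 0 < κ := half_pos (lt_min (by linarith) (by linarith))
  have hv' : 1 + κ < v.re := by linarith [min_le_left (v.re - 1) (t.re - 1)]
  have ht' : 1 + κ < t.re := by linarith [min_le_right (v.re - 1) (t.re - 1)]
  obtain ⟨g, hg, h⟩ := exists_norm_arithTerm_le hκ0
  set U : Set (ℂ × ℂ × ℂ) := {q | 1 / 2 < q.1.re ∧ 1 + κ < q.2.1.re ∧ 1 + κ < q.2.2.re} with hU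
  have hUo : IsOpen U := by
    have c1 : Continuous fun q : ℂ × ℂ × ℂ => q.1.re := by fun_prop
    have c2 : Continuous fun q : ℂ × ℂ × ℂ => q.2.1.re := by fun_prop
    have c3 : Continuous fun q : ℂ × ℂ × ℂ => q.2.2.re := by fun_prop
    exact (isOpen_lt continuous_const c1).inter
      ((isOpen_lt continuous_const c2).inter (isOpen_lt continuous_const c3))
  have hc : ContinuousOn (fun q : ℂ × ℂ × ℂ => ∑' k, arithTerm r q.1 q.2.1 q.2.2 k) U := by
    refine continuousOn_tsum (fun k => ?_) hg fun k q hq =>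
      h r q.1 q.2.1 q.2.2 hq.1.le hq.2.1.le hq.2.2.le k
    by_cases hk : k.1.Coprime r ∧ k.2.Coprime r
    · simp only [arithTerm, if_pos hk]
      rcases eq_or_ne k.1 0 with h1 | h1
      · simpa [h1] using continuousOn_const
      rcases eq_or_ne k.2 0 with h2 | h2
      · simpa [h2] using continuousOn_const
      refine ContinuousOn.mul (continuous_const.mul (Continuous.mul ?_ ?_)).continuousOn ?_
      · exact (differentiable_natCast_cpow_neg h1).continuous.comp (by fun_prop)
      · exact (differentiable_natCast_cpow_neg h2).continuous.comp (by fun_prop)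
      · exact (differentiableOn_prod_inv_one_sub_prime_cpow _).continuousOn.comp
          continuous_fst.continuousOn fun q hq => hq.1
    · simp only [arithTerm, if_neg hk]
      exact continuousOn_const
  exact hc.continuousAt (hUo.mem_nhds ⟨hu, hv', ht'⟩)

/-- The arithmetic factor of the ratio, continued to `Re u > 1/2` with the help of the Riemann
hypothesis: for `Re u > 1` it is the sum of `tripleTerm`. -/
noncomputable def arithFactor (r : ℕ) (u v t : ℂ) : ℂ :=
  (1 - (r : ℂ) ^ (-u))⁻¹ * invZeta u * ∑' k, arithTerm r u v t k

/-- The coefficients left of the four-variable Dirichlet series when the common divisor of the first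
two variables has been summed out; `k = ((z, w), y)`. -/
noncomputable def tripleTerm (r : ℕ) (u v t : ℂ) (k : (ℕ × ℕ) × ℕ) : ℂ :=
  if (k.1.1.Coprime r ∧ k.1.2.Coprime r ∧ k.2.Coprime r) ∧ k.2.Coprime k.1.1 then
    (ArithmeticFunction.moebius (k.1.1 * k.1.2) : ℂ) *
      (ArithmeticFunction.moebius (k.2 * k.1.2) : ℂ) *
        ((k.2 : ℂ) ^ (-u) * (k.1.1 : ℂ) ^ (-v) * (k.1.2 : ℂ) ^ (-t))
  else 0

theorem summable_tripleTerm (r : ℕ) {u v t : ℂ} (hu : 1 < u.re) (hv : 1 < v.re) (ht : 1 < t.re) :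
    Summable (fun k => ‖tripleTerm r u v t k‖) := by
  have h1 := summable_norm_natCast_cpow_neg hu
  have h2 := summable_norm_natCast_cpow_neg hv
  have h3 := summable_norm_natCast_cpow_neg ht
  have h4 := (h2.mul_of_nonneg h3 (fun _ => norm_nonneg _)
    (fun _ => norm_nonneg _)).mul_of_nonneg h1 (fun _ => by positivity) (fun _ => norm_nonneg _)
  refine Summable.of_nonneg_of_le (fun _ => norm_nonneg _) (fun k => ?_) h4
  by_cases hk : (k.1.1.Coprime r ∧ k.1.2.Coprime r ∧ k.2.Coprime r) ∧ k.2.Coprime k.1.1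
  · rw [tripleTerm, if_pos hk, norm_mul, norm_mul, norm_mul, norm_mul]
    calc _ ≤ 1 * 1 * (‖(k.2 : ℂ) ^ (-u)‖ * ‖(k.1.1 : ℂ) ^ (-v)‖ * ‖(k.1.2 : ℂ) ^ (-t)‖) := by
          gcongr <;> exact norm_moebius_le _
      _ = _ := by ring
  · rw [tripleTerm, if_neg hk, norm_zero]
    positivity

theorem moebius_mul_eq (m n : ℕ) : ArithmeticFunction.moebius (m * n) =
    if m.Coprime n then ArithmeticFunction.moebius m * ArithmeticFunction.moebius n else 0 := by
  split_ifs with h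
  · exact ArithmeticFunction.isMultiplicative_moebius.map_mul_of_coprime h
  · refine ArithmeticFunction.moebius_eq_zero_of_not_squarefree fun hsq => h ?_
    exact Nat.coprime_of_squarefree_mul hsq

/-- Summing out the variable `y`. -/
theorem hasSum_tripleTerm {r : ℕ} (hr : r.Prime) {u v t : ℂ} (hu : 1 < u.re) (hv : 1 < v.re)
    (ht : 1 < t.re) : HasSum (tripleTerm r u v t) (arithFactor r u v t) := by
  have hS : Summable (tripleTerm r u v t) := (summable_tripleTerm r hu hv ht).of_norm
  have hfib : ∀ k : ℕ × ℕ, HasSum (fun y => tripleTerm r u v t (k, y))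
      ((1 - (r : ℂ) ^ (-u))⁻¹ * invZeta u * arithTerm r u v t k) := by
    rintro ⟨z, w⟩
    by_cases hcop : z.Coprime r ∧ w.Coprime r
    swap
    · have : ∀ y, tripleTerm r u v t ((z, w), y) = 0 := fun y => by
        rw [tripleTerm, if_neg]
        exact fun h => hcop ⟨h.1.1, h.1.2.1⟩
      simp only [this, arithTerm, if_neg hcop, mul_zero]
      exact hasSum_zero
    have hne : ∀ n : ℕ, n.Coprime r → n ≠ 0 := by
      rintro n hn rfl
      exact hr.one_lt.ne' (by simpa using hn)
    have hzw : z * w ≠ 0 := mul_ne_zero (hne z hcop.1) (hne w hcop.2)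
    have hM : r * (z * w) ≠ 0 := mul_ne_zero hr.ne_zero hzw
    have key := (hasSum_coprime_moebius hM hu).mul_left
      ((ArithmeticFunction.moebius (z * w) : ℂ) * (ArithmeticFunction.moebius w : ℂ) *
        ((z : ℂ) ^ (-v) * (w : ℂ) ^ (-t)))
    have hfun : (fun y => tripleTerm r u v t ((z, w), y)) = fun y : ℕ =>
        (ArithmeticFunction.moebius (z * w) : ℂ) * (ArithmeticFunction.moebius w : ℂ) *
          ((z : ℂ) ^ (-v) * (w : ℂ) ^ (-t)) * if y.Coprime (r * (z * w)) then
            (ArithmeticFunction.moebius y : ℂ) * (y : ℂ) ^ (-u) else 0 := by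
      funext y
      have hcy : y.Coprime (r * (z * w)) ↔ y.Coprime r ∧ y.Coprime z ∧ y.Coprime w := by
        rw [Nat.coprime_mul_iff_right, Nat.coprime_mul_iff_right]
      simp only [tripleTerm, moebius_mul_eq y w, hcy]
      by_cases hall : y.Coprime r ∧ y.Coprime z ∧ y.Coprime w
      · rw [if_pos hall, if_pos ⟨⟨hcop.1, hcop.2, hall.1⟩, hall.2.1⟩, if_pos hall.2.2]
        push_cast
        ring
      · rw [if_neg hall, mul_zero]
        split_ifs with ha hb
        · exact absurd ⟨ha.1.2.2, ha.2, hb⟩ hall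
        · simp
        · rfl
    have hdis : (r * (z * w)).primeFactors = insert r (z * w).primeFactors := by
      rw [Nat.primeFactors_mul hr.ne_zero hzw, hr.primeFactors]
      rfl
    have hnot : r ∉ (z * w).primeFactors := by
      intro h
      rcases hr.dvd_mul.1 (Nat.dvd_of_mem_primeFactors h) with h | h
      · exact (Nat.Prime.coprime_iff_not_dvd hr).1 hcop.1.symm h
      · exact (Nat.Prime.coprime_iff_not_dvd hr).1 hcop.2.symm h
    rw [hdis, Finset.prod_insert hnot] at key
    rw [hfun, arithTerm, if_pos hcop, Finset.prod_inv_distrib]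
    simp only
    rw [show ∀ a b c d : ℂ, a⁻¹ * b * (c * d⁻¹) = c * ((a * d)⁻¹ * b) by
      intro a b c d; rw [mul_inv]; ring]
    exact key
  have h1 := hS.hasSum.prod_fiberwise hfib
  have h2 := (summable_arithTerm (r := r) (u := u) (by linarith) hv ht).hasSum.mul_left
    ((1 - (r : ℂ) ^ (-u))⁻¹ * invZeta u)
  rw [arithFactor, h2.unique h1]
  exact hS.hasSum

/-- The symmetry of the arithmetic factor, visible in `tripleTerm` by exchanging `y` and `z`, but
hidden in the formula for `arithFactor`, where `y` has been summed out. -/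
theorem arithFactor_symm {r : ℕ} (hr : r.Prime) {u v t : ℂ} (hu : 1 < u.re) (hv : 1 < v.re)
    (ht : 1 < t.re) : arithFactor r u v t = arithFactor r v u t := by
  have h1 := hasSum_tripleTerm hr hu hv ht
  have h2 := hasSum_tripleTerm hr hv hu ht
  set e : (ℕ × ℕ) × ℕ ≃ (ℕ × ℕ) × ℕ :=
    { toFun := fun k => ((k.2, k.1.2), k.1.1)
      invFun := fun k => ((k.2, k.1.2), k.1.1)
      left_inv := fun _ => rfl
      right_inv := fun _ => rfl } with he
  have h3 := (e.hasSum_iff).2 h2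
  refine h1.unique ?_
  convert h3 using 1
  ext ⟨⟨z, w⟩, y⟩
  simp only [Function.comp, he, Equiv.coe_fn_mk, tripleTerm]
  by_cases h : (z.Coprime r ∧ w.Coprime r ∧ y.Coprime r) ∧ y.Coprime z
  · rw [if_pos h, if_pos ⟨⟨h.1.2.2, h.1.2.1, h.1.1⟩, h.2.symm⟩]
    ring
  · rw [if_neg h, if_neg fun h' => h ⟨⟨h'.1.2.2, h'.1.2.1, h'.1.1⟩, h'.2.symm⟩]

/-- `ζ` without its Euler factor at `r`. -/
noncomputable def zetaAway (r : ℕ) (s : ℂ) : ℂ := (1 - (r : ℂ) ^ (-s)) * riemannZeta s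

theorem hasSum_zetaAway {r : ℕ} (hr : r.Prime) {s : ℂ} (hs : 1 < s.re) :
    HasSum (fun n : ℕ => if n.Coprime r then (n : ℂ) ^ (-s) else 0) (zetaAway r s) := by
  have := hasSum_coprime hr.ne_zero hs
  rwa [hr.primeFactors, Finset.prod_singleton] at this

theorem Nat.Coprime.ne_zero_of_prime {r n : ℕ} (hr : r.Prime) (hn : n.Coprime r) : n ≠ 0 := by
  rintro rfl
  exact hr.one_lt.ne' (by simpa using hn)

/-- The term of the four-variable series at `a = xy`, `b = xz`, `c = zw`, `d = yw`. -/
theorem steinhausRatioTerm_param {r : ℕ} (hr : r.Prime) {z₁ z₂ s₁ s₂ : ℂ} {x y z w : ℕ}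
    (hx : x.Coprime r) (hz : z.Coprime r) (hw : w.Coprime r) (hy : y.Coprime r)
    (hyz : y.Coprime z) :
    steinhausRatioTerm r z₁ z₂ s₁ s₂ (x * y, x * z, z * w, y * w) =
      (if x.Coprime r then (x : ℂ) ^ (-(z₁ + z₂)) else 0) *
        tripleTerm r (z₁ + s₂) (z₂ + s₁) (s₁ + s₂) ((z, w), y) := by
  have hxC : (x : ℂ) ≠ 0 := by exact_mod_cast hx.ne_zero_of_prime hr
  have hyC : (y : ℂ) ≠ 0 := by exact_mod_cast hy.ne_zero_of_prime hr
  have hzC : (z : ℂ) ≠ 0 := by exact_mod_cast hz.ne_zero_of_prime hr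
  have hwC : (w : ℂ) ≠ 0 := by exact_mod_cast hw.ne_zero_of_prime hr
  have hcop : ((x * y).Coprime r ∧ (x * z).Coprime r ∧ (z * w).Coprime r ∧ (y * w).Coprime r) ∧
      x * y * (z * w) = x * z * (y * w) :=
    ⟨⟨hx.mul_left hy, hx.mul_left hz, hz.mul_left hw, hy.mul_left hw⟩, by ring⟩
  rw [steinhausRatioTerm, steinhausE_ratio hr.one_lt.ne', if_pos hcop, if_pos hx, tripleTerm,
    if_pos ⟨⟨hz, hw, hy⟩, hyz⟩]
  push_cast
  rw [natCast_mul_natCast_cpow, natCast_mul_natCast_cpow, natCast_mul_natCast_cpow,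
    natCast_mul_natCast_cpow]
  simp only [cpow_neg, cpow_add _ _ hxC, cpow_add _ _ hyC, cpow_add _ _ hzC, cpow_add _ _ hwC]
  rw [div_eq_mul_inv]
  simp only [mul_inv]
  ring

theorem param_injective {x y z w x' y' z' w' : ℕ} (hx : x ≠ 0) (hz : z ≠ 0) (hyz : y.Coprime z)
    (hyz' : y'.Coprime z') (e1 : x * y = x' * y') (e2 : x * z = x' * z')
    (e3 : z * w = z' * w') : x = x' ∧ y = y' ∧ z = z' ∧ w = w' := by
  have hxx : x = x' := by
    have := congrArg₂ Nat.gcd e1 e2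
    rwa [Nat.gcd_mul_left, Nat.gcd_mul_left, hyz, hyz', mul_one, mul_one] at this
  subst hxx
  have hx0 := Nat.pos_of_ne_zero hx
  have hyy := Nat.eq_of_mul_eq_mul_left hx0 e1
  have hzz := Nat.eq_of_mul_eq_mul_left hx0 e2
  subst hyy hzz
  exact ⟨rfl, rfl, rfl, Nat.eq_of_mul_eq_mul_left (Nat.pos_of_ne_zero hz) e3⟩

theorem exists_param {a b c d : ℕ} (ha : a ≠ 0) (hb : b ≠ 0) (h : a * c = b * d) :
    ∃ x y z w : ℕ, y.Coprime z ∧ a = x * y ∧ b = x * z ∧ c = z * w ∧ d = y * w := by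
  obtain ⟨x, y, z, hx0, hyz, hax, hbx⟩ := Nat.exists_coprime' (m := a) (n := b)
    (Nat.gcd_pos_of_pos_left b (Nat.pos_of_ne_zero ha))
  have hycz : y * c = z * d := by
    refine Nat.eq_of_mul_eq_mul_left hx0 ?_
    rw [hax, hbx] at h
    linarith
  obtain ⟨w, hw⟩ : z ∣ c := (hyz.symm).dvd_of_dvd_mul_left (Dvd.intro _ hycz.symm)
  have hz0 : 0 < z := by
    rcases Nat.eq_zero_or_pos z with h | h
    · exact absurd (by rw [hbx, h, zero_mul]) hb
    · exact h
  refine ⟨x, y, z, w, hyz, by rw [hax, mul_comm], by rw [hbx, mul_comm], hw, ?_⟩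
  refine Nat.eq_of_mul_eq_mul_left hz0 ?_
  rw [← hycz, hw]; ring

/-- Closed form of the four-variable Dirichlet series. The Steinhaus average forces `ac = bd`, and
such quadruples are parametrised by `a = xy`, `b = xz`, `c = zw`, `d = yw` with `(y, z) = 1`. -/
theorem hasSum_steinhausRatioTerm {r : ℕ} (hr : r.Prime) {z₁ z₂ s₁ s₂ : ℂ}
    (h1 : 1 < (z₁ + z₂).re) (h2 : 1 < (z₁ + s₂).re) (h3 : 1 < (z₂ + s₁).re)
    (h4 : 1 < (s₁ + s₂).re) :
    HasSum (steinhausRatioTerm r z₁ z₂ s₁ s₂)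
      (zetaAway r (z₁ + z₂) * arithFactor r (z₁ + s₂) (z₂ + s₁) (s₁ + s₂)) := by
  have hX := hasSum_zetaAway hr h1
  have hY := hasSum_tripleTerm hr h2 h3 h4
  have hXn : Summable fun n : ℕ => ‖if n.Coprime r then (n : ℂ) ^ (-(z₁ + z₂)) else 0‖ := by
    refine Summable.of_nonneg_of_le (fun _ => norm_nonneg _) (fun n => ?_)
      (summable_norm_natCast_cpow_neg h1)
    split_ifs <;> simp
  set g : ℕ × ((ℕ × ℕ) × ℕ) → ℂ := fun q =>
    (if q.1.Coprime r then (q.1 : ℂ) ^ (-(z₁ + z₂)) else 0) *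
      tripleTerm r (z₁ + s₂) (z₂ + s₁) (s₁ + s₂) q.2 with hg
  have hgs : Summable g := summable_mul_of_summable_norm
    (f := fun n : ℕ => if n.Coprime r then (n : ℂ) ^ (-(z₁ + z₂)) else 0)
    (g := tripleTerm r (z₁ + s₂) (z₂ + s₁) (s₁ + s₂)) hXn (summable_tripleTerm r h2 h3 h4)
  have hXY : HasSum g (zetaAway r (z₁ + z₂) * arithFactor r (z₁ + s₂) (z₂ + s₁) (s₁ + s₂)) :=
    HasSum.mul (f := fun n : ℕ => if n.Coprime r then (n : ℂ) ^ (-(z₁ + z₂)) else 0)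
      (g := tripleTerm r (z₁ + s₂) (z₂ + s₁) (s₁ + s₂)) hX hY hgs
  have hsupp : ∀ q, g q ≠ 0 → q.1.Coprime r ∧ (q.2.1.1.Coprime r ∧ q.2.1.2.Coprime r ∧
      q.2.2.Coprime r) ∧ q.2.2.Coprime q.2.1.1 := by
    intro q hq
    constructor
    · by_contra h
      exact hq (by simp [hg, h])
    · by_contra h
      exact hq (by simp only [hg, tripleTerm]; rw [if_neg h, mul_zero])
  refine (hasSum_iff_hasSum_of_ne_zero_bij (g := g)
    (fun q : Function.support g => (q.1.1 * q.1.2.2, q.1.1 * q.1.2.1.1, q.1.2.1.1 * q.1.2.1.2,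
      q.1.2.2 * q.1.2.1.2)) ?_ ?_ ?_).2 hXY
  · rintro ⟨⟨x, ⟨z, w⟩, y⟩, hq⟩ ⟨⟨x', ⟨z', w'⟩, y'⟩, hq'⟩ heq
    obtain ⟨hx, ⟨hz, hw, hy⟩, hyz⟩ := hsupp _ hq
    obtain ⟨hx', ⟨hz', hw', hy'⟩, hyz'⟩ := hsupp _ hq'
    have e1 : x * y = x' * y' := congrArg (fun k => k.1) heq
    have e2 : x * z = x' * z' := congrArg (fun k => k.2.1) heq
    have e3 : z * w = z' * w' := congrArg (fun k => k.2.2.1) heq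
    obtain ⟨rfl, rfl, rfl, rfl⟩ := param_injective (hx.ne_zero_of_prime hr)
      (hz.ne_zero_of_prime hr) hyz hyz' e1 e2 e3
    rfl
  · rintro ⟨a, b, c, d⟩ hk
    rw [Function.mem_support] at hk
    have hcond : (a.Coprime r ∧ b.Coprime r ∧ c.Coprime r ∧ d.Coprime r) ∧ a * c = b * d := by
      by_contra hcond
      refine hk ?_
      rw [steinhausRatioTerm, steinhausE_ratio hr.one_lt.ne']
      simp only
      rw [if_neg hcond, zero_div]
    obtain ⟨⟨ha, hb, hc, hd⟩, hacbd⟩ := hcond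
    obtain ⟨x, y, z, w, hyz, rfl, rfl, rfl, rfl⟩ := exists_param (ha.ne_zero_of_prime hr)
      (hb.ne_zero_of_prime hr) hacbd
    have hv := steinhausRatioTerm_param hr (z₁ := z₁) (z₂ := z₂) (s₁ := s₁) (s₂ := s₂)
      (ha.coprime_mul_right) (hb.coprime_mul_left) (hc.coprime_mul_left) (ha.coprime_mul_left) hyz
    refine ⟨⟨(x, (z, w), y), ?_⟩, rfl⟩
    rw [hv] at hk
    exact hk
  · rintro ⟨⟨x, ⟨z, w⟩, y⟩, hq⟩
    obtain ⟨hx, ⟨hz, hw, hy⟩, hyz⟩ := hsupp _ hq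
    exact steinhausRatioTerm_param hr hx hz hw hy hyz

/-! ### The Steinhaus average on the critical lines -/

theorem norm_one_sub_prime_cpow_le {r : ℕ} (hr : r.Prime) {s : ℂ} (hs : 0 ≤ s.re) :
    ‖1 - (r : ℂ) ^ (-s)‖ ≤ 2 := by
  refine (norm_sub_le _ _).trans ?_
  have h1 : (1 : ℝ) ≤ r := by exact_mod_cast hr.one_le
  have : ‖(r : ℂ) ^ (-s)‖ ≤ 1 := by
    rw [norm_natCast_cpow_of_pos hr.pos, neg_re]
    exact Real.rpow_le_one_of_one_le_of_nonpos h1 (by linarith)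
  rw [norm_one]; linarith

theorem norm_zetaAway_le {r : ℕ} (hr : r.Prime) {s : ℂ} (hs : 1 / 2 ≤ s.re) (hs1 : s ≠ 1) :
    ‖zetaAway r s‖ ≤ 2 * (‖s‖ * (1 / ‖s - 1‖ + 2)) := by
  rw [zetaAway, norm_mul]
  gcongr
  · exact norm_one_sub_prime_cpow_le hr (by linarith)
  · exact norm_riemannZeta_le hs hs1

/-- `(s - 1) ζ(s)` without its Euler factor at `r`. -/
noncomputable def zetaAway₁ (r : ℕ) (s : ℂ) : ℂ := (1 - (r : ℂ) ^ (-s)) * riemannZeta₁ s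

theorem differentiable_zetaAway₁ {r : ℕ} (hr : r.Prime) : Differentiable ℂ (zetaAway₁ r) :=
  ((differentiable_natCast_cpow_neg hr.ne_zero).const_sub 1).mul differentiable_riemannZeta₁

theorem zetaAway₁_eq (r : ℕ) {s : ℂ} (hs : s ≠ 1) : zetaAway₁ r s = (s - 1) * zetaAway r s := by
  rw [zetaAway₁, zetaAway, riemannZeta₁_eq_mul hs]
  ring

theorem continuousAt_zetaAway {r : ℕ} (hr : r.Prime) {s : ℂ} (hs : s ≠ 1) :
    ContinuousAt (zetaAway r) s :=
  (((differentiable_natCast_cpow_neg hr.ne_zero).const_sub 1).continuous.continuousAt).mul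
    (differentiableAt_riemannZeta hs).continuousAt

section arithFactor

variable {r : ℕ}

theorem differentiableOn_arithFactor (hr : r.Prime) (hζ : ZetaNeZeroRightHalf) {v t : ℂ}
    (hv : 1 < v.re) (ht : 1 < t.re) :
    DifferentiableOn ℂ (fun u => arithFactor r u v t) {u | 1 / 2 < u.re} := by
  refine DifferentiableOn.mul (DifferentiableOn.mul ?_ hζ.differentiableOn_invZeta)
    (differentiableOn_tsum_arithTerm r hv ht)
  refine DifferentiableOn.inv
    ((differentiable_natCast_cpow_neg hr.ne_zero).const_sub 1).differentiableOn
    fun u hu => one_sub_prime_cpow_ne_zero_of_half_le hr (le_of_lt hu)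

theorem continuousAt_arithFactor (hr : r.Prime) (hζ : ZetaNeZeroRightHalf) {u v t : ℂ}
    (hu : 1 / 2 < u.re) (hv : 1 < v.re) (ht : 1 < t.re) :
    ContinuousAt (fun q : ℂ × ℂ × ℂ => arithFactor r q.1 q.2.1 q.2.2) (u, v, t) := by
  refine ContinuousAt.mul (ContinuousAt.mul ?_ ?_) (continuousAt_tsum_arithTerm r hu hv ht)
  · refine ContinuousAt.inv₀ ?_ (one_sub_prime_cpow_ne_zero_of_half_le hr hu.le)
    exact (((differentiable_natCast_cpow_neg hr.ne_zero).const_sub 1).continuous.comp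
      continuous_fst).continuousAt
  · have h1 : ContinuousAt invZeta u :=
      (hζ.differentiableOn_invZeta.differentiableAt
        ((Complex.isOpen_re_gt _).mem_nhds hu)).continuousAt
    exact ContinuousAt.comp (f := fun q : ℂ × ℂ × ℂ => q.1) (x := (u, v, t)) h1
      continuousAt_fst

/-- The arithmetic factor is smaller than any power of `|Im u|`, uniformly in `r`. -/
theorem exists_norm_arithFactor_le (hζ : ZetaNeZeroRightHalf) {κ ε : ℝ} (hκ : 0 < κ)
    (hε : 0 < ε) : ∃ C : ℝ, 0 < C ∧ ∀ (r : ℕ), r.Prime → ∀ u v t : ℂ, 3 / 4 ≤ u.re →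
      1 + κ ≤ v.re → 1 + κ ≤ t.re → ‖arithFactor r u v t‖ ≤ C * (1 + |u.im|) ^ ε := by
  obtain ⟨C₁, h1, hC₁⟩ := hζ.exists_norm_invZeta_le hε
  obtain ⟨C₂, h2, hC₂⟩ := exists_norm_tsum_arithTerm_le hκ
  refine ⟨4 * C₁ * C₂, by positivity, fun r hr u v t hu hv ht => ?_⟩
  rw [arithFactor, norm_mul, norm_mul]
  calc _ ≤ 4 * (C₁ * (1 + |u.im|) ^ ε) * C₂ := by
        gcongr
        · exact norm_inv_one_sub_prime_cpow_le hr (by linarith)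
        · exact hC₁ u hu
        · exact hC₂ r u v t (by linarith) hv ht
    _ = _ := by ring

end arithFactor

/-- The closed form of the Steinhaus average on the critical lines: the value extended from the
region of absolute convergence. -/
theorem steinhausRatio_eq {r : ℕ} (hr : r.Prime) (hζ : ZetaNeZeroRightHalf) {z₁ z₂ s₁ s₂ : ℂ}
    (h1 : z₁.re = 1 / 2) (h2 : z₂.re = 1 / 2) (h12 : z₁ + z₂ ≠ 1) (h3 : 1 / 2 < s₁.re)
    (h4 : 1 / 2 < s₂.re) :
    steinhausRatio r z₁ z₂ s₁ s₂ =
      zetaAway r (z₁ + z₂) * arithFactor r (z₁ + s₂) (z₂ + s₁) (s₁ + s₂) := by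
  set S : Set (ℂ × ℂ × ℂ × ℂ) := {p | 1 / 2 < p.1.re ∧ 1 / 2 < p.2.1.re ∧ 1 / 2 < p.2.2.1.re ∧
      1 / 2 < p.2.2.2.re} with hS
  set P : ℂ × ℂ × ℂ × ℂ → ℂ := fun p => zetaAway r (p.1 + p.2.1) *
    arithFactor r (p.1 + p.2.2.2) (p.2.1 + p.2.2.1) (p.2.2.1 + p.2.2.2) with hP
  have hcl : (z₁, z₂, s₁, s₂) ∈ closure S := by
    have ht : Tendsto (fun x : ℝ => ((z₁ + x, z₂ + x, s₁, s₂) : ℂ × ℂ × ℂ × ℂ)) (𝓝[>] 0)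
        (𝓝 (z₁, z₂, s₁, s₂)) := by
      have : Continuous fun x : ℝ => ((z₁ + x, z₂ + x, s₁, s₂) : ℂ × ℂ × ℂ × ℂ) := by fun_prop
      have h0 := this.tendsto 0
      simp only [ofReal_zero, add_zero] at h0
      exact h0.mono_left nhdsWithin_le_nhds
    refine mem_closure_of_tendsto ht ?_
    filter_upwards [self_mem_nhdsWithin] with x hx
    have hx : 0 < x := hx
    refine ⟨?_, ?_, h3, h4⟩
    · simp only [add_re, ofReal_re]; linarith
    · simp only [add_re, ofReal_re]; linarith
  have hPc : ContinuousAt P (z₁, z₂, s₁, s₂) := by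
    have hz : ContinuousAt (fun p : ℂ × ℂ × ℂ × ℂ => zetaAway r (p.1 + p.2.1))
        (z₁, z₂, s₁, s₂) :=
      ContinuousAt.comp (f := fun p : ℂ × ℂ × ℂ × ℂ => p.1 + p.2.1)
        (continuousAt_zetaAway hr h12) (by fun_prop)
    have ha := continuousAt_arithFactor hr hζ (u := z₁ + s₂) (v := z₂ + s₁) (t := s₁ + s₂)
      (by rw [add_re]; linarith) (by rw [add_re]; linarith) (by rw [add_re]; linarith)
    have ha' : ContinuousAt (fun p : ℂ × ℂ × ℂ × ℂ =>
        arithFactor r (p.1 + p.2.2.2) (p.2.1 + p.2.2.1) (p.2.2.1 + p.2.2.2)) (z₁, z₂, s₁, s₂) :=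
      ContinuousAt.comp (g := fun q : ℂ × ℂ × ℂ => arithFactor r q.1 q.2.1 q.2.2)
        (f := fun p : ℂ × ℂ × ℂ × ℂ => (p.1 + p.2.2.2, p.2.1 + p.2.2.1, p.2.2.1 + p.2.2.2))
        (x := (z₁, z₂, s₁, s₂)) ha (by fun_prop)
    exact hz.mul ha'
  rw [steinhausRatio]
  refine extendFrom_eq hcl ?_
  refine (hPc.mono_left nhdsWithin_le_nhds).congr' ?_
  filter_upwards [self_mem_nhdsWithin] with p hp
  obtain ⟨p1, p2, p3, p4⟩ := hp
  refine ((hasSum_steinhausRatioTerm hr ?_ ?_ ?_ ?_).tsum_eq).symm <;>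
  · rw [add_re]; linarith

/-- The kernels extract the twisted Steinhaus average from the four-variable series. -/
theorem integral_integral_coeffKernel_mul_ratio {r : ℕ} (hr : r.Prime) {m₁ m₂ : ℕ} (hm₁ : 1 ≤ m₁)
    (hm₂ : 1 ≤ m₂) {s₁ s₂ : ℂ} (h3 : 1 / 2 < s₁.re) (h4 : 1 / 2 < s₂.re) :
    Summable (steinhausTwistedTerm r m₁ m₂ s₁ s₂) ∧
    (∀ t₁ : ℝ, Integrable fun t₂ : ℝ => coeffKernel m₂ ((3 / 4 : ℝ) + t₂ * I) *
      (zetaAway r (((1 / 2 : ℝ) + t₁ * I) + ((3 / 4 : ℝ) + t₂ * I)) *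
        arithFactor r (((1 / 2 : ℝ) + t₁ * I) + s₂) (((3 / 4 : ℝ) + t₂ * I) + s₁) (s₁ + s₂))) ∧
    (Integrable fun t₁ : ℝ => coeffKernel m₁ ((1 / 2 : ℝ) + t₁ * I) *
        ∫ t₂ : ℝ, coeffKernel m₂ ((3 / 4 : ℝ) + t₂ * I) *
          (zetaAway r (((1 / 2 : ℝ) + t₁ * I) + ((3 / 4 : ℝ) + t₂ * I)) *
            arithFactor r (((1 / 2 : ℝ) + t₁ * I) + s₂) (((3 / 4 : ℝ) + t₂ * I) + s₁)
              (s₁ + s₂))) ∧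
    ∫ t₁ : ℝ, coeffKernel m₁ ((1 / 2 : ℝ) + t₁ * I) *
        ∫ t₂ : ℝ, coeffKernel m₂ ((3 / 4 : ℝ) + t₂ * I) *
          (zetaAway r (((1 / 2 : ℝ) + t₁ * I) + ((3 / 4 : ℝ) + t₂ * I)) *
            arithFactor r (((1 / 2 : ℝ) + t₁ * I) + s₂) (((3 / 4 : ℝ) + t₂ * I) + s₁) (s₁ + s₂)) =
      ∑' k, steinhausTwistedTerm r m₁ m₂ s₁ s₂ k := by
  set c : ℕ × ℕ × ℕ × ℕ → ℂ := fun k => steinhausE (fun θ => fStar r θ k.1 *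
      starRingEnd ℂ (fStar r θ k.2.1) * muStar r θ k.2.2.1 *
        starRingEnd ℂ (muStar r θ k.2.2.2)) / ((k.2.2.1 : ℂ) ^ s₁ * (k.2.2.2 : ℂ) ^ s₂) with hc
  have hterm : ∀ (z₁ z₂ : ℂ) k, steinhausRatioTerm r z₁ z₂ s₁ s₂ k =
      c k * (k.1 : ℂ) ^ (-z₁) * (k.2.1 : ℂ) ^ (-z₂) := by
    intro z₁ z₂ k
    rw [steinhausRatioTerm, hc]
    simp only [cpow_neg, div_eq_mul_inv, mul_inv]
    ring
  have hc1 : ∀ k, k.1 = 0 → c k = 0 := by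
    intro k hk
    have : ¬ (0 : ℕ).Coprime r := by simpa using hr.one_lt.ne'
    simp only [hc, steinhausE_ratio hr.one_lt.ne', hk]
    rw [if_neg fun h => this h.1.1, zero_div]
  have hc2 : ∀ k, k.2.1 = 0 → c k = 0 := by
    intro k hk
    have : ¬ (0 : ℕ).Coprime r := by simpa using hr.one_lt.ne'
    simp only [hc, steinhausE_ratio hr.one_lt.ne', hk]
    rw [if_neg fun h => this h.1.2.1, zero_div]
  have hsum : ∀ t₁ t₂ : ℝ, HasSum (steinhausRatioTerm r ((1 / 2 : ℝ) + t₁ * I)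
      ((3 / 4 : ℝ) + t₂ * I) s₁ s₂) (zetaAway r (((1 / 2 : ℝ) + t₁ * I) + ((3 / 4 : ℝ) + t₂ * I)) *
        arithFactor r (((1 / 2 : ℝ) + t₁ * I) + s₂) (((3 / 4 : ℝ) + t₂ * I) + s₁) (s₁ + s₂)) := by
    intro t₁ t₂
    refine hasSum_steinhausRatioTerm hr ?_ ?_ ?_ ?_ <;>
      simp only [add_re, ofReal_re, mul_re, I_re, mul_zero, ofReal_im, I_im, mul_one, sub_self,
        add_zero] <;> linarith
  have h00 : Summable fun k => c k * (k.1 : ℂ) ^ (-((1 / 2 : ℝ) : ℂ)) *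
      (k.2.1 : ℂ) ^ (-((3 / 4 : ℝ) : ℂ)) := by
    have := (hsum 0 0).summable
    simp only [ofReal_zero, zero_mul, add_zero] at this
    exact this.congr fun k => hterm _ _ k
  have htw : ∀ q : ℕ × ℕ, steinhausTwistedTerm r m₁ m₂ s₁ s₂ q = c (m₁, m₂, q) := fun q => rfl
  have hinj : Function.Injective fun q : ℕ × ℕ => ((m₁, m₂, q) : ℕ × ℕ × ℕ × ℕ) := by
    intro q q' h
    exact congrArg (fun k => k.2.2) h
  have hm₁C : (m₁ : ℂ) ≠ 0 := by exact_mod_cast (by lia : m₁ ≠ 0)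
  have hm₂C : (m₂ : ℂ) ≠ 0 := by exact_mod_cast (by lia : m₂ ≠ 0)
  refine ⟨?_, ?_⟩
  · have h5 := (h00.comp_injective hinj).mul_right
      ((m₁ : ℂ) ^ ((1 / 2 : ℝ) : ℂ) * (m₂ : ℂ) ^ ((3 / 4 : ℝ) : ℂ))
    refine h5.congr fun q => ?_
    rw [htw]
    simp only [Function.comp]
    rw [cpow_neg, cpow_neg]
    have e1 : (m₁ : ℂ) ^ ((1 / 2 : ℝ) : ℂ) ≠ 0 := by simp [cpow_eq_zero_iff, hm₁C]
    have e2 : (m₂ : ℂ) ^ ((3 / 4 : ℝ) : ℂ) ≠ 0 := by simp [cpow_eq_zero_iff, hm₂C]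
    field_simp
  have hs1 : ∀ t₁ : ℝ, Summable fun k : ℕ × ℕ × ℕ × ℕ =>
      c k * (k.1 : ℂ) ^ (-((1 / 2 : ℝ) + t₁ * I : ℂ)) * (k.2.1 : ℂ) ^ (-((3 / 4 : ℝ) : ℂ)) := by
    intro t₁
    refine Summable.of_norm (h00.norm.congr fun k => ?_)
    rw [norm_mul, norm_mul (c k * (k.1 : ℂ) ^ (-((1 / 2 : ℝ) + t₁ * I : ℂ))),
      norm_mul_natCast_cpow_vertical (hc1 k)]
  have hk1 : ∀ (t₁ : ℝ) (k : ℕ × ℕ × ℕ × ℕ), k.2.1 = 0 →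
      c k * (k.1 : ℂ) ^ (-((1 / 2 : ℝ) + t₁ * I : ℂ)) = 0 :=
    fun t₁ k hk => by simp [hc2 k hk]
  have hfun : ∀ t₁ : ℝ, (fun t₂ : ℝ => coeffKernel m₂ ((3 / 4 : ℝ) + t₂ * I) *
          (zetaAway r (((1 / 2 : ℝ) + t₁ * I) + ((3 / 4 : ℝ) + t₂ * I)) *
            arithFactor r (((1 / 2 : ℝ) + t₁ * I) + s₂) (((3 / 4 : ℝ) + t₂ * I) + s₁) (s₁ + s₂))) =
      fun t₂ : ℝ => coeffKernel m₂ ((3 / 4 : ℝ) + t₂ * I) *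
        ∑' k : ℕ × ℕ × ℕ × ℕ, c k * (k.1 : ℂ) ^ (-((1 / 2 : ℝ) + t₁ * I : ℂ)) *
          (k.2.1 : ℂ) ^ (-((3 / 4 : ℝ) + t₂ * I : ℂ)) := by
    intro t₁
    funext t₂
    rw [← (hsum t₁ t₂).tsum_eq]
    congr 1
    exact tsum_congr fun k => hterm _ _ k
  refine ⟨fun t₁ => ?_, ?_⟩
  · rw [hfun]
    exact integrable_coeffKernel_mul_tsum hm₂ (by norm_num) (by norm_num) _
      (fun k : ℕ × ℕ × ℕ × ℕ => k.2.1) (hk1 t₁) (hs1 t₁)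
  have hinner : ∀ t₁ : ℝ, ∫ t₂ : ℝ, coeffKernel m₂ ((3 / 4 : ℝ) + t₂ * I) *
          (zetaAway r (((1 / 2 : ℝ) + t₁ * I) + ((3 / 4 : ℝ) + t₂ * I)) *
            arithFactor r (((1 / 2 : ℝ) + t₁ * I) + s₂) (((3 / 4 : ℝ) + t₂ * I) + s₁) (s₁ + s₂)) =
      ∑' k, (if k.2.1 = m₂ then c k else 0) * (k.1 : ℂ) ^ (-((1 / 2 : ℝ) + t₁ * I : ℂ)) := by
    intro t₁
    rw [hfun, integral_coeffKernel_mul_tsum hm₂ (by norm_num) (by norm_num) _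
      (fun k : ℕ × ℕ × ℕ × ℕ => k.2.1) (hk1 t₁) (hs1 t₁)]
    refine tsum_congr fun k => ?_
    split_ifs <;> simp
  simp_rw [hinner]
  have hs2 : Summable fun k : ℕ × ℕ × ℕ × ℕ => (if k.2.1 = m₂ then c k else 0) *
      (k.1 : ℂ) ^ (-((1 / 2 : ℝ) : ℂ)) := by
    refine Summable.of_norm_bounded
      ((h00.norm).mul_right ‖(m₂ : ℂ) ^ ((3 / 4 : ℝ) : ℂ)‖) fun k => ?_
    split_ifs with h
    · rw [← norm_mul, h, mul_assoc, cpow_neg _ ((3 / 4 : ℝ) : ℂ), inv_mul_cancel₀, mul_one]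
      simp [cpow_eq_zero_iff, hm₂C]
    · rw [zero_mul, norm_zero]; positivity
  have hk0 : ∀ k : ℕ × ℕ × ℕ × ℕ, k.1 = 0 → (if k.2.1 = m₂ then c k else 0) = 0 :=
    fun k hk => by simp [hc1 k hk]
  refine ⟨integrable_coeffKernel_mul_tsum hm₁ (c := 1 / 2) (by norm_num) (by norm_num)
    (fun k : ℕ × ℕ × ℕ × ℕ => if k.2.1 = m₂ then c k else 0) (fun k => k.1) hk0 hs2, ?_⟩
  rw [integral_coeffKernel_mul_tsum hm₁ (c := 1 / 2) (by norm_num) (by norm_num)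
    (fun k : ℕ × ℕ × ℕ × ℕ => if k.2.1 = m₂ then c k else 0) (fun k => k.1) hk0 hs2]
  rw [← hinj.tsum_eq]
  · refine tsum_congr fun q => ?_
    simp [htw]
  · intro k hk
    rw [Function.mem_support] at hk
    have h1 : k.1 = m₁ := by
      by_contra h; exact hk (if_neg h)
    have h2 : k.2.1 = m₂ := by
      by_contra h; exact hk (by rw [if_pos h1, if_neg h])
    exact ⟨k.2.2, by rw [← h1, ← h2]⟩

/-! ### The factor `H` -/

/-- The size of `Γ` on the line `Re s = 1/2`, from the reflection formula. -/
theorem norm_Gamma_half_mul_exp_le (y : ℝ) :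
    ‖Complex.Gamma (1 / 2 + y * I)‖ * Real.exp (Real.pi * |y| / 2) ≤ 3 := by
  set s : ℂ := 1 / 2 + y * I with hs
  have h1 := Complex.Gamma_mul_Gamma_one_sub s
  have h2 : 1 - s = starRingEnd ℂ s := by
    apply Complex.ext
    · simp [hs]; norm_num
    · simp [hs]
  have h3 : Complex.sin (Real.pi * s) = (Real.cosh (Real.pi * y) : ℂ) := by
    rw [show (Real.pi : ℂ) * s = ((Real.pi * y : ℝ) : ℂ) * I + Real.pi / 2 by
      rw [hs]; push_cast; ring, Complex.sin_add_pi_div_two, Complex.cos_mul_I, ofReal_cosh]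
  rw [h2, Complex.Gamma_conj, Complex.mul_conj, h3, ← ofReal_div, Complex.normSq_eq_norm_sq] at h1
  have h4 : ‖Complex.Gamma s‖ ^ 2 = Real.pi / Real.cosh (Real.pi * y) := by exact_mod_cast h1
  have h5 : Real.exp (Real.pi * |y|) ≤ 2 * Real.cosh (Real.pi * y) := by
    rw [← Real.cosh_abs, abs_mul, abs_of_pos Real.pi_pos, Real.cosh_eq]
    have := Real.exp_pos (-(Real.pi * |y|))
    linarith
  have h6 : (‖Complex.Gamma s‖ * Real.exp (Real.pi * |y| / 2)) ^ 2 ≤ 3 ^ 2 := by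
    rw [mul_pow, h4, ← Real.exp_nat_mul, div_mul_eq_mul_div, div_le_iff₀ (Real.cosh_pos _)]
    rw [show ((2 : ℕ) : ℝ) * (Real.pi * |y| / 2) = Real.pi * |y| by push_cast; ring]
    have hp := Real.pi_lt_four
    have hp0 := Real.pi_pos
    have hc := Real.cosh_pos (Real.pi * y)
    calc Real.pi * Real.exp (Real.pi * |y|) ≤ Real.pi * (2 * Real.cosh (Real.pi * y)) := by gcongr
      _ ≤ 3 ^ 2 * Real.cosh (Real.pi * y) := by nlinarith
  exact (sq_le_sq₀ (by positivity) (by norm_num)).1 h6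

/-- The exponential decay of `Γ` for `1/4 ≤ Re s ≤ 1/2`, transferred from the line `Re s = 3/2` by
the Beta integral `B(s, 3/2 - Re s)`. -/
theorem exists_norm_Gamma_mul_exp_le : ∃ C : ℝ, 0 < C ∧ ∀ s : ℂ, 1 / 4 ≤ s.re → s.re ≤ 1 / 2 →
    ‖Complex.Gamma s‖ * Real.exp (Real.pi * |s.im| / 2) ≤ C * (1 + |s.im|) := by
  obtain ⟨D, hD⟩ := (isCompact_Icc (a := (1 : ℝ)) (b := 5 / 4)).exists_bound_of_continuousOn
    (f := fun x : ℝ => (Real.Gamma x)⁻¹) (by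
      intro x hx
      have hx0 : 0 < x := by linarith [hx.1]
      refine ContinuousAt.continuousWithinAt (ContinuousAt.inv₀ ?_ (Real.Gamma_pos_of_pos hx0).ne')
      refine (Real.differentiableAt_Gamma fun m => ?_).continuousAt
      have : (0 : ℝ) ≤ m := m.cast_nonneg
      linarith)
  have hD0 : 0 ≤ D := (norm_nonneg _).trans (hD 1 ⟨le_rfl, by norm_num⟩)
  refine ⟨12 * D + 1, by positivity, fun s h1 h2 => ?_⟩
  set x := s.re with hx
  set y := s.im with hy
  set c : ℝ := 3 / 2 - x with hc
  have hs0 : 0 < s.re := by linarith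
  have hc0 : 0 < (c : ℂ).re := by rw [ofReal_re]; linarith
  have key := Complex.Gamma_mul_Gamma_eq_betaIntegral hs0 hc0
  have hsc : s + c = (1 / 2 + y * I) + 1 := by
    apply Complex.ext
    · simp [hc, ← hx]; norm_num
    · simp [← hy]
  have hhalf : (1 / 2 + y * I : ℂ) ≠ 0 := by
    intro h
    have := congrArg Complex.re h
    simp at this
  rw [hsc, Complex.Gamma_add_one _ hhalf, Complex.Gamma_ofReal] at key
  have hbeta : ‖Complex.betaIntegral s c‖ ≤ 4 := by
    have h4 : ∫ t : ℝ in (0 : ℝ)..1, t ^ (-(3 / 4) : ℝ) = 4 := by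
      rw [integral_rpow (Or.inl (by norm_num))]
      norm_num
    rw [← h4, Complex.betaIntegral]
    refine intervalIntegral.norm_integral_le_of_norm_le zero_le_one ?_
      (intervalIntegral.intervalIntegrable_rpow' (by norm_num))
    have hne : ∀ᵐ t : ℝ, t ≠ 1 := by
      simp [ae_iff, measure_singleton]
    filter_upwards [hne] with t ht1 ht
    have ht0 : 0 < t := ht.1
    have ht2 : t < 1 := lt_of_le_of_ne ht.2 ht1
    rw [norm_mul, norm_cpow_eq_rpow_re_of_pos ht0,
      show (1 - (t : ℂ)) = ((1 - t : ℝ) : ℂ) by push_cast; ring,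
      norm_cpow_eq_rpow_re_of_pos (by linarith)]
    calc _ ≤ t ^ (-(3 / 4) : ℝ) * 1 := by
          refine mul_le_mul (Real.rpow_le_rpow_of_exponent_ge ht0 ht2.le ?_)
            (Real.rpow_le_one (by linarith) (by linarith) ?_) (by positivity) (by positivity)
          · rw [sub_re, one_re, ← hx]; linarith
          · rw [sub_re, one_re, ofReal_re]; linarith
      _ = _ := mul_one _
  have hΓc : 0 < Real.Gamma c := Real.Gamma_pos_of_pos (by linarith)
  have hDc : (Real.Gamma c)⁻¹ ≤ D := by
    refine (le_abs_self _).trans (hD c ⟨by linarith, by linarith⟩)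
  have hn := congrArg norm key
  rw [norm_mul, norm_mul, norm_mul, Complex.norm_real, Real.norm_of_nonneg hΓc.le] at hn
  have hΓs : ‖Complex.Gamma s‖ = ‖(1 / 2 + y * I : ℂ)‖ * ‖Complex.Gamma (1 / 2 + y * I)‖ *
      ‖Complex.betaIntegral s c‖ * (Real.Gamma c)⁻¹ := by
    rw [← hn, mul_inv_cancel_right₀ hΓc.ne']
  have hnh : ‖(1 / 2 + y * I : ℂ)‖ ≤ 1 + |y| := by
    refine (norm_le_abs_re_add_abs_im _).trans ?_
    simp
    norm_num
  have h3 := norm_Gamma_half_mul_exp_le y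
  have hy0 := abs_nonneg y
  rw [hΓs]
  calc _ = ‖(1 / 2 + y * I : ℂ)‖ * (‖Complex.Gamma (1 / 2 + y * I)‖ *
        Real.exp (Real.pi * |y| / 2)) * ‖Complex.betaIntegral s c‖ * (Real.Gamma c)⁻¹ := by ring
    _ ≤ (1 + |y|) * 3 * 4 * D := by gcongr
    _ ≤ _ := by nlinarith

theorem norm_sin_le (w : ℂ) : ‖Complex.sin w‖ ≤ Real.exp |w.im| := by
  have h := norm_sinh_le (w * I)
  rw [Complex.sinh_mul_I, norm_mul, norm_I, mul_one] at h
  simpa using h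

/-- The factor `H` grows at most polynomially: the decay of `Γ` balances the growth of the sines. -/
theorem exists_norm_ratiosH_le : ∃ C : ℝ, 0 < C ∧ ∀ z₁ z₂ : ℂ, 1 / 2 ≤ z₁.re → z₁.re ≤ 3 / 4 →
    1 / 2 ≤ z₂.re → z₂.re ≤ 3 / 4 →
      ‖ratiosH z₁ z₂‖ ≤ C * (1 + |z₁.im|) * (1 + |z₂.im|) := by
  obtain ⟨C, hC0, hC⟩ := exists_norm_Gamma_mul_exp_le
  have hpi := Real.pi_pos
  have hG : ∀ (z : ℂ) (a : ℕ), 1 / 2 ≤ z.re → z.re ≤ 3 / 4 →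
      ‖Complex.Gamma (1 - z)‖ * ‖Complex.sin ((Real.pi : ℂ) / 2 * (1 - z + (a : ℂ)))‖ ≤
        C * (1 + |z.im|) := by
    intro z a h1 h2
    have h := hC (1 - z) (by rw [sub_re, one_re]; linarith) (by rw [sub_re, one_re]; linarith)
    have him : |(1 - z).im| = |z.im| := by simp
    rw [him] at h
    refine le_trans ?_ h
    gcongr
    refine (norm_sin_le _).trans (Real.exp_le_exp.2 ?_)
    have : ((Real.pi : ℂ) / 2 * (1 - z + (a : ℂ))).im = -(Real.pi / 2 * z.im) := by
      rw [show (Real.pi : ℂ) / 2 * (1 - z + (a : ℂ)) =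
        ((Real.pi / 2 : ℝ) : ℂ) * (1 - z + (a : ℂ)) by push_cast; ring, im_ofReal_mul]
      simp
    rw [this, abs_neg, abs_mul, abs_of_pos (by positivity)]
    linarith
  refine ⟨(2 * Real.pi) ^ 2 / Real.pi ^ 2 * C ^ 2, by positivity, fun z₁ z₂ h1 h2 h3 h4 => ?_⟩
  have hpow : ‖(2 * (Real.pi : ℂ)) ^ (z₁ + z₂)‖ ≤ (2 * Real.pi) ^ 2 := by
    rw [show (2 * (Real.pi : ℂ)) = ((2 * Real.pi : ℝ) : ℂ) by push_cast; rfl,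
      norm_cpow_eq_rpow_re_of_pos (by positivity), ← Real.rpow_natCast]
    refine Real.rpow_le_rpow_of_exponent_le (by linarith [Real.pi_gt_three]) ?_
    rw [add_re]
    push_cast
    linarith
  have hterm : ∀ a : ℕ, ‖Complex.Gamma (1 - z₁)‖ * ‖Complex.Gamma (1 - z₂)‖ *
      ‖Complex.sin ((Real.pi : ℂ) / 2 * (1 - z₁ + (a : ℂ))) *
        Complex.sin ((Real.pi : ℂ) / 2 * (1 - z₂ + (a : ℂ)))‖ ≤
      C ^ 2 * (1 + |z₁.im|) * (1 + |z₂.im|) := by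
    intro a
    rw [norm_mul]
    calc _ = (‖Complex.Gamma (1 - z₁)‖ *
            ‖Complex.sin ((Real.pi : ℂ) / 2 * (1 - z₁ + (a : ℂ)))‖) *
          (‖Complex.Gamma (1 - z₂)‖ *
            ‖Complex.sin ((Real.pi : ℂ) / 2 * (1 - z₂ + (a : ℂ)))‖) := by ring
      _ ≤ (C * (1 + |z₁.im|)) * (C * (1 + |z₂.im|)) := by
          exact mul_le_mul (hG z₁ a h1 h2) (hG z₂ a h3 h4) (by positivity) (by positivity)
      _ = _ := by ring
  have h5 := hterm 0
  have h6 := hterm 1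
  rw [ratiosH, Finset.sum_range_succ, Finset.sum_range_one]
  set A := Complex.sin ((Real.pi : ℂ) / 2 * (1 - z₁ + ((0 : ℕ) : ℂ))) *
        Complex.sin ((Real.pi : ℂ) / 2 * (1 - z₂ + ((0 : ℕ) : ℂ)))
  set B := Complex.sin ((Real.pi : ℂ) / 2 * (1 - z₁ + ((1 : ℕ) : ℂ))) *
        Complex.sin ((Real.pi : ℂ) / 2 * (1 - z₂ + ((1 : ℕ) : ℂ)))
  have hAB : ‖(A + B) / 2‖ ≤ (‖A‖ + ‖B‖) / 2 := by
    rw [norm_div, show ‖(2 : ℂ)‖ = 2 by simp]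
    gcongr
    exact norm_add_le _ _
  rw [norm_mul, norm_mul, norm_mul, norm_div, norm_pow, Complex.norm_real,
    Real.norm_of_nonneg hpi.le]
  calc _ = ‖(2 * (Real.pi : ℂ)) ^ (z₁ + z₂)‖ / Real.pi ^ 2 *
        (‖Complex.Gamma (1 - z₁)‖ * ‖Complex.Gamma (1 - z₂)‖ * ‖(A + B) / 2‖) := by ring
    _ ≤ (2 * Real.pi) ^ 2 / Real.pi ^ 2 *
        (‖Complex.Gamma (1 - z₁)‖ * ‖Complex.Gamma (1 - z₂)‖ * ((‖A‖ + ‖B‖) / 2)) := by gcongr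
    _ = (2 * Real.pi) ^ 2 / Real.pi ^ 2 *
        ((‖Complex.Gamma (1 - z₁)‖ * ‖Complex.Gamma (1 - z₂)‖ * ‖A‖ +
          ‖Complex.Gamma (1 - z₁)‖ * ‖Complex.Gamma (1 - z₂)‖ * ‖B‖) / 2) := by ring
    _ ≤ (2 * Real.pi) ^ 2 / Real.pi ^ 2 * (C ^ 2 * (1 + |z₁.im|) * (1 + |z₂.im|)) := by
        gcongr
        linarith
    _ = _ := by ring

/-- The value of `H` on the line `z₁ + z₂ = 1`, which makes the two poles of the main term
cancel. -/
theorem ratiosH_one_sub {z : ℂ} (h0 : 0 < z.re) (h1 : z.re < 1) : ratiosH z (1 - z) = 1 := by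
  have hpi : (Real.pi : ℂ) ≠ 0 := by exact_mod_cast Real.pi_ne_zero
  have hne : Complex.sin (Real.pi * z) ≠ 0 := by
    intro h
    obtain ⟨k, hk⟩ := Complex.sin_eq_zero_iff.1 h
    have hz : z = k := by
      rw [mul_comm (k : ℂ)] at hk
      exact mul_left_cancel₀ hpi hk
    rw [hz, intCast_re] at h0 h1
    have h0' : 0 < k := by exact_mod_cast h0
    have h1' : k < 1 := by exact_mod_cast h1
    omega
  have hΓ : Complex.Gamma (1 - z) * Complex.Gamma z = Real.pi / Complex.sin (Real.pi * z) := by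
    rw [mul_comm, Complex.Gamma_mul_Gamma_one_sub]
  have hsin : Complex.sin ((Real.pi : ℂ) / 2 * (1 - z + ((0 : ℕ) : ℂ))) *
        Complex.sin ((Real.pi : ℂ) / 2 * (1 - (1 - z) + ((0 : ℕ) : ℂ))) +
      Complex.sin ((Real.pi : ℂ) / 2 * (1 - z + ((1 : ℕ) : ℂ))) *
        Complex.sin ((Real.pi : ℂ) / 2 * (1 - (1 - z) + ((1 : ℕ) : ℂ))) =
      Complex.sin (Real.pi * z) := by
    rw [show (Real.pi : ℂ) * z = 2 * (Real.pi / 2 * z) by ring, Complex.sin_two_mul,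
      show (Real.pi : ℂ) / 2 * (1 - z + ((0 : ℕ) : ℂ)) = Real.pi / 2 - Real.pi / 2 * z by
        push_cast; ring,
      show (Real.pi : ℂ) / 2 * (1 - (1 - z) + ((0 : ℕ) : ℂ)) = Real.pi / 2 * z by push_cast; ring,
      show (Real.pi : ℂ) / 2 * (1 - z + ((1 : ℕ) : ℂ)) = Real.pi - Real.pi / 2 * z by
        push_cast; ring,
      show (Real.pi : ℂ) / 2 * (1 - (1 - z) + ((1 : ℕ) : ℂ)) = Real.pi / 2 * z + Real.pi / 2 by
        push_cast; ring,
      Complex.sin_pi_div_two_sub, Complex.sin_pi_sub, Complex.sin_add_pi_div_two]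
    ring
  rw [ratiosH, Finset.sum_range_succ, Finset.sum_range_one, hsin, add_sub_cancel, cpow_one,
    sub_sub_cancel, mul_assoc (2 * (Real.pi : ℂ) / _), hΓ]
  field_simp

theorem differentiableOn_ratiosH (z₁ : ℂ) : DifferentiableOn ℂ (ratiosH z₁) {z | z.re < 1} := by
  intro z hz
  have hΓ : DifferentiableAt ℂ (fun z => Complex.Gamma (1 - z)) z := by
    refine DifferentiableAt.comp z (g := Complex.Gamma) (Complex.differentiableAt_Gamma _ ?_)
      (by fun_prop)
    intro m h
    have h := congrArg Complex.re h
    have hz : z.re < 1 := hz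
    have : (0 : ℝ) ≤ m := m.cast_nonneg
    simp at h
    linarith
  have hp : DifferentiableAt ℂ (fun z => (2 * (Real.pi : ℂ)) ^ (z₁ + z)) z :=
    DifferentiableAt.const_cpow (by fun_prop)
      (Or.inl (by simp [Real.pi_ne_zero]))
  have hs : DifferentiableAt ℂ (fun z => (∑ a ∈ Finset.range 2,
      Complex.sin ((Real.pi : ℂ) / 2 * (1 - z₁ + (a : ℂ))) *
        Complex.sin ((Real.pi : ℂ) / 2 * (1 - z + (a : ℂ)))) / 2) z := by fun_prop
  exact ((((hp.div_const _).mul_const _).mul hΓ).mul hs).differentiableWithinAt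

/-! ### The two halves of the main term -/

/-- The first half of the main term in closed form. -/
noncomputable def mainFirst (r : ℕ) (s₁ s₂ z₁ z₂ : ℂ) : ℂ :=
  zetaAway r (z₁ + z₂) * arithFactor r (z₁ + s₂) (z₂ + s₁) (s₁ + s₂)

/-- The second half of the main term, the one with the factor `H`, in closed form. -/
noncomputable def mainSecond (r : ℕ) (s₁ s₂ z₁ z₂ : ℂ) : ℂ :=
  ratiosH z₁ z₂ / (r : ℂ) ^ (z₁ + z₂ - 1) *
    (zetaAway r (1 - z₂ + (1 - z₁)) *
      arithFactor r (1 - z₂ + s₂) (1 - z₁ + s₁) (s₁ + s₂))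

/-- The main term multiplied by `z₁ + z₂ - 1`, which removes the poles of its two halves. In both
arithmetic factors the variable `z₂` is put into the first slot, where the factor is known to be
holomorphic. -/
noncomputable def mainNum (r : ℕ) (s₁ s₂ z₁ z₂ : ℂ) : ℂ :=
  zetaAway₁ r (z₁ + z₂) * arithFactor r (z₂ + s₁) (z₁ + s₂) (s₁ + s₂) -
    ratiosH z₁ z₂ / (r : ℂ) ^ (z₁ + z₂ - 1) *
      (zetaAway₁ r (1 - z₂ + (1 - z₁)) *
        arithFactor r (1 - z₂ + s₂) (1 - z₁ + s₁) (s₁ + s₂))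

section MainTerm

variable {r : ℕ} {ε : ℝ} {s₁ s₂ z₁ z₂ : ℂ}

theorem ratiosMainTerm_eq (hr : r.Prime) (hζ : ZetaNeZeroRightHalf) (h1 : z₁.re = 1 / 2)
    (h2 : z₂.re = 1 / 2) (h12 : z₁ + z₂ ≠ 1) (h3 : 1 / 2 < s₁.re) (h4 : 1 / 2 < s₂.re) :
    ratiosMainTerm r z₁ z₂ s₁ s₂ = mainFirst r s₁ s₂ z₁ z₂ + mainSecond r s₁ s₂ z₁ z₂ := by
  rw [ratiosMainTerm, steinhausRatio_eq hr hζ h1 h2 h12 h3 h4,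
    steinhausRatio_eq hr hζ (by rw [sub_re, one_re, h2]; norm_num)
      (by rw [sub_re, one_re, h1]; norm_num) (fun h => h12 (by linear_combination -h)) h3 h4]
  rfl

/-- Away from the pole. The hypotheses on real parts allow the symmetry of the arithmetic factor. -/
theorem mainNum_eq (hr : r.Prime) (h1 : 1 < (z₁ + s₂).re) (h2 : 1 < (z₂ + s₁).re)
    (h3 : 1 < (s₁ + s₂).re) (h12 : z₁ + z₂ ≠ 1) :
    mainNum r s₁ s₂ z₁ z₂ =
      (z₁ + z₂ - 1) * (mainFirst r s₁ s₂ z₁ z₂ + mainSecond r s₁ s₂ z₁ z₂) := by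
  rw [mainNum, mainFirst, mainSecond, zetaAway₁_eq r h12, zetaAway₁_eq r
    (fun h => h12 (by linear_combination -h)), arithFactor_symm hr h1 h2 h3]
  ring

/-- The two poles of the main term cancel. -/
theorem mainNum_one_sub (hr : r.Prime) (hε : 0 < ε) (h1 : z₁.re = 1 / 2)
    (h3 : s₁.re = 1 / 2 + ε) (h4 : s₂.re = 1 / 2 + ε) : mainNum r s₁ s₂ z₁ (1 - z₁) = 0 := by
  rw [mainNum, ratiosH_one_sub (by linarith) (by linarith), add_sub_cancel, sub_self, cpow_zero,
    sub_sub_cancel, add_sub_cancel, div_one, one_mul,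
    arithFactor_symm hr (u := z₁ + s₂) (by rw [add_re]; linarith)
      (by rw [add_re, sub_re, one_re]; linarith) (by rw [add_re]; linarith), sub_self]

theorem differentiableOn_mainNum (hr : r.Prime) (hζ : ZetaNeZeroRightHalf) (hε : 0 < ε)
    (h1 : z₁.re = 1 / 2) (h3 : s₁.re = 1 / 2 + ε) (h4 : s₂.re = 1 / 2 + ε) :
    DifferentiableOn ℂ (mainNum r s₁ s₂ z₁) {z | 0 < z.re ∧ z.re < 1} := by
  have hrC : (r : ℂ) ≠ 0 := by exact_mod_cast hr.ne_zero
  have ht : 1 < (s₁ + s₂).re := by rw [add_re]; linarith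
  have hz := differentiable_zetaAway₁ hr
  have hA : DifferentiableOn ℂ (fun z₂ => arithFactor r (z₂ + s₁) (z₁ + s₂) (s₁ + s₂))
      {z | 0 < z.re ∧ z.re < 1} :=
    (differentiableOn_arithFactor hr hζ (v := z₁ + s₂) (by rw [add_re]; linarith) ht).comp
      (f := fun z₂ => z₂ + s₁) (by fun_prop) fun z hz => by
        have := hz.1
        simp only [mem_ofPred_eq, add_re]
        linarith
  have hB : DifferentiableOn ℂ (fun z₂ => arithFactor r (1 - z₂ + s₂) (1 - z₁ + s₁) (s₁ + s₂))
      {z | 0 < z.re ∧ z.re < 1} :=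
    (differentiableOn_arithFactor hr hζ (v := 1 - z₁ + s₁)
      (by rw [add_re, sub_re, one_re]; linarith) ht).comp
      (f := fun z₂ => 1 - z₂ + s₂) (by fun_prop) fun z hz => by
        have := hz.2
        simp only [mem_ofPred_eq, add_re, sub_re, one_re]
        linarith
  have hH : DifferentiableOn ℂ (fun z₂ => ratiosH z₁ z₂ / (r : ℂ) ^ (z₁ + z₂ - 1))
      {z | 0 < z.re ∧ z.re < 1} := by
    refine ((differentiableOn_ratiosH z₁).mono fun z hz => hz.2).div ?_ fun z _ => ?_
    · exact Differentiable.differentiableOn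
        (Differentiable.const_cpow (by fun_prop) (Or.inl hrC))
    · simp [cpow_eq_zero_iff, hrC]
  have hz1 : Differentiable ℂ fun z₂ => zetaAway₁ r (z₁ + z₂) := hz.comp (by fun_prop)
  have hz2 : Differentiable ℂ fun z₂ => zetaAway₁ r (1 - z₂ + (1 - z₁)) := hz.comp (by fun_prop)
  exact (hz1.differentiableOn.mul hA).sub (hH.mul (hz2.differentiableOn.mul hB))

theorem norm_zetaAway₁_le (hr : r.Prime) {s : ℂ} (hs : 1 / 2 ≤ s.re) (hs2 : s.re ≤ 2) :
    ‖zetaAway₁ r s‖ ≤ 24 * (1 + |s.im|) ^ 2 := by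
  have h0 := abs_nonneg s.im
  have h1 : ‖s‖ ≤ 2 * (1 + |s.im|) := by
    refine (norm_le_abs_re_add_abs_im s).trans ?_
    rw [abs_of_nonneg (by linarith)]
    linarith
  have h2 : ‖s - 1‖ ≤ 1 + |s.im| := by
    refine (norm_le_abs_re_add_abs_im _).trans ?_
    rw [sub_re, sub_im, one_re, one_im, sub_zero]
    gcongr
    rw [abs_le]
    constructor <;> linarith
  rw [zetaAway₁, norm_mul]
  calc _ ≤ 2 * (2 * (1 + |s.im|) + 2 * (2 * (1 + |s.im|) * (1 + |s.im|))) := by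
        refine mul_le_mul (norm_one_sub_prime_cpow_le hr (by linarith)) ?_ (norm_nonneg _)
          (by norm_num)
        refine (norm_riemannZeta₁_le hs).trans ?_
        gcongr
    _ ≤ _ := by nlinarith

theorem one_add_abs_add_le (x y : ℝ) : 1 + |x + y| ≤ (1 + |x|) * (1 + |y|) := by
  have := abs_add_le x y
  nlinarith [abs_nonneg x, abs_nonneg y, mul_nonneg (abs_nonneg x) (abs_nonneg y)]

theorem one_add_abs_sub_le (x y : ℝ) : 1 + |x - y| ≤ (1 + |x|) * (1 + |y|) := by
  simpa [sub_eq_add_neg] using one_add_abs_add_le x (-y)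

/-- Polynomial growth of the cleared main term in `z₂`, with constants that depend on everything
else. -/
theorem exists_norm_mainNum_le (hr : r.Prime) (hζ : ZetaNeZeroRightHalf) (hε : 0 < ε)
    (h1 : z₁.re = 1 / 2) (h3 : s₁.re = 1 / 2 + ε) (h4 : s₂.re = 1 / 2 + ε) :
    ∃ C : ℝ, 0 < C ∧ ∀ z₂ : ℂ, 1 / 2 ≤ z₂.re → z₂.re ≤ 3 / 4 →
      ‖mainNum r s₁ s₂ z₁ z₂‖ ≤ C * (1 + |z₂.im|) ^ 4 := by
  obtain ⟨A, hA0, hA⟩ := exists_norm_arithFactor_le hζ hε one_pos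
  obtain ⟨H, hH0, hH⟩ := exists_norm_ratiosH_le
  set a := 1 + |z₁.im| with ha
  set b := 1 + |s₁.im| with hb
  set c := 1 + |s₂.im| with hc
  have ha1 : 1 ≤ a := by rw [ha]; linarith [abs_nonneg z₁.im]
  have hb1 : 1 ≤ b := by rw [hb]; linarith [abs_nonneg s₁.im]
  have hc1 : 1 ≤ c := by rw [hc]; linarith [abs_nonneg s₂.im]
  refine ⟨24 * a ^ 2 * (A * b) + H * a * (24 * a ^ 2 * (A * c)), by positivity,
    fun z₂ h5 h6 => ?_⟩
  set y := 1 + |z₂.im| with hy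
  have hy1 : 1 ≤ y := by rw [hy]; linarith [abs_nonneg z₂.im]
  have e1 : ‖zetaAway₁ r (z₁ + z₂)‖ ≤ 24 * (a * y) ^ 2 := by
    refine (norm_zetaAway₁_le hr (by rw [add_re]; linarith) (by rw [add_re]; linarith)).trans ?_
    gcongr
    rw [add_im]
    exact one_add_abs_add_le _ _
  have e2 : ‖zetaAway₁ r (1 - z₂ + (1 - z₁))‖ ≤ 24 * (a * y) ^ 2 := by
    refine (norm_zetaAway₁_le hr (by simp only [add_re, sub_re, one_re]; linarith)
      (by simp only [add_re, sub_re, one_re]; linarith)).trans ?_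
    gcongr
    rw [show (1 - z₂ + (1 - z₁)).im = -(z₁.im + z₂.im) by
      simp only [add_im, sub_im, one_im]; ring, abs_neg]
    exact one_add_abs_add_le _ _
  have e3 : ‖arithFactor r (z₂ + s₁) (z₁ + s₂) (s₁ + s₂)‖ ≤ A * (y * b) := by
    refine (hA r hr _ _ _ (by rw [add_re]; linarith) (by rw [add_re]; linarith)
      (by rw [add_re]; linarith)).trans ?_
    rw [Real.rpow_one, add_im]
    gcongr
    exact one_add_abs_add_le _ _
  have e4 : ‖arithFactor r (1 - z₂ + s₂) (1 - z₁ + s₁) (s₁ + s₂)‖ ≤ A * (c * y) := by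
    refine (hA r hr _ _ _ (by simp only [add_re, sub_re, one_re]; linarith)
      (by simp only [add_re, sub_re, one_re]; linarith) (by rw [add_re]; linarith)).trans ?_
    rw [Real.rpow_one, show (1 - z₂ + s₂).im = s₂.im - z₂.im by
      simp only [add_im, sub_im, one_im]; ring]
    gcongr
    exact one_add_abs_sub_le _ _
  have e5 : ‖ratiosH z₁ z₂ / (r : ℂ) ^ (z₁ + z₂ - 1)‖ ≤ H * a * y := by
    rw [norm_div, norm_natCast_cpow_of_pos hr.pos]
    refine (div_le_self (norm_nonneg _) (Real.one_le_rpow (by exact_mod_cast hr.one_le) ?_)).trans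
      (hH z₁ z₂ (by linarith) (by linarith) h5 h6)
    simp only [sub_re, add_re, one_re]
    linarith
  rw [mainNum]
  refine (norm_sub_le _ _).trans ?_
  rw [norm_mul, norm_mul, norm_mul]
  calc _ ≤ 24 * (a * y) ^ 2 * (A * (y * b)) +
        H * a * y * (24 * (a * y) ^ 2 * (A * (c * y))) := by gcongr
    _ = 24 * a ^ 2 * (A * b) * y ^ 3 + H * a * (24 * a ^ 2 * (A * c)) * y ^ 4 := by ring
    _ ≤ 24 * a ^ 2 * (A * b) * y ^ 4 + H * a * (24 * a ^ 2 * (A * c)) * y ^ 4 := by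
        gcongr
        norm_num
    _ = _ := by ring

/-- On the shifted line the second half of the main term saves a power of `r`. -/
theorem exists_norm_mainSecond_le (hζ : ZetaNeZeroRightHalf) (hε : 0 < ε) (hε1 : ε ≤ 1) :
    ∃ C : ℝ, 0 < C ∧ ∀ r : ℕ, r.Prime → ∀ s₁ s₂ z₁ z₂ : ℂ, s₁.re = 1 / 2 + ε →
      s₂.re = 1 / 2 + ε → z₁.re = 1 / 2 → z₂.re = 3 / 4 →
        ‖mainSecond r s₁ s₂ z₁ z₂‖ ≤ C * (r : ℝ) ^ (-(1 / 4) : ℝ) * (1 + |s₂.im|) ^ ε *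
          (1 + |z₁.im|) ^ 2 * (1 + |z₂.im|) ^ 3 := by
  obtain ⟨A, hA0, hA⟩ := exists_norm_arithFactor_le hζ hε hε
  obtain ⟨H, hH0, hH⟩ := exists_norm_ratiosH_le
  refine ⟨H * 12 * A, by positivity, fun r hr s₁ s₂ z₁ z₂ h3 h4 h1 h2 => ?_⟩
  set a := 1 + |z₁.im| with ha
  set c := 1 + |s₂.im| with hc
  set y := 1 + |z₂.im| with hy
  have ha1 : 1 ≤ a := by rw [ha]; linarith [abs_nonneg z₁.im]
  have hc1 : 1 ≤ c := by rw [hc]; linarith [abs_nonneg s₂.im]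
  have hy1 : 1 ≤ y := by rw [hy]; linarith [abs_nonneg z₂.im]
  have e4 : ‖arithFactor r (1 - z₂ + s₂) (1 - z₁ + s₁) (s₁ + s₂)‖ ≤ A * (c ^ ε * y) := by
    refine (hA r hr _ _ _ (by simp only [add_re, sub_re, one_re]; linarith)
      (by simp only [add_re, sub_re, one_re]; linarith) (by rw [add_re]; linarith)).trans ?_
    rw [show (1 - z₂ + s₂).im = s₂.im - z₂.im by
      simp only [add_im, sub_im, one_im]; ring]
    have : (1 + |s₂.im - z₂.im|) ^ ε ≤ (c * y) ^ ε :=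
      Real.rpow_le_rpow (by positivity) (one_add_abs_sub_le _ _) hε.le
    rw [Real.mul_rpow (by linarith) (by linarith)] at this
    gcongr
    refine this.trans ?_
    gcongr
    simpa using Real.rpow_le_rpow_of_exponent_le hy1 hε1
  have e5 : ‖ratiosH z₁ z₂ / (r : ℂ) ^ (z₁ + z₂ - 1)‖ ≤ H * a * y * (r : ℝ) ^ (-(1 / 4) : ℝ) := by
    rw [norm_div, norm_natCast_cpow_of_pos hr.pos, Real.rpow_neg (Nat.cast_nonneg r),
      ← div_eq_mul_inv, show (z₁ + z₂ - 1).re = 1 / 4 by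
        simp only [sub_re, add_re, one_re]; rw [h1, h2]; norm_num]
    gcongr
    exact hH z₁ z₂ (by linarith) (by linarith) (by linarith) (by linarith)
  have e2 : ‖zetaAway r (1 - z₂ + (1 - z₁))‖ ≤ 12 * (a * y) := by
    set s := 1 - z₂ + (1 - z₁) with hs
    have hre : s.re = 3 / 4 := by
      simp only [hs, sub_re, add_re, one_re]; rw [h1, h2]; norm_num
    have hd : 1 / 4 ≤ ‖s - 1‖ := by
      have := abs_re_le_norm (s - 1)
      rw [sub_re, hre, one_re] at this
      norm_num at this
      linarith
    have hs1 : s ≠ 1 := by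
      rintro h
      rw [h] at hd
      norm_num at hd
    have hn : ‖s‖ ≤ a * y := by
      refine (norm_le_abs_re_add_abs_im s).trans (le_trans ?_ (one_add_abs_add_le z₁.im z₂.im))
      rw [hre, show s.im = -(z₁.im + z₂.im) by
        simp only [hs, add_im, sub_im, one_im]; ring, abs_neg]
      gcongr
      norm_num
    refine (norm_zetaAway_le hr (by linarith) hs1).trans ?_
    calc _ ≤ 2 * (a * y * (1 / (1 / 4) + 2)) := by gcongr
      _ = _ := by ring
  rw [mainSecond, norm_mul, norm_mul]
  calc _ ≤ H * a * y * (r : ℝ) ^ (-(1 / 4) : ℝ) * (12 * (a * y) * (A * (c ^ ε * y))) := by gcongr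
    _ = _ := by ring

end MainTerm

/-! ### Moving the line of integration -/

/-- For fixed `z₁` the main term, whose singularity at `z₂ = 1 - z₁` is removable, is moved from the
critical line to the line `Re z₂ = 3/4`, where its two halves can be separated. -/
theorem integral_coeffKernel_mul_ratiosMainTerm {r : ℕ} {ε : ℝ} {s₁ s₂ z₁ : ℂ} (hr : r.Prime)
    (hζ : ZetaNeZeroRightHalf) (hε : 0 < ε) (h1 : z₁.re = 1 / 2) (h3 : s₁.re = 1 / 2 + ε)
    (h4 : s₂.re = 1 / 2 + ε) {m : ℕ} (hm : 1 ≤ m) :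
    (Integrable fun t : ℝ => coeffKernel m ((1 / 2 : ℝ) + t * I) *
      ratiosMainTerm r z₁ ((1 / 2 : ℝ) + t * I) s₁ s₂) ∧
    (Integrable fun t : ℝ => coeffKernel m ((3 / 4 : ℝ) + t * I) *
      (mainFirst r s₁ s₂ z₁ ((3 / 4 : ℝ) + t * I) +
        mainSecond r s₁ s₂ z₁ ((3 / 4 : ℝ) + t * I))) ∧
    ∫ t : ℝ, coeffKernel m ((1 / 2 : ℝ) + t * I) *
        ratiosMainTerm r z₁ ((1 / 2 : ℝ) + t * I) s₁ s₂ =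
      ∫ t : ℝ, coeffKernel m ((3 / 4 : ℝ) + t * I) *
        (mainFirst r s₁ s₂ z₁ ((3 / 4 : ℝ) + t * I) +
          mainSecond r s₁ s₂ z₁ ((3 / 4 : ℝ) + t * I)) := by
  set N := mainNum r s₁ s₂ z₁ with hN
  set G : ℂ → ℂ := fun z => coeffKernel m z * dslope N (1 - z₁) z with hG
  have hN0 : N (1 - z₁) = 0 := mainNum_one_sub hr hε h1 h3 h4
  have hslope : ∀ z : ℂ, z₁ + z ≠ 1 → dslope N (1 - z₁) z = (z₁ + z - 1)⁻¹ * N z := by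
    intro z hz
    rw [dslope_of_ne N (fun h => hz (by rw [h]; ring)), slope_def_field, hN0, sub_zero,
      div_eq_inv_mul]
    congr 2
    ring
  have hmain : ∀ z : ℂ, 1 / 2 ≤ z.re → z₁ + z ≠ 1 → dslope N (1 - z₁) z =
      mainFirst r s₁ s₂ z₁ z + mainSecond r s₁ s₂ z₁ z := by
    intro z hz hne
    rw [hslope z hne, hN, mainNum_eq hr (by rw [add_re]; linarith) (by rw [add_re]; linarith)
      (by rw [add_re]; linarith) hne, inv_mul_cancel_left₀ (sub_ne_zero.2 hne)]
  set U : Set ℂ := {z | 0 < z.re ∧ z.re < 1} with hU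
  have hUo : IsOpen U :=
    (isOpen_lt continuous_const continuous_re).inter (isOpen_lt continuous_re continuous_const)
  have hGd : DifferentiableOn ℂ G U := by
    refine (differentiable_coeffKernel hm).differentiableOn.mul ?_
    refine (Complex.differentiableOn_dslope (hUo.mem_nhds ⟨?_, ?_⟩)).2
      (differentiableOn_mainNum hr hζ hε h1 h3 h4)
    · rw [sub_re, one_re]; linarith
    · rw [sub_re, one_re]; linarith
  obtain ⟨C, hC0, hC⟩ := exists_norm_mainNum_le hr hζ hε h1 h3 h4
  have hGc : ContinuousOn G {z | 1 / 2 ≤ z.re ∧ z.re ≤ 3 / 4} :=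
    hGd.continuousOn.mono fun z hz => ⟨by linarith [hz.1], by linarith [hz.2]⟩
  obtain ⟨B, hB⟩ := exists_bound_on_strip (C := coeffKernelConst * m ^ 7 * C)
    (Y := |z₁.im| + 1) hGc (by
      -- Here `‖z₁ + z - 1‖ ≥ 1`, so clearing the pole has not made the main term smaller.
      intro z hz1 hz2 hY
      have hK := norm_coeffKernel_le hm hz1 (by linarith)
      have hKc := coeffKernelConst_pos
      have him : 1 ≤ ‖z₁ + z - 1‖ := by
        refine le_trans ?_ (abs_im_le_norm _)
        rw [sub_im, add_im, one_im, sub_zero]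
        have := abs_sub_abs_le_abs_sub z.im (-z₁.im)
        rw [abs_neg, sub_neg_eq_add, add_comm z.im] at this
        linarith
      have hne : z₁ + z ≠ 1 := by
        rintro h
        rw [h, sub_self, norm_zero] at him
        linarith
      have h0 := abs_nonneg z.im
      have hp : 0 < 1 + |z.im| := by linarith
      simp only [hG]
      rw [hslope z hne, norm_mul, norm_mul, norm_inv]
      calc _ ≤ coeffKernelConst * m ^ 7 / (1 + |z.im|) ^ 6 * (1 * (C * (1 + |z.im|) ^ 4)) := by
            gcongr
            · exact inv_le_one_of_one_le₀ him
            · exact hC z hz1 hz2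
        _ = coeffKernelConst * m ^ 7 * C / (1 + |z.im|) ^ 2 := by field_simp
        _ ≤ _ := by
            gcongr
            rw [← sq_abs]; nlinarith)
  have hI := integrable_vertical hGc le_rfl (by norm_num) hB
  have hI' := integrable_vertical hGc (by norm_num) le_rfl hB
  have hshift := integral_vertical_eq (by norm_num) hGc
    (hGd.mono fun z hz => ⟨by linarith [hz.1], by linarith [hz.2]⟩) hB
  have hae : (fun t : ℝ => G ((1 / 2 : ℝ) + t * I)) =ᵐ[volume] fun t : ℝ =>
      coeffKernel m ((1 / 2 : ℝ) + t * I) * ratiosMainTerm r z₁ ((1 / 2 : ℝ) + t * I) s₁ s₂ := by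
    have hne : ∀ᵐ t : ℝ, t ≠ -z₁.im := by
      simp [ae_iff, measure_singleton]
    filter_upwards [hne] with t ht
    have hre : (((1 / 2 : ℝ) : ℂ) + t * I).re = 1 / 2 := by simp
    have h12 : z₁ + (((1 / 2 : ℝ) : ℂ) + t * I) ≠ 1 := by
      intro h
      have := congrArg Complex.im h
      simp at this
      exact ht (by linarith)
    simp only [hG]
    rw [hmain _ hre.ge h12, ratiosMainTerm_eq hr hζ h1 hre h12 (by linarith) (by linarith)]
  have heq : (fun t : ℝ => G ((3 / 4 : ℝ) + t * I)) = fun t : ℝ =>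
      coeffKernel m ((3 / 4 : ℝ) + t * I) * (mainFirst r s₁ s₂ z₁ ((3 / 4 : ℝ) + t * I) +
        mainSecond r s₁ s₂ z₁ ((3 / 4 : ℝ) + t * I)) := by
    funext t
    have hre : (((3 / 4 : ℝ) : ℂ) + t * I).re = 3 / 4 := by simp
    simp only [hG]
    rw [hmain _ (by rw [hre]; norm_num)]
    intro h
    have := congrArg Complex.re h
    rw [add_re, hre, h1, one_re] at this
    norm_num at this
  refine ⟨hI.congr hae, heq ▸ hI', ?_⟩
  rw [← integral_congr_ae hae, ← heq]
  exact hshift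

/-! ### Averages over characters -/

theorem integrable_charAvg {r : ℕ} [NeZero r] {F : DirichletCharacter ℂ r → ℝ → ℂ}
    (hF : ∀ χ ≠ 1, Integrable (F χ)) : Integrable fun t => charAvg r fun χ => F χ t := by
  simp only [charAvg]
  exact (integrable_finsetSum _ fun χ hχ => hF χ (Finset.ne_of_mem_erase hχ)).const_mul _

theorem integral_charAvg {r : ℕ} [NeZero r] {F : DirichletCharacter ℂ r → ℝ → ℂ}
    (hF : ∀ χ ≠ 1, Integrable (F χ)) :
    ∫ t, charAvg r (fun χ => F χ t) = charAvg r fun χ => ∫ t, F χ t := by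
  simp only [charAvg]
  rw [integral_const_mul, integral_finsetSum _ fun χ hχ => hF χ (Finset.ne_of_mem_erase hχ)]

theorem mul_charAvg {r : ℕ} [NeZero r] (c : ℂ) (F : DirichletCharacter ℂ r → ℂ) :
    c * charAvg r F = charAvg r fun χ => c * F χ := by
  rw [charAvg, charAvg, mul_left_comm, Finset.mul_sum]

theorem charAvg_congr {r : ℕ} [NeZero r] {F G : DirichletCharacter ℂ r → ℂ}
    (h : ∀ χ ≠ 1, F χ = G χ) : charAvg r F = charAvg r G := by
  rw [charAvg, charAvg]
  congr 1
  exact Finset.sum_congr rfl fun χ hχ => h χ (Finset.ne_of_mem_erase hχ)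

theorem star_ne_one_of_ne_one {r : ℕ} [NeZero r] {χ : DirichletCharacter ℂ r} (h : χ ≠ 1) :
    star χ ≠ 1 := by
  rw [MulChar.star_eq_inv]
  exact inv_ne_one.2 h

section CharacterSide

variable {r : ℕ} [NeZero r] {m₁ m₂ : ℕ} (D : DirichletCharacter ℂ r → ℂ)

/-- Extraction of `χ̄(m₂)`, with a weight `1 / D χ` not depending on the variable of integration. -/
theorem integral_coeffKernel_mul_charAvg_inner (hm₂ : 1 ≤ m₂) (z₁ : ℂ) :
    (Integrable fun t : ℝ => coeffKernel m₂ ((1 / 2 : ℝ) + t * I) * charAvg r fun χ =>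
      DirichletCharacter.LFunction χ z₁ *
        DirichletCharacter.LFunction (star χ) ((1 / 2 : ℝ) + t * I) / D χ) ∧
    ∫ t : ℝ, coeffKernel m₂ ((1 / 2 : ℝ) + t * I) * charAvg r (fun χ =>
      DirichletCharacter.LFunction χ z₁ *
        DirichletCharacter.LFunction (star χ) ((1 / 2 : ℝ) + t * I) / D χ) =
      charAvg r fun χ => DirichletCharacter.LFunction χ z₁ * star χ (m₂ : ZMod r) / D χ := by
  have e : ∀ t : ℝ, coeffKernel m₂ ((1 / 2 : ℝ) + t * I) * charAvg r (fun χ =>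
      DirichletCharacter.LFunction χ z₁ *
        DirichletCharacter.LFunction (star χ) ((1 / 2 : ℝ) + t * I) / D χ) =
      charAvg r fun χ => DirichletCharacter.LFunction χ z₁ / D χ *
        (coeffKernel m₂ ((1 / 2 : ℝ) + t * I) *
          DirichletCharacter.LFunction (star χ) ((1 / 2 : ℝ) + t * I)) := by
    intro t
    rw [mul_charAvg]
    exact charAvg_congr fun χ _ => by ring
  simp_rw [e]
  have hI : ∀ χ : DirichletCharacter ℂ r, χ ≠ 1 → Integrable fun t : ℝ =>
      DirichletCharacter.LFunction χ z₁ / D χ * (coeffKernel m₂ ((1 / 2 : ℝ) + t * I) *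
          DirichletCharacter.LFunction (star χ) ((1 / 2 : ℝ) + t * I)) := fun χ hχ =>
    (integrable_coeffKernel_mul_LFunction (star_ne_one_of_ne_one hχ) hm₂).const_mul _
  refine ⟨integrable_charAvg hI, ?_⟩
  rw [integral_charAvg hI]
  refine charAvg_congr fun χ hχ => ?_
  rw [integral_const_mul, integral_coeffKernel_mul_LFunction (star_ne_one_of_ne_one hχ) hm₂]
  ring

/-- Extraction of `χ(m₁)`. -/
theorem integral_coeffKernel_mul_charAvg_outer (hm₁ : 1 ≤ m₁) :
    (Integrable fun t : ℝ => coeffKernel m₁ ((1 / 2 : ℝ) + t * I) * charAvg r fun χ =>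
      DirichletCharacter.LFunction χ ((1 / 2 : ℝ) + t * I) * star χ (m₂ : ZMod r) / D χ) ∧
    ∫ t : ℝ, coeffKernel m₁ ((1 / 2 : ℝ) + t * I) * charAvg r (fun χ =>
      DirichletCharacter.LFunction χ ((1 / 2 : ℝ) + t * I) * star χ (m₂ : ZMod r) / D χ) =
      charAvg r fun χ => χ (m₁ : ZMod r) * star χ (m₂ : ZMod r) / D χ := by
  have e : ∀ t : ℝ, coeffKernel m₁ ((1 / 2 : ℝ) + t * I) * charAvg r (fun χ =>
      DirichletCharacter.LFunction χ ((1 / 2 : ℝ) + t * I) * star χ (m₂ : ZMod r) / D χ) =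
      charAvg r fun χ => star χ (m₂ : ZMod r) / D χ * (coeffKernel m₁ ((1 / 2 : ℝ) + t * I) *
        DirichletCharacter.LFunction χ ((1 / 2 : ℝ) + t * I)) := by
    intro t
    rw [mul_charAvg]
    exact charAvg_congr fun χ _ => by ring
  simp_rw [e]
  have hI : ∀ χ : DirichletCharacter ℂ r, χ ≠ 1 → Integrable fun t : ℝ =>
      star χ (m₂ : ZMod r) / D χ * (coeffKernel m₁ ((1 / 2 : ℝ) + t * I) *
        DirichletCharacter.LFunction χ ((1 / 2 : ℝ) + t * I)) := fun χ hχ =>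
    (integrable_coeffKernel_mul_LFunction hχ hm₁).const_mul _
  refine ⟨integrable_charAvg hI, ?_⟩
  rw [integral_charAvg hI]
  refine charAvg_congr fun χ hχ => ?_
  rw [integral_const_mul, integral_coeffKernel_mul_LFunction hχ hm₁]
  ring

end CharacterSide

/-! ### From the Ratios Conjecture to the twisted average -/

/-- The principal character carries the zeros of `ζ`, so a single modulus gives the Riemann
hypothesis. -/
theorem zetaNeZeroRightHalf_of_GRHModulus {r : ℕ} [Fact r.Prime] (h : GRHModulus r) :
    ZetaNeZeroRightHalf := by
  intro s h1 h2 h0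
  have hs : s ≠ 1 := by
    rintro rfl
    simp at h2
  have h3 := h 1 s (by linarith) h2
    ((DirichletCharacter.LFunctionTrivChar_eq_mul_riemannZeta hs).trans (by rw [h0, mul_zero]))
  linarith

theorem norm_integral_coeffKernel_mul_le {m : ℕ} (hm : 1 ≤ m) {c : ℝ} (h1 : 1 / 2 ≤ c)
    (h2 : c ≤ 2) {f : ℝ → ℂ} {B : ℝ} (hB : 0 ≤ B) (hf : ∀ᵐ t : ℝ, ‖f t‖ ≤ B * (1 + |t|) ^ 4) :
    ‖∫ t : ℝ, coeffKernel m (c + t * I) * f t‖ ≤ coeffKernelConst * m ^ 7 * B * Real.pi := by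
  have hKc := coeffKernelConst_pos
  rw [← integral_univ_inv_one_add_sq, ← integral_const_mul]
  refine norm_integral_le_of_norm_le (integrable_inv_one_add_sq.const_mul _) ?_
  filter_upwards [hf] with t ht
  have h0 := abs_nonneg t
  have hp : 0 < 1 + |t| := by positivity
  have hK := norm_coeffKernel_le hm (z := c + t * I) (by simpa using h1) (by simpa using h2)
  rw [show ((c : ℂ) + t * I).im = t by simp] at hK
  rw [norm_mul]
  calc _ ≤ coeffKernelConst * m ^ 7 / (1 + |t|) ^ 6 * (B * (1 + |t|) ^ 4) := by gcongr
    _ = coeffKernelConst * m ^ 7 * B * ((1 + |t|) ^ 2)⁻¹ := by field_simp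
    _ ≤ _ := by
        gcongr
        rw [← sq_abs]; nlinarith

/-- The height in the conjecture's error term, with the integration variables `x, y` split off. -/
theorem one_add_max_rpow_le {x y a b ε : ℝ} (hε : 0 < ε) (hε1 : ε ≤ 1) :
    (1 + max (max |x| |y|) (max |a| |b|)) ^ ε ≤
      (1 + max |a| |b|) ^ ε * (1 + |x|) * (1 + |y|) := by
  have hx := abs_nonneg x
  have hy := abs_nonneg y
  have hab : 0 ≤ max |a| |b| := (abs_nonneg a).trans (le_max_left _ _)
  have h1 : 1 + max (max |x| |y|) (max |a| |b|) ≤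
      (1 + max |a| |b|) * ((1 + |x|) * (1 + |y|)) := by
    have h3 : max (max |x| |y|) (max |a| |b|) ≤ |x| + |y| + max |a| |b| :=
      max_le (max_le (by linarith) (by linarith)) (by linarith)
    have h2 : 1 + (|x| + |y|) ≤ (1 + |x|) * (1 + |y|) := by nlinarith
    have h4 : 1 + (|x| + |y| + max |a| |b|) ≤ (1 + max |a| |b|) * (1 + (|x| + |y|)) := by nlinarith
    calc _ ≤ 1 + (|x| + |y| + max |a| |b|) := by linarith
      _ ≤ _ := h4
      _ ≤ _ := by gcongr
  refine (Real.rpow_le_rpow (by positivity) h1 hε.le).trans ?_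
  rw [Real.mul_rpow (by positivity) (by positivity), mul_assoc]
  gcongr
  have h5 : 1 ≤ (1 + |x|) * (1 + |y|) := by nlinarith
  simpa using Real.rpow_le_rpow_of_exponent_le h5 hε1

/-- The twisted average, for a pointwise error `E (1 + |t₁|) (1 + |t₂|)` in the asymptotic formula
on the critical lines and a bound for the second half of the main term on the shifted line. -/
theorem norm_charAvg_sub_tsum_le {r : ℕ} [Fact r.Prime] (hζ : ZetaNeZeroRightHalf) {ε E : ℝ}
    (hε : 0 < ε) (hE : 0 ≤ E) {s₁ s₂ : ℂ} (h3 : s₁.re = 1 / 2 + ε) (h4 : s₂.re = 1 / 2 + ε)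
    (havg : ∀ z₁ z₂ : ℂ, z₁.re = 1 / 2 → z₂.re = 1 / 2 → z₁ + z₂ ≠ 1 →
      ‖charAvg r (fun χ =>
          (DirichletCharacter.LFunction χ z₁ * DirichletCharacter.LFunction (star χ) z₂) /
            (DirichletCharacter.LFunction χ s₁ * DirichletCharacter.LFunction (star χ) s₂)) -
        ratiosMainTerm r z₁ z₂ s₁ s₂‖ ≤ E * (1 + |z₁.im|) * (1 + |z₂.im|))
    (hsec : ∀ z₁ z₂ : ℂ, z₁.re = 1 / 2 → z₂.re = 3 / 4 →
      ‖mainSecond r s₁ s₂ z₁ z₂‖ ≤ E * (1 + |z₁.im|) ^ 2 * (1 + |z₂.im|) ^ 3)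
    {m₁ m₂ : ℕ} (hm₁ : 1 ≤ m₁) (hm₂ : 1 ≤ m₂) :
    ‖charAvg r (fun χ => (χ (m₁ : ZMod r) * star χ (m₂ : ZMod r)) /
        (DirichletCharacter.LFunction χ s₁ * DirichletCharacter.LFunction (star χ) s₂)) -
      ∑' k : ℕ × ℕ, steinhausTwistedTerm r m₁ m₂ s₁ s₂ k‖ ≤
      2 * (coeffKernelConst * Real.pi) ^ 2 * E * ((m₁ : ℝ) ^ 7 * (m₂ : ℝ) ^ 7) := by
  have hr : r.Prime := Fact.out
  have hKc := coeffKernelConst_pos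
  have hpi := Real.pi_pos
  set D : DirichletCharacter ℂ r → ℂ := fun χ =>
    DirichletCharacter.LFunction χ s₁ * DirichletCharacter.LFunction (star χ) s₂ with hD
  obtain ⟨-, hfirst, hFi, hFv⟩ := integral_integral_coeffKernel_mul_ratio hr hm₁ hm₂ (s₁ := s₁)
    (s₂ := s₂) (by linarith) (by linarith)
  obtain ⟨hai, hav⟩ := integral_coeffKernel_mul_charAvg_outer (m₂ := m₂) D hm₁
  rw [← hFv, ← hav, ← integral_sub hai hFi]
  simp_rw [← mul_sub]
  have hdiff : ∀ t₁ : ℝ, ‖charAvg r (fun χ =>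
        DirichletCharacter.LFunction χ ((1 / 2 : ℝ) + t₁ * I) * star χ (m₂ : ZMod r) / D χ) -
      ∫ t₂ : ℝ, coeffKernel m₂ ((3 / 4 : ℝ) + t₂ * I) *
        (zetaAway r (((1 / 2 : ℝ) + t₁ * I) + ((3 / 4 : ℝ) + t₂ * I)) *
          arithFactor r (((1 / 2 : ℝ) + t₁ * I) + s₂) (((3 / 4 : ℝ) + t₂ * I) + s₁) (s₁ + s₂))‖ ≤
      2 * (coeffKernelConst * m₂ ^ 7 * E * Real.pi) * (1 + |t₁|) ^ 4 := by
    intro t₁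
    set z₁ : ℂ := ((1 / 2 : ℝ) : ℂ) + t₁ * I with hz₁
    have h1 : z₁.re = 1 / 2 := by simp [hz₁]
    have h1i : z₁.im = t₁ := by simp [hz₁]
    have h0 := abs_nonneg t₁
    obtain ⟨hbi, hbv⟩ := integral_coeffKernel_mul_charAvg_inner D hm₂ z₁
    obtain ⟨hMi, hMi', hMv⟩ :=
      integral_coeffKernel_mul_ratiosMainTerm hr hζ hε h1 h3 h4 hm₂
    have hsi : Integrable fun t₂ : ℝ => coeffKernel m₂ ((3 / 4 : ℝ) + t₂ * I) *
        mainSecond r s₁ s₂ z₁ ((3 / 4 : ℝ) + t₂ * I) := by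
      refine (hMi'.sub (hfirst t₁)).congr (ae_of_all _ fun t₂ => ?_)
      simp only [Pi.sub_apply, mainFirst]
      ring
    have hsplit : charAvg r (fun χ =>
          DirichletCharacter.LFunction χ z₁ * star χ (m₂ : ZMod r) / D χ) -
        ∫ t₂ : ℝ, coeffKernel m₂ ((3 / 4 : ℝ) + t₂ * I) *
          (zetaAway r (z₁ + ((3 / 4 : ℝ) + t₂ * I)) *
            arithFactor r (z₁ + s₂) (((3 / 4 : ℝ) + t₂ * I) + s₁) (s₁ + s₂)) =
        (∫ t₂ : ℝ, coeffKernel m₂ ((1 / 2 : ℝ) + t₂ * I) *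
          (charAvg r (fun χ => DirichletCharacter.LFunction χ z₁ *
            DirichletCharacter.LFunction (star χ) ((1 / 2 : ℝ) + t₂ * I) / D χ) -
              ratiosMainTerm r z₁ ((1 / 2 : ℝ) + t₂ * I) s₁ s₂)) +
        ∫ t₂ : ℝ, coeffKernel m₂ ((3 / 4 : ℝ) + t₂ * I) *
          mainSecond r s₁ s₂ z₁ ((3 / 4 : ℝ) + t₂ * I) := by
      have e1 := integral_sub hbi hMi
      have e2 := integral_add (hfirst t₁) hsi
      simp_rw [← mul_sub] at e1
      simp_rw [← mul_add] at e2
      rw [e1, hbv, hMv]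
      simp only [mainFirst]
      rw [e2]
      ring
    rw [hsplit]
    have b1 : ‖∫ t₂ : ℝ, coeffKernel m₂ ((1 / 2 : ℝ) + t₂ * I) *
          (charAvg r (fun χ => DirichletCharacter.LFunction χ z₁ *
            DirichletCharacter.LFunction (star χ) ((1 / 2 : ℝ) + t₂ * I) / D χ) -
              ratiosMainTerm r z₁ ((1 / 2 : ℝ) + t₂ * I) s₁ s₂)‖ ≤
        coeffKernelConst * m₂ ^ 7 * (E * (1 + |t₁|) ^ 4) * Real.pi := by
      refine norm_integral_coeffKernel_mul_le hm₂ le_rfl (by norm_num) (by positivity) ?_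
      -- The point `z₁ + z₂ = 1`, where nothing is assumed, is a null set of the line.
      have hne : ∀ᵐ t : ℝ, t ≠ -t₁ := by
        simp [ae_iff, measure_singleton]
      filter_upwards [hne] with t₂ ht
      have h2 : (((1 / 2 : ℝ) : ℂ) + t₂ * I).re = 1 / 2 := by simp
      have h2i : (((1 / 2 : ℝ) : ℂ) + t₂ * I).im = t₂ := by simp
      have h12 : z₁ + (((1 / 2 : ℝ) : ℂ) + t₂ * I) ≠ 1 := by
        intro h
        have := congrArg Complex.im h
        rw [add_im, h1i, h2i, one_im] at this
        exact ht (by linarith)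
      refine (havg z₁ _ h1 h2 h12).trans ?_
      rw [h1i, h2i]
      have h0' := abs_nonneg t₂
      gcongr
      · exact le_self_pow₀ (by linarith) (by norm_num)
      · exact le_self_pow₀ (by linarith) (by norm_num)
    have b2 : ‖∫ t₂ : ℝ, coeffKernel m₂ ((3 / 4 : ℝ) + t₂ * I) *
          mainSecond r s₁ s₂ z₁ ((3 / 4 : ℝ) + t₂ * I)‖ ≤
        coeffKernelConst * m₂ ^ 7 * (E * (1 + |t₁|) ^ 4) * Real.pi := by
      refine norm_integral_coeffKernel_mul_le hm₂ (by norm_num) (by norm_num) (by positivity)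
        (ae_of_all _ fun t₂ => ?_)
      refine (hsec z₁ _ h1 (by simp)).trans ?_
      rw [h1i, show (((3 / 4 : ℝ) : ℂ) + t₂ * I).im = t₂ by simp]
      have h0' := abs_nonneg t₂
      gcongr
      · linarith
      · norm_num
      · linarith
      · norm_num
    refine (norm_add_le _ _).trans ((add_le_add b1 b2).trans (le_of_eq ?_))
    ring
  refine (norm_integral_coeffKernel_mul_le hm₁ le_rfl (by norm_num) (by positivity)
    (ae_of_all _ hdiff)).trans (le_of_eq ?_)
  ring

end

theorem mainTheorem7
    (hGRH : ∀ (r : ℕ) [Fact r.Prime], 2 < r → GRHModulus r)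
    (hRatios : RatiosConjecture) :
    ∃ ω' : ℝ, 0 < ω' ∧ ω' ≤ 1 / 2 ∧ ∃ ε₀ : ℝ, 0 < ε₀ ∧ ∃ ℏ₀ : ℝ, 0 < ℏ₀ ∧
      ∀ ε : ℝ, 0 < ε → ε < ε₀ → ∃ C : ℝ, ∀ ℏ : ℝ, 0 < ℏ → ℏ < ℏ₀ →
        ∀ (r : ℕ) [Fact r.Prime], 2 < r →
          ∀ m₁ m₂ : ℕ, 1 ≤ m₁ → 1 ≤ m₂ → (m₁ : ℝ) ≤ (r : ℝ) ^ ℏ → (m₂ : ℝ) ≤ (r : ℝ) ^ ℏ →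
            ∀ s₁ s₂ : ℂ, s₁.re = 1 / 2 + ε → s₂.re = 1 / 2 + ε →
              Summable (steinhausTwistedTerm r m₁ m₂ s₁ s₂) ∧
              ‖charAvg r (fun χ => (χ (m₁ : ZMod r) * star χ (m₂ : ZMod r)) /
                  (DirichletCharacter.LFunction χ s₁ *
                    DirichletCharacter.LFunction (star χ) s₂)) -
                ∑' k : ℕ × ℕ, steinhausTwistedTerm r m₁ m₂ s₁ s₂ k‖ ≤
              C * (1 + max |s₁.im| |s₂.im|) ^ ε * (r : ℝ) ^ (-ω') := by
  have hζ : ZetaNeZeroRightHalf := by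
    have : Fact (Nat.Prime 3) := ⟨by norm_num⟩
    exact zetaNeZeroRightHalf_of_GRHModulus (hGRH 3 (by norm_num))
  obtain ⟨ω, hω0, hω, ε₁, hε₁, hR⟩ := hRatios
  set ω₁ : ℝ := min ω (1 / 4) with hω₁
  have hω₁0 : 0 < ω₁ := lt_min hω0 (by norm_num)
  have hω₁1 : ω₁ ≤ 1 / 4 := min_le_right _ _
  -- The twist costs `m₁⁷ m₂⁷ ≤ r^(14 ℏ)`, which takes at most half of the saving `r^(-ω₁)`.
  refine ⟨ω₁ / 2, by positivity, by linarith, min ε₁ 1, lt_min hε₁ one_pos, ω₁ / 28,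
    by positivity, fun ε hε hε2 => ?_⟩
  have hε1 : ε ≤ 1 := (hε2.trans_le (min_le_right _ _)).le
  obtain ⟨A, hA⟩ := hR ε hε (hε2.trans_le (min_le_left _ _))
  obtain ⟨B, hB0, hB⟩ := exists_norm_mainSecond_le hζ hε hε1
  refine ⟨2 * (coeffKernelConst * Real.pi) ^ 2 * (|A| + B), ?_⟩
  intro ℏ _ hℏ r _ hr2 m₁ m₂ hm₁ hm₂ hm₁r hm₂r s₁ s₂ h3 h4
  have hr : r.Prime := Fact.out
  refine ⟨(integral_integral_coeffKernel_mul_ratio hr hm₁ hm₂ (by linarith) (by linarith)).1, ?_⟩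
  have hr1 : (1 : ℝ) ≤ r := by exact_mod_cast hr.one_le
  have hr0 : (0 : ℝ) < r := by linarith
  have hKc := coeffKernelConst_pos
  have hT0 : 0 ≤ max |s₁.im| |s₂.im| := (abs_nonneg _).trans (le_max_left _ _)
  have hsave : ∀ x : ℝ, ω₁ ≤ x → (r : ℝ) ^ (-x) ≤ (r : ℝ) ^ (-ω₁) := fun x hx =>
    Real.rpow_le_rpow_of_exponent_le hr1 (by linarith)
  have hA0 := abs_nonneg A
  set P : ℝ := (1 + max |s₁.im| |s₂.im|) ^ ε with hP
  have hP0 : 0 ≤ P := by positivity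
  have key := norm_charAvg_sub_tsum_le (r := r) hζ (E := (|A| + B) * P * (r : ℝ) ^ (-ω₁)) hε
    (by positivity) h3 h4 ?_ ?_ hm₁ hm₂
  · refine key.trans ?_
    have hm : ∀ m : ℕ, (m : ℝ) ≤ (r : ℝ) ^ ℏ → (m : ℝ) ^ 7 ≤ (r : ℝ) ^ (ω₁ / 4) := by
      intro m h
      calc (m : ℝ) ^ 7 ≤ ((r : ℝ) ^ ℏ) ^ 7 := by gcongr
        _ = (r : ℝ) ^ (ℏ * (7 : ℕ)) := by rw [Real.rpow_mul hr0.le, Real.rpow_natCast]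
        _ ≤ _ := Real.rpow_le_rpow_of_exponent_le hr1 (by push_cast; linarith)
    calc _ ≤ 2 * (coeffKernelConst * Real.pi) ^ 2 * ((|A| + B) * P * (r : ℝ) ^ (-ω₁)) *
          ((r : ℝ) ^ (ω₁ / 4) * (r : ℝ) ^ (ω₁ / 4)) := by
          gcongr
          · exact hm m₁ hm₁r
          · exact hm m₂ hm₂r
      _ = 2 * (coeffKernelConst * Real.pi) ^ 2 * (|A| + B) * P *
          ((r : ℝ) ^ (-ω₁) * ((r : ℝ) ^ (ω₁ / 4) * (r : ℝ) ^ (ω₁ / 4))) := by ring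
      _ = _ := by
          rw [← Real.rpow_add hr0, ← Real.rpow_add hr0]
          congr 2
          ring
  · intro z₁ z₂ h1 h2 h12
    have h5 := hA r hr2 z₁ z₂ s₁ s₂ h1 h2 h12 h3 h4
    refine h5.trans ?_
    rw [div_eq_mul_inv, ← Real.rpow_neg hr0.le]
    calc _ ≤ |A| * (P * (1 + |z₁.im|) * (1 + |z₂.im|)) * (r : ℝ) ^ (-ω₁) := by
          gcongr
          · exact le_abs_self A
          · exact one_add_max_rpow_le hε hε1
          · exact min_le_left _ _
      _ = |A| * P * (r : ℝ) ^ (-ω₁) * (1 + |z₁.im|) * (1 + |z₂.im|) := by ring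
      _ ≤ _ := by
          gcongr
          linarith
  · intro z₁ z₂ h1 h2
    refine (hB r hr s₁ s₂ z₁ z₂ h3 h4 h1 h2).trans ?_
    have h6 : (1 + |s₂.im|) ^ ε ≤ P :=
      Real.rpow_le_rpow (by positivity) (by gcongr; exact le_max_right _ _) hε.le
    calc _ ≤ B * (r : ℝ) ^ (-ω₁) * P * (1 + |z₁.im|) ^ 2 * (1 + |z₂.im|) ^ 3 := by
          gcongr
      _ = B * P * (r : ℝ) ^ (-ω₁) * (1 + |z₁.im|) ^ 2 * (1 + |z₂.im|) ^ 3 := by ring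
      _ ≤ _ := by
          gcongr
          linarith
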